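/- Let $(Y_i,A_i,\mathbf X_i)$, $i=1,2,\dots$, be i.i.d. with $Y_i\in\mathbb R$, $A_i\in\{0,1\}$, $\mathbf X_i\in\mathbb R^p$, and let $Y_i^{(1)},Y_i^{(0)}$ be potential outcomes satisfying (A1) $(Y_i^{(1)},Y_i^{(0)})\perp A_i\mid \mathbf X_i$, (A2) overlap: $c\le e(\mathbf X_i)\le 1-c$ a.s. for some $c>0$, where $e(\mathbf x)=P(A_i=1\mid \mathbf X_i=\mathbf x)$, and (A3) $Y_i=Y_i^{(a)}$ if $A_i=a$. Let $M:\mathbb R^p\to\{1,\dots,G\}$ be a fixed grouping function, $\mathbf I(\mathbf x)=(I\{M(\mathbf x)=1\},\dots,I\{M(\mathbf x)=G\})^\top$, $\tau_g=E\{Y_i^{(1)}-Y_i^{(0)}\mid M(\mathbf X_i)=g\}$, $\boldsymbol\tau=(\tau_1,\dots,\tau_G)^\top$, $\tau(\mathbf x)=E\{Y_i^{(1)}-Y_i^{(0)}\mid\mathbf X_i=\mathbf x\}$. The effect $\tau(\mathbf x)$ is not assumed to be constant within groups. Put $\delta(\mathbf x)=\tau(\mathbf x)-\sum_g\tau_g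 I\{M(\mathbf x)=g\}$ and $$\epsilon_i=Y_i-E\{Y_i^{(0)}\mid\mathbf X_i\}-A_i\sum_{g}\tau_gI\{M(\mathbf X_i)=g\}-A_i\delta(\mathbf X_i).$$ For even $N$, split $\{1,\dots,N\}$ at random, independently of the data, into disjoint halves $\mathcal I_1,\mathcal I_2$ of size $N/2$; for $k=1,2$ let $\widehat E_k(\cdot)$ and $\widehat e_k(\cdot)$ be estimates of $\mathbf x\mapsto E(Y_i\mid\mathbf X_i=\mathbf x)$ and $e$ computed from the data in $\mathcal I_k^C$ (possibly with auxiliary randomness independent of the data), with $\widehat e_k$ uniformly bounded. With $\|h\|_{P,r}=\{\int|h|^r\,dP_{\mathbf X}\}^{1/r}$ for fixed $h$, assume (a) $E(Y_i^4)<\infty$, $E(\epsilon_i^2\mid\mathbf X_i)$ is bounded, and $P\{M(\mathbf X_i)=g\}\ge c_1>0$ for all $g$; (b) $\|\widehat E_k\|_{P,4}$ is bounded in probability; (c) $\|\widehat E_k-E(Y_i\mid\mathbf X_i=\cdot)\|_{P,2}\to0$, $\sqrt N\,\|\widehat e_k-e\|_{P,2}^2\to0$ and $\sqrt N\,\|\widehat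 e_k-e\|_{P,2}\,\|\widehat E_k-E(Y_i\mid\mathbf X_i=\cdot)\|_{P,2}\to0$ in probability as $N\to\infty$. Let $$\widehat{\boldsymbol\tau}_{\rm SSLS}=\Big[\sum_{k=1}^2\sum_{i\in\mathcal I_k}\{A_i-\widehat e_k(\mathbf X_i)\}^2\mathbf I(\mathbf X_i)\mathbf I(\mathbf X_i)^\top\Big]^{-1}\Big[\sum_{k=1}^2\sum_{i\in\mathcal I_k}\{Y_i-\widehat E_k(\mathbf X_i)\}\{A_i-\widehat e_k(\mathbf X_i)\}\mathbf I(\mathbf X_i)\Big],$$ $\widehat\epsilon_{ki}=Y_i-\widehat E_k(\mathbf X_i)-\{A_i-\widehat e_k(\mathbf X_i)\}\mathbf I(\mathbf X_i)^\top\widehat{\boldsymbol\tau}_{\rm SSLS}$, and $$\widehat\Sigma_{gg}=\frac{\frac1N\sum_{k}\sum_{i\in\mathcal I_k}\widehat\epsilon_{ki}^{\,2}\{A_i-\widehat e_k(\mathbf X_i)\}^2I\{M(\mathbf X_i)=g\}}{\big[\frac1N\sum_k\sum_{i\in\mathcal I_k}\{A_i-\widehat e_k(\mathbf X_i)\}^2I\{M(\mathbf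 X_i)=g\}\big]^2}.$$ If for each $g$ the propensity score $e(\mathbf X_i)$ is a.s. constant on $\{M(\mathbf X_i)=g\}$, then, as $N\to\infty$ through even $N$, $$\sqrt N\,(\widehat{\boldsymbol\tau}_{\rm SSLS}-\boldsymbol\tau)\xrightarrow{D}N(0,\Sigma'),\qquad \Sigma'=E(\mathbf V^*\mathbf V^{*\top})^{-1}E(\epsilon'^2\,\mathbf V^*\mathbf V^{*\top})E(\mathbf V^*\mathbf V^{*\top})^{-1},$$ with $\mathbf V^*=\{A_i-e(\mathbf X_i)\}\mathbf I(\mathbf X_i)$ and $\epsilon'=\{A_i-e(\mathbf X_i)\}\delta(\mathbf X_i)+\epsilon_i$. The matrix $\Sigma'$ is diagonal with $$\Sigma'_{gg}=\frac{E\big[\{A_i-e(\mathbf X_i)\}^4\delta(\mathbf X_i)^2I\{M(\mathbf X_i)=g\}\big]+E\big[\epsilon_i^2\{A_i-e(\mathbf X_i)\}^2I\{M(\mathbf X_i)=g\}\big]}{\big(E[\{A_i-e(\mathbf X_i)\}^2I\{M(\mathbf X_i)=g\}]\big)^2},$$ and $\widehat\Sigma_{gg}\to\Sigma'_{gg}$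 in probability for every $g$. -/

import Mathlib

open MeasureTheory ProbabilityTheory Filter Topology
open scoped ENNReal NNReal

noncomputable section

namespace SSLS

/-- The covariate space `ℝ^p`. -/
abbrev Cov (p : ℕ) := EuclideanSpace ℝ (Fin p)

/-- One observation `(Y, A, X)`. -/
abbrev Obs (p : ℕ) := ℝ × ℝ × Cov p

/-- `Z n = o_P(1)` for nonnegative extended real random quantities `Z n`. -/
def TendstoZeroInProb {Ω : Type*} [MeasurableSpace Ω] (μ : Measure Ω)
    (Z : ℕ → Ω → ℝ≥0∞) : Prop :=
  ∀ η : ℝ≥0∞, 0 < η → Tendsto (fun n => μ {ω | η ≤ Z n ω}) atTop (𝓝 0)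

/-- `Z n = O_P(1)` for nonnegative extended real random quantities `Z n`. -/
def BoundedInProb {Ω : Type*} [MeasurableSpace Ω] (μ : Measure Ω)
    (Z : ℕ → Ω → ℝ≥0∞) : Prop :=
  ∀ η : ℝ≥0∞, 0 < η → ∃ C : ℝ≥0, ∀ᶠ n in atTop, μ {ω | (C : ℝ≥0∞) < Z n ω} ≤ η

/-- The regression function `x ↦ E(Z | X = x)`. -/
def condMean {Ω : Type*} [MeasurableSpace Ω] {p : ℕ} (μ : Measure Ω) [IsFiniteMeasure μ]
    (Z : Ω → ℝ) (X : Ω → Cov p) (x : Cov p) : ℝ :=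
  ∫ z, z ∂(condDistrib Z X μ x)

/-- The group membership indicator `I{M(x) = g}`, i.e. the `g`-th entry of the vector `I(x)`. -/
def groupInd {p G : ℕ} (M : Cov p → Fin G) (x : Cov p) (g : Fin G) : ℝ :=
  if M x = g then 1 else 0

/-- The random variables of the study: for each individual `i`, potential outcomes `Y1 i`, `Y0 i`
under treatment and control, observed outcome `Y i`, treatment `A i` and covariates `X i`. -/
structure Study (Ω : Type*) (p : ℕ) where
  Y1 : ℕ → Ω → ℝ
  Y0 : ℕ → Ω → ℝ
  Y : ℕ → Ω → ℝ
  A : ℕ → Ω → ℝ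
  X : ℕ → Ω → Cov p

namespace Study

variable {Ω : Type*} {p G : ℕ}

/-- The observation of individual `i`. -/
def obs (D : Study Ω p) (i : ℕ) (ω : Ω) : Obs p := (D.Y i ω, D.A i ω, D.X i ω)

/-- The whole sequence of observations. -/
def data (D : Study Ω p) (ω : Ω) : ℕ → Obs p := fun i => D.obs i ω

variable [MeasurableSpace Ω]

/-- The law of the covariates. The observations are identically distributed, so individual `0`
serves as the generic individual here and below. -/
def lawX (D : Study Ω p) (μ : Measure Ω) : Measure (Cov p) := μ.map (D.X 0)

/-- The propensity score `e(x) = P(A = 1 | X = x)`. -/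
def propensity (D : Study Ω p) (μ : Measure Ω) [IsFiniteMeasure μ] (x : Cov p) : ℝ :=
  (condDistrib (D.A 0) (D.X 0) μ x).real {1}

/-- The outcome regression `E(Y | X = x)`. -/
def outcomeReg (D : Study Ω p) (μ : Measure Ω) [IsFiniteMeasure μ] (x : Cov p) : ℝ :=
  condMean μ (D.Y 0) (D.X 0) x

/-- The conditional average treatment effect `τ(x) = E(Y1 - Y0 | X = x)`. -/
def cate (D : Study Ω p) (μ : Measure Ω) [IsFiniteMeasure μ] (x : Cov p) : ℝ :=
  condMean μ (fun ω => D.Y1 0 ω - D.Y0 0 ω) (D.X 0) x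

/-- The group average treatment effect `τ_g = E(Y1 - Y0 | M(X) = g)`. -/
def tau (D : Study Ω p) (μ : Measure Ω) (M : Cov p → Fin G) (g : Fin G) : ℝ :=
  ∫ ω, (D.Y1 0 ω - D.Y0 0 ω) ∂(cond μ {ω | M (D.X 0 ω) = g})

/-- The within-group deviation of the effect, `δ(x) = τ(x) - ∑ g, τ_g I{M(x) = g}`. -/
def delta (D : Study Ω p) (μ : Measure Ω) [IsFiniteMeasure μ] (M : Cov p → Fin G)
    (x : Cov p) : ℝ :=
  D.cate μ x - ∑ g, D.tau μ M g * groupInd M x g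

/-- The error `ε` of the outcome model with bias term,
`Y - E(Y0 | X) - A ∑ g, τ_g I{M(X) = g} = A δ(X) + ε`. -/
def eps (D : Study Ω p) (μ : Measure Ω) [IsFiniteMeasure μ] (M : Cov p → Fin G)
    (ω : Ω) : ℝ :=
  D.Y 0 ω - condMean μ (D.Y0 0) (D.X 0) (D.X 0 ω)
    - D.A 0 ω * ∑ g, D.tau μ M g * groupInd M (D.X 0 ω) g
    - D.A 0 ω * D.delta μ M (D.X 0 ω)

/-- The regressor `V* = {A - e(X)} I(X)`. -/
def Vstar (D : Study Ω p) (μ : Measure Ω) [IsFiniteMeasure μ] (M : Cov p → Fin G)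
    (g : Fin G) (ω : Ω) : ℝ :=
  (D.A 0 ω - D.propensity μ (D.X 0 ω)) * groupInd M (D.X 0 ω) g

/-- The error of the transformed model, `ε' = {A - e(X)} δ(X) + ε`. -/
def eps' (D : Study Ω p) (μ : Measure Ω) [IsFiniteMeasure μ] (M : Cov p → Fin G)
    (ω : Ω) : ℝ :=
  (D.A 0 ω - D.propensity μ (D.X 0 ω)) * D.delta μ M (D.X 0 ω) + D.eps μ M ω

/-- The asymptotic covariance `Σ' = E(V* V*ᵀ)⁻¹ E(ε'² V* V*ᵀ) E(V* V*ᵀ)⁻¹`. -/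
def Sigma' (D : Study Ω p) (μ : Measure Ω) [IsFiniteMeasure μ] (M : Cov p → Fin G) :
    Matrix (Fin G) (Fin G) ℝ :=
  (Matrix.of fun g h => ∫ ω, D.Vstar μ M g ω * D.Vstar μ M h ω ∂μ)⁻¹
    * (Matrix.of fun g h => ∫ ω, D.eps' μ M ω ^ 2 * (D.Vstar μ M g ω * D.Vstar μ M h ω) ∂μ)
    * (Matrix.of fun g h => ∫ ω, D.Vstar μ M g ω * D.Vstar μ M h ω ∂μ)⁻¹

/-- `E[{A - e(X)}² I{M(X) = g}]`. -/
def denom (D : Study Ω p) (μ : Measure Ω) [IsFiniteMeasure μ] (M : Cov p → Fin G)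
    (g : Fin G) : ℝ :=
  ∫ ω, (D.A 0 ω - D.propensity μ (D.X 0 ω)) ^ 2 * groupInd M (D.X 0 ω) g ∂μ

/-- The variance `Σ_gg` of the correctly specified model. -/
def SigmaDiag (D : Study Ω p) (μ : Measure Ω) [IsFiniteMeasure μ] (M : Cov p → Fin G)
    (g : Fin G) : ℝ :=
  (∫ ω, D.eps μ M ω ^ 2 * (D.A 0 ω - D.propensity μ (D.X 0 ω)) ^ 2
      * groupInd M (D.X 0 ω) g ∂μ) / D.denom μ M g ^ 2

/-- The variance `Σ'_gg`: `Σ_gg` plus the contribution of the bias term `δ`. -/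
def SigmaDiag' (D : Study Ω p) (μ : Measure Ω) [IsFiniteMeasure μ] (M : Cov p → Fin G)
    (g : Fin G) : ℝ :=
  (∫ ω, (D.A 0 ω - D.propensity μ (D.X 0 ω)) ^ 4 * D.delta μ M (D.X 0 ω) ^ 2
      * groupInd M (D.X 0 ω) g ∂μ) / D.denom μ M g ^ 2
    + D.SigmaDiag μ M g

/-- Binary treatment, i.i.d. observations, and the causal assumptions: consistency (SUTVA),
conditional unconfoundedness given `X = x`, and overlap. -/
structure IsCausal (D : Study Ω p) (μ : Measure Ω) [IsProbabilityMeasure μ] : Prop where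
  meas_Y1 : ∀ i, Measurable (D.Y1 i)
  meas_Y0 : ∀ i, Measurable (D.Y0 i)
  meas_Y : ∀ i, Measurable (D.Y i)
  meas_A : ∀ i, Measurable (D.A i)
  meas_X : ∀ i, Measurable (D.X i)
  binary : ∀ i ω, D.A i ω = 0 ∨ D.A i ω = 1
  indep : iIndepFun D.obs μ
  identDistrib : ∀ i, IdentDistrib (D.obs i) (D.obs 0) μ μ
  consistency : ∀ i ω, (D.A i ω = 1 → D.Y i ω = D.Y1 i ω) ∧ (D.A i ω = 0 → D.Y i ω = D.Y0 i ω)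
  unconfounded : ∀ i, ∀ᵐ x ∂(μ.map (D.X i)),
    condDistrib (fun ω => ((D.Y1 i ω, D.Y0 i ω), D.A i ω)) (D.X i) μ x
      = (condDistrib (fun ω => (D.Y1 i ω, D.Y0 i ω)) (D.X i) μ x).prod
          (condDistrib (D.A i) (D.X i) μ x)
  overlap : ∃ c : ℝ, 0 < c ∧
    ∀ᵐ x ∂(D.lawX μ), c ≤ D.propensity μ x ∧ D.propensity μ x ≤ 1 - c

end Study

/-- A cross-fitting scheme for the sample sizes `N = 2n`. The seed `u : 𝒰` carries the random
sample split and any internal randomness of the learning algorithms; `split n u` is the first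
half-sample; `Ehat n k u d` and `ehat n k u d` are the estimates `Ê_k(Y | X = ·)` and `ê_k(·)`
computed from the data `d`. -/
structure CrossFit (𝒰 : Type*) (p : ℕ) where
  split : ℕ → 𝒰 → Finset ℕ
  Ehat : ℕ → Fin 2 → 𝒰 → (ℕ → Obs p) → Cov p → ℝ
  ehat : ℕ → Fin 2 → 𝒰 → (ℕ → Obs p) → Cov p → ℝ

namespace CrossFit

variable {𝒰 : Type*} {p G : ℕ}

/-- The half-sample `I_k` of `{0, …, 2n - 1}`. -/
def fold (L : CrossFit 𝒰 p) (n : ℕ) (u : 𝒰) (k : Fin 2) : Finset ℕ :=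
  if k = 0 then L.split n u else Finset.range (2 * n) \ L.split n u

/-- The split consists of two halves of equal size, and the `k`-th estimates are (jointly
measurable) functions of the seed and of the data in the complement of `I_k` only. -/
structure IsValid [MeasurableSpace 𝒰] (L : CrossFit 𝒰 p) : Prop where
  split_mem : ∀ n u, L.split n u ∈ Finset.powersetCard n (Finset.range (2 * n))
  meas_split : ∀ n, Measurable (L.split n)
  meas_Ehat : ∀ n k,
    Measurable (fun z : 𝒰 × (ℕ → Obs p) × Cov p => L.Ehat n k z.1 z.2.1 z.2.2)
  meas_ehat : ∀ n k,
    Measurable (fun z : 𝒰 × (ℕ → Obs p) × Cov p => L.ehat n k z.1 z.2.1 z.2.2)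
  Ehat_congr : ∀ n k u (d d' : ℕ → Obs p),
    (∀ i ∈ Finset.range (2 * n) \ L.fold n u k, d i = d' i) → L.Ehat n k u d = L.Ehat n k u d'
  ehat_congr : ∀ n k u (d d' : ℕ → Obs p),
    (∀ i ∈ Finset.range (2 * n) \ L.fold n u k, d i = d' i) → L.ehat n k u d = L.ehat n k u d'
  ehat_bounded : ∃ B : ℝ, ∀ n k u d x, |L.ehat n k u d x| ≤ B

/-- The residualized treatment `A_i - ê_k(X_i)`. -/
def resA (L : CrossFit 𝒰 p) (n : ℕ) (u : 𝒰) (d : ℕ → Obs p) (k : Fin 2) (i : ℕ) : ℝ :=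
  (d i).2.1 - L.ehat n k u d (d i).2.2

/-- The residualized outcome `Y_i - Ê_k(Y_i | X_i)`. -/
def resY (L : CrossFit 𝒰 p) (n : ℕ) (u : 𝒰) (d : ℕ → Obs p) (k : Fin 2) (i : ℕ) : ℝ :=
  (d i).1 - L.Ehat n k u d (d i).2.2

/-- The estimator
`τ̂ = [∑ₖ ∑_{i ∈ I_k} (A_i - ê_k)² I(X_i) I(X_i)ᵀ]⁻¹ [∑ₖ ∑_{i ∈ I_k} (Y_i - Ê_k)(A_i - ê_k) I(X_i)]`
at sample size `2n`. -/
def tauHat (L : CrossFit 𝒰 p) (M : Cov p → Fin G) (n : ℕ) (u : 𝒰) (d : ℕ → Obs p) :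
    Fin G → ℝ :=
  (∑ k, ∑ i ∈ L.fold n u k, L.resA n u d k i ^ 2 •
      Matrix.vecMulVec (groupInd M (d i).2.2) (groupInd M (d i).2.2))⁻¹.mulVec
    (∑ k, ∑ i ∈ L.fold n u k,
      (L.resY n u d k i * L.resA n u d k i) • groupInd M (d i).2.2)

/-- The residual `ε̂_ki = Y_i - Ê_k(Y_i | X_i) - {A_i - ê_k(X_i)} I(X_i)ᵀ τ̂`. -/
def epsHat (L : CrossFit 𝒰 p) (M : Cov p → Fin G) (n : ℕ) (u : 𝒰) (d : ℕ → Obs p)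
    (k : Fin 2) (i : ℕ) : ℝ :=
  L.resY n u d k i
    - L.resA n u d k i * ∑ g, groupInd M (d i).2.2 g * L.tauHat M n u d g

/-- The plug-in variance estimator `Σ̂_gg` at sample size `2n`. -/
def SigmaHat (L : CrossFit 𝒰 p) (M : Cov p → Fin G) (n : ℕ) (u : 𝒰) (d : ℕ → Obs p)
    (g : Fin G) : ℝ :=
  (1 / (2 * n : ℝ) * ∑ k, ∑ i ∈ L.fold n u k,
      L.epsHat M n u d k i ^ 2 * L.resA n u d k i ^ 2 * groupInd M (d i).2.2 g)
    / (1 / (2 * n : ℝ) * ∑ k, ∑ i ∈ L.fold n u k,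
        L.resA n u d k i ^ 2 * groupInd M (d i).2.2 g) ^ 2

/-- `√N (τ̂ - τ)` at sample size `N = 2n`. -/
def scaledError (L : CrossFit 𝒰 p) (M : Cov p → Fin G) (τ : Fin G → ℝ) (n : ℕ) (u : 𝒰)
    (d : ℕ → Obs p) : EuclideanSpace ℝ (Fin G) :=
  WithLp.toLp 2 (Real.sqrt (2 * n : ℝ) • (L.tauHat M n u d - τ))

end CrossFit

section Conditions

variable {Ω 𝒰 : Type*} [MeasurableSpace Ω] {p G : ℕ}

/-- `‖Ê_k(Y | X) - E(Y | X)‖_{P,2}` at sample size `2n`. -/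
def errE (D : Study Ω p) (μ : Measure Ω) [IsFiniteMeasure μ] (L : CrossFit 𝒰 p) (U : Ω → 𝒰)
    (k : Fin 2) (n : ℕ) (ω : Ω) : ℝ≥0∞ :=
  eLpNorm (fun x => L.Ehat n k (U ω) (D.data ω) x - D.outcomeReg μ x) 2 (D.lawX μ)

/-- `‖ê_k(X) - e(X)‖_{P,2}` at sample size `2n`. -/
def errProp (D : Study Ω p) (μ : Measure Ω) [IsFiniteMeasure μ] (L : CrossFit 𝒰 p) (U : Ω → 𝒰)
    (k : Fin 2) (n : ℕ) (ω : Ω) : ℝ≥0∞ :=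
  eLpNorm (fun x => L.ehat n k (U ω) (D.data ω) x - D.propensity μ x) 2 (D.lawX μ)

/-- The regularity conditions: bounded moments, groups of positive probability, and convergence
of the cross-fitted nuisance estimates. -/
structure Regular (D : Study Ω p) (μ : Measure Ω) [IsFiniteMeasure μ] (M : Cov p → Fin G)
    (L : CrossFit 𝒰 p) (U : Ω → 𝒰) : Prop where
  moment_Y : MemLp (D.Y 0) 4 μ
  moment_eps : ∃ C : ℝ, ∀ᵐ x ∂(D.lawX μ),
    condMean μ (fun ω => D.eps μ M ω ^ 2) (D.X 0) x ≤ C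
  group_pos : ∃ c : ℝ, 0 < c ∧ ∀ g, c ≤ μ.real {ω | M (D.X 0 ω) = g}
  moment_Ehat : ∀ k, BoundedInProb μ (fun n ω =>
    eLpNorm (L.Ehat n k (U ω) (D.data ω)) 4 (D.lawX μ))
  consistent_Ehat : ∀ k, TendstoZeroInProb μ (errE D μ L U k)
  rate_ehat : ∀ k, TendstoZeroInProb μ (fun n ω =>
    ENNReal.ofReal (Real.sqrt (2 * n : ℝ)) * errProp D μ L U k n ω ^ 2)
  rate_product : ∀ k, TendstoZeroInProb μ (fun n ω =>
    ENNReal.ofReal (Real.sqrt (2 * n : ℝ))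
      * (errProp D μ L U k n ω * errE D μ L U k n ω))

end Conditions

end SSLS

end

namespace SSLS

/-! ### Convergence in probability -/

section InProbability

variable {Ω : Type*} [MeasurableSpace Ω] {μ : Measure Ω}

lemma TendstoZeroInProb.mono {Z W : ℕ → Ω → ℝ≥0∞} (hW : TendstoZeroInProb μ W)
    (h : ∀ n ω, Z n ω ≤ W n ω) : TendstoZeroInProb μ Z := fun η hη =>
  tendsto_of_tendsto_of_tendsto_of_le_of_le tendsto_const_nhds (hW η hη) (fun _ => zero_le)
    fun n => measure_mono fun ω (hω : η ≤ Z n ω) => hω.trans (h n ω)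

lemma TendstoZeroInProb.mono_of_pos {Z W : ℕ → Ω → ℝ≥0∞} (hW : TendstoZeroInProb μ W)
    (h : ∀ n, 0 < n → ∀ ω, Z n ω ≤ W n ω) : TendstoZeroInProb μ Z := fun η hη =>
  tendsto_of_tendsto_of_tendsto_of_le_of_le' tendsto_const_nhds (hW η hη)
    (Eventually.of_forall fun _ => zero_le) <| (eventually_gt_atTop 0).mono fun n hn =>
      measure_mono fun ω (hω : η ≤ Z n ω) => hω.trans (h n hn ω)

lemma TendstoZeroInProb.add {Z W : ℕ → Ω → ℝ≥0∞} (hZ : TendstoZeroInProb μ Z)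
    (hW : TendstoZeroInProb μ W) : TendstoZeroInProb μ (fun n ω => Z n ω + W n ω) := by
  intro η hη
  have h2 : 0 < η / 2 := ENNReal.half_pos hη.ne'
  have := (hZ _ h2).add (hW _ h2)
  rw [add_zero] at this
  refine tendsto_of_tendsto_of_tendsto_of_le_of_le tendsto_const_nhds this (fun _ => zero_le)
    fun n => (measure_mono fun ω (hω : η ≤ Z n ω + W n ω) => ?_).trans (measure_union_le _ _)
  by_contra hcon
  simp only [Set.mem_union, Set.mem_ofPred_eq, not_or, not_le] at hcon
  have := ENNReal.add_lt_add hcon.1 hcon.2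
  rw [ENNReal.add_halves] at this
  exact absurd hω this.not_ge

lemma TendstoZeroInProb.const_mul {Z : ℕ → Ω → ℝ≥0∞} (hZ : TendstoZeroInProb μ Z) {c : ℝ≥0∞}
    (hc : c ≠ ∞) : TendstoZeroInProb μ (fun n ω => c * Z n ω) := by
  intro η hη
  have h2 : 0 < η / (c + 1) := ENNReal.div_pos hη.ne' (by simp [hc])
  refine tendsto_of_tendsto_of_tendsto_of_le_of_le tendsto_const_nhds (hZ _ h2)
    (fun _ => zero_le) fun n => measure_mono fun ω (hω : η ≤ c * Z n ω) => ?_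
  refine ENNReal.div_le_of_le_mul' (hω.trans ?_)
  gcongr
  exact le_self_add

lemma TendstoZeroInProb.pow {Z : ℕ → Ω → ℝ≥0∞} (hZ : TendstoZeroInProb μ Z) {k : ℕ}
    (hk : k ≠ 0) : TendstoZeroInProb μ (fun n ω => Z n ω ^ k) := by
  intro η hη
  refine tendsto_of_tendsto_of_tendsto_of_le_of_le tendsto_const_nhds
    (hZ (min η 1) (lt_min hη one_pos)) (fun _ => zero_le)
    fun n => measure_mono fun ω (hω : η ≤ Z n ω ^ k) => ?_
  by_contra hcon
  simp only [Set.mem_ofPred_eq, not_le, lt_min_iff] at hcon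
  have := pow_le_of_le_one (a := Z n ω) zero_le hcon.2.le hk
  exact absurd (hω.trans this) hcon.1.not_ge

lemma TendstoZeroInProb.of_pow {Z : ℕ → Ω → ℝ≥0∞} {k : ℕ}
    (hZ : TendstoZeroInProb μ (fun n ω => Z n ω ^ k)) : TendstoZeroInProb μ Z := by
  intro η hη
  refine tendsto_of_tendsto_of_tendsto_of_le_of_le tendsto_const_nhds
    (hZ (η ^ k) (ENNReal.pow_pos hη k)) (fun _ => zero_le)
    fun n => measure_mono fun ω (hω : η ≤ Z n ω) => ?_
  exact pow_le_pow_left₀ zero_le hω k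

lemma tendstoInMeasure_zero_iff {E : Type*} [SeminormedAddCommGroup E] {f : ℕ → Ω → E} :
    TendstoInMeasure μ f atTop (fun _ => 0) ↔ TendstoZeroInProb μ (fun n ω => ‖f n ω‖ₑ) := by
  simp only [TendstoInMeasure, TendstoZeroInProb, edist_zero_right]

lemma TendstoInMeasure.continuousAt_comp {E F : Type*} [PseudoEMetricSpace E]
    [PseudoEMetricSpace F] {f : ℕ → Ω → E} {c : E} {g : E → F} (hg : ContinuousAt g c)
    (hf : TendstoInMeasure μ f atTop (fun _ => c)) :
    TendstoInMeasure μ (fun n ω => g (f n ω)) atTop (fun _ => g c) := by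
  intro ε hε
  obtain ⟨δ, hδ, h⟩ := EMetric.tendsto_nhds_nhds.1 hg ε hε
  refine tendsto_of_tendsto_of_tendsto_of_le_of_le tendsto_const_nhds (hf δ hδ)
    (fun _ => zero_le) fun n => measure_mono fun ω hω => ?_
  by_contra hcon
  exact absurd (h (not_le.1 hcon)) (not_lt.2 hω)

lemma TendstoInMeasure.prodMk {E F : Type*} [PseudoEMetricSpace E] [PseudoEMetricSpace F]
    {f : ℕ → Ω → E} {g : ℕ → Ω → F} {a : E} {b : F}
    (hf : TendstoInMeasure μ f atTop (fun _ => a)) (hg : TendstoInMeasure μ g atTop (fun _ => b)) :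
    TendstoInMeasure μ (fun n ω => (f n ω, g n ω)) atTop (fun _ => (a, b)) := by
  intro ε hε
  have := (hf ε hε).add (hg ε hε)
  rw [add_zero] at this
  refine tendsto_of_tendsto_of_tendsto_of_le_of_le tendsto_const_nhds this (fun _ => zero_le)
    fun n => (measure_mono fun ω hω => ?_).trans (measure_union_le _ _)
  simpa [Prod.edist_eq] using hω

lemma TendstoInMeasure.pi {ι : Type*} [Fintype ι] {E : ι → Type*} [∀ i, PseudoEMetricSpace (E i)]
    {f : ℕ → Ω → ∀ i, E i} {a : ∀ i, E i}
    (hf : ∀ i, TendstoInMeasure μ (fun n ω => f n ω i) atTop (fun _ => a i)) :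
    TendstoInMeasure μ f atTop (fun _ => a) := by
  intro ε hε
  have : Tendsto (fun n => ∑ i, μ {ω | ε ≤ edist (f n ω i) (a i)}) atTop (𝓝 0) := by
    simpa using tendsto_finsetSum Finset.univ fun i _ => hf i ε hε
  refine tendsto_of_tendsto_of_tendsto_of_le_of_le tendsto_const_nhds this (fun _ => zero_le)
    fun n => (measure_mono fun ω hω => ?_).trans (measure_iUnion_fintype_le _ _)
  by_contra hcon
  simp only [Set.mem_iUnion, Set.mem_ofPred_eq, not_exists, not_le] at hcon
  exact absurd ((Finset.sup_lt_iff hε).2 fun i _ => hcon i) (not_lt.2 hω)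

lemma tendstoInMeasure_of_sub {E : Type*} [SeminormedAddCommGroup E] {f g : ℕ → Ω → E} {c : E}
    (hg : TendstoInMeasure μ g atTop (fun _ => c))
    (h : TendstoZeroInProb μ (fun n ω => ‖f n ω - g n ω‖ₑ)) :
    TendstoInMeasure μ f atTop (fun _ => c) := by
  have h1 : TendstoZeroInProb μ (fun n ω => ‖g n ω - c‖ₑ) := by
    intro η hη
    simpa [edist_eq_enorm_sub] using hg η hη
  have h2 : TendstoZeroInProb μ (fun n ω => ‖f n ω - c‖ₑ) := by
    refine (h.add h1).mono fun n ω => ?_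
    simp only [← edist_eq_enorm_sub]
    exact edist_triangle _ _ _
  intro η hη
  simpa [edist_eq_enorm_sub] using h2 η hη

end InProbability

/-! ### Averages over a held-out fold -/

section HeldOut

variable {Ω 𝒰 𝒪 : Type*} [MeasurableSpace Ω] [MeasurableSpace 𝒰] [MeasurableSpace 𝒪]
  {μ : Measure Ω} [IsProbabilityMeasure μ] {obs : ℕ → Ω → 𝒪} {U : Ω → 𝒰}

lemma indepFun_prodMk_restrict [Inhabited 𝒪] (hobs : ∀ i, Measurable (obs i))
    (hind : iIndepFun obs μ) (hU : Measurable U) (hUD : IndepFun U (fun ω i => obs i ω) μ)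
    (T : Finset ℕ) {i : ℕ} (hi : i ∉ T) :
    IndepFun (fun ω => (U ω, fun j => if j ∈ T then obs j ω else default)) (obs i) μ := by
  set ψ : (T → 𝒪) → ℕ → 𝒪 := fun d j => if h : j ∈ T then d ⟨j, h⟩ else default with hψ
  have hψm : Measurable ψ := by
    refine measurable_pi_lambda _ fun j => ?_
    by_cases h : j ∈ T
    · simpa [hψ, h] using measurable_pi_apply _
    · simp [hψ, h]
  set W : Ω → ℕ → 𝒪 := fun ω j => if j ∈ T then obs j ω else default with hW
  have hWψ : W = ψ ∘ fun ω (j : T) => obs j ω := by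
    ext ω j
    by_cases h : j ∈ T <;> simp [hW, hψ, h]
  have hWm : Measurable W := by
    rw [hWψ]
    exact hψm.comp (measurable_pi_lambda _ fun j => hobs j)
  have hWZ : IndepFun W (obs i) μ := by
    have h := hind.indepFun_finset T {i} (by simpa using hi) hobs
    rw [hWψ]
    exact h.comp hψm (measurable_pi_apply (⟨i, by simp⟩ : ({i} : Finset ℕ)))
  have hUWZ : IndepFun U (fun ω => (W ω, obs i ω)) μ := by
    refine hUD.comp measurable_id
      (ψ := fun d : ℕ → 𝒪 => ((fun j => if j ∈ T then d j else default : ℕ → 𝒪), d i)) ?_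
    refine Measurable.prodMk (measurable_pi_lambda _ fun j => ?_) (measurable_pi_apply i)
    by_cases h : j ∈ T
    · simpa [h] using measurable_pi_apply j
    · simp [h]
  have hUW : IndepFun U W μ := hUWZ.comp measurable_id measurable_fst
  have hZ := hobs i
  rw [indepFun_iff_map_prod_eq_prod_map_map (hU.prodMk hWm).aemeasurable hZ.aemeasurable,
    (indepFun_iff_map_prod_eq_prod_map_map hU.aemeasurable hWm.aemeasurable).1 hUW]
  have h1 := (indepFun_iff_map_prod_eq_prod_map_map hU.aemeasurable
    (hWm.prodMk hZ).aemeasurable).1 hUWZ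
  rw [(indepFun_iff_map_prod_eq_prod_map_map hWm.aemeasurable hZ.aemeasurable).1 hWZ] at h1
  have h2 : Measure.map (fun ω => ((U ω, W ω), obs i ω)) μ
      = (Measure.map (fun ω => (U ω, W ω, obs i ω)) μ).map MeasurableEquiv.prodAssoc.symm := by
    rw [Measure.map_map (MeasurableEquiv.measurable _) (hU.prodMk (hWm.prodMk hZ))]
    rfl
  have : IsProbabilityMeasure (μ.map U) := Measure.isProbabilityMeasure_map hU.aemeasurable
  have : IsProbabilityMeasure (μ.map W) := Measure.isProbabilityMeasure_map hWm.aemeasurable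
  have : IsProbabilityMeasure (μ.map (obs i)) := Measure.isProbabilityMeasure_map hZ.aemeasurable
  rw [h2, h1]
  have h3 := Measure.prodAssoc_prod (μ := μ.map U) (ν := μ.map W) (τ := μ.map (obs i))
  rw [← h3, Measure.map_map (MeasurableEquiv.measurable _) (MeasurableEquiv.measurable _)]
  simp

/-- The law of the sample, with observation `i` replaced by an independent copy. -/
lemma lintegral_heldOut [Inhabited 𝒪] (hobs : ∀ i, Measurable (obs i))
    (hind : iIndepFun obs μ) (hid : ∀ i, μ.map (obs i) = μ.map (obs 0)) (hU : Measurable U)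
    (hUD : IndepFun U (fun ω i => obs i ω) μ) (T : Finset ℕ) {i : ℕ} (hi : i ∉ T)
    {F : 𝒰 → (ℕ → 𝒪) → 𝒪 → ℝ≥0∞}
    (hF : Measurable fun z : 𝒰 × (ℕ → 𝒪) × 𝒪 => F z.1 z.2.1 z.2.2)
    (hcongr : ∀ u d d', (∀ j ∈ T, d j = d' j) → F u d = F u d') :
    ∫⁻ ω, F (U ω) (fun j => obs j ω) (obs i ω) ∂μ
      = ∫⁻ ω, ∫⁻ z, F (U ω) (fun j => obs j ω) z ∂(μ.map (obs 0)) ∂μ := by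
  set W : Ω → ℕ → 𝒪 := fun ω j => if j ∈ T then obs j ω else default with hW
  have hWm : Measurable W := measurable_pi_lambda _ fun j => by
    by_cases h : j ∈ T
    · simpa [hW, h] using hobs j
    · simp [hW, h]
  have hFW : ∀ ω, F (U ω) (fun j => obs j ω) = F (U ω) (W ω) := fun ω =>
    hcongr _ _ _ fun j hj => by simp [hW, hj]
  simp_rw [hFW]
  have hI := (indepFun_iff_map_prod_eq_prod_map_map (hU.prodMk hWm).aemeasurable
    (hobs i).aemeasurable).1 (indepFun_prodMk_restrict hobs hind hU hUD T hi)
  have : IsProbabilityMeasure (μ.map (obs 0)) :=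
    Measure.isProbabilityMeasure_map (hobs 0).aemeasurable
  have hF' : Measurable fun z : (𝒰 × (ℕ → 𝒪)) × 𝒪 => F z.1.1 z.1.2 z.2 :=
    hF.comp (by fun_prop : Measurable fun z : (𝒰 × (ℕ → 𝒪)) × 𝒪 => (z.1.1, z.1.2, z.2))
  calc ∫⁻ ω, F (U ω) (W ω) (obs i ω) ∂μ
      = ∫⁻ z, F z.1.1 z.1.2 z.2 ∂(μ.map fun ω => ((U ω, W ω), obs i ω)) := by
        rw [lintegral_map hF' ((hU.prodMk hWm).prodMk (hobs i))]
    _ = ∫⁻ y, ∫⁻ z, F y.1 y.2 z ∂(μ.map (obs 0)) ∂(μ.map fun ω => (U ω, W ω)) := by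
        rw [hI, hid i, lintegral_prod _ hF'.aemeasurable]
    _ = _ := by rw [lintegral_map hF'.lintegral_prod_right' (hU.prodMk hWm)]

lemma integral_heldOut [Inhabited 𝒪] (hobs : ∀ i, Measurable (obs i))
    (hind : iIndepFun obs μ) (hid : ∀ i, μ.map (obs i) = μ.map (obs 0)) (hU : Measurable U)
    (hUD : IndepFun U (fun ω i => obs i ω) μ) (T : Finset ℕ) {i : ℕ} (hi : i ∉ T)
    {F : 𝒰 → (ℕ → 𝒪) → 𝒪 → ℝ}
    (hF : Measurable fun z : 𝒰 × (ℕ → 𝒪) × 𝒪 => F z.1 z.2.1 z.2.2)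
    (hcongr : ∀ u d d', (∀ j ∈ T, d j = d' j) → F u d = F u d')
    (hint : Integrable (fun ω => F (U ω) (fun j => obs j ω) (obs i ω)) μ) :
    ∫ ω, F (U ω) (fun j => obs j ω) (obs i ω) ∂μ
      = ∫ ω, ∫ z, F (U ω) (fun j => obs j ω) z ∂(μ.map (obs 0)) ∂μ := by
  set W : Ω → ℕ → 𝒪 := fun ω j => if j ∈ T then obs j ω else default with hW
  have hWm : Measurable W := measurable_pi_lambda _ fun j => by
    by_cases h : j ∈ T
    · simpa [hW, h] using hobs j
    · simp [hW, h]
  have hFW : ∀ ω, F (U ω) (fun j => obs j ω) = F (U ω) (W ω) := fun ω =>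
    hcongr _ _ _ fun j hj => by simp [hW, hj]
  simp_rw [hFW] at hint ⊢
  have hI := (indepFun_iff_map_prod_eq_prod_map_map (hU.prodMk hWm).aemeasurable
    (hobs i).aemeasurable).1 (indepFun_prodMk_restrict hobs hind hU hUD T hi)
  have : IsProbabilityMeasure (μ.map (obs 0)) :=
    Measure.isProbabilityMeasure_map (hobs 0).aemeasurable
  have : IsProbabilityMeasure (μ.map fun ω => (U ω, W ω)) :=
    Measure.isProbabilityMeasure_map (hU.prodMk hWm).aemeasurable
  have hF' : Measurable fun z : (𝒰 × (ℕ → 𝒪)) × 𝒪 => F z.1.1 z.1.2 z.2 :=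
    hF.comp (by fun_prop : Measurable fun z : (𝒰 × (ℕ → 𝒪)) × 𝒪 => (z.1.1, z.1.2, z.2))
  have hm := (hU.prodMk hWm).prodMk (hobs i)
  have hint' : Integrable (fun z : (𝒰 × (ℕ → 𝒪)) × 𝒪 => F z.1.1 z.1.2 z.2)
      (μ.map fun ω => ((U ω, W ω), obs i ω)) :=
    (integrable_map_measure hF'.aestronglyMeasurable hm.aemeasurable).2 hint
  calc ∫ ω, F (U ω) (W ω) (obs i ω) ∂μ
      = ∫ z, F z.1.1 z.1.2 z.2 ∂(μ.map fun ω => ((U ω, W ω), obs i ω)) := by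
        rw [integral_map hm.aemeasurable hF'.aestronglyMeasurable]
    _ = ∫ y, ∫ z, F y.1 y.2 z ∂(μ.map (obs 0)) ∂(μ.map fun ω => (U ω, W ω)) := by
        rw [hI, hid i] at hint' ⊢
        rw [integral_prod _ hint']
    _ = _ := by
        rw [integral_map (hU.prodMk hWm).aemeasurable
          hF'.stronglyMeasurable.integral_prod_right'.aestronglyMeasurable]

end HeldOut

section HeldOutAverages

variable {Ω 𝒰 𝒪 : Type*} [MeasurableSpace Ω] [MeasurableSpace 𝒰] [MeasurableSpace 𝒪]
  {μ : Measure Ω} [IsProbabilityMeasure μ] {obs : ℕ → Ω → 𝒪} {U : Ω → 𝒰}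

lemma sum_eq_sum_range_ite {R : Type*} [AddCommMonoid R] {s : Finset ℕ} {N : ℕ}
    (hs : s ⊆ Finset.range N) (f : ℕ → R) :
    ∑ i ∈ s, f i = ∑ i ∈ Finset.range N, if i ∈ s then f i else 0 := by
  rw [← Finset.sum_filter, Finset.filter_mem_eq_inter, Finset.inter_eq_right.2 hs]

lemma lintegral_heldOut_indicator [Inhabited 𝒪] (hobs : ∀ i, Measurable (obs i))
    (hind : iIndepFun obs μ) (hid : ∀ i, μ.map (obs i) = μ.map (obs 0)) (hU : Measurable U)
    (hUD : IndepFun U (fun ω i => obs i ω) μ) {N : ℕ} {S : 𝒰 → Finset ℕ}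
    (hSm : ∀ i, MeasurableSet {u | i ∈ S u})
    {h : 𝒰 → (ℕ → 𝒪) → 𝒪 → ℝ≥0∞}
    (hh : Measurable fun z : 𝒰 × (ℕ → 𝒪) × 𝒪 => h z.1 z.2.1 z.2.2)
    (hcongr : ∀ u d d', (∀ j ∈ Finset.range N \ S u, d j = d' j) → h u d = h u d') (i : ℕ) :
    ∫⁻ ω, (if i ∈ S (U ω) then h (U ω) (fun j => obs j ω) (obs i ω) else 0) ∂μ
      ≤ ∫⁻ ω, ∫⁻ z, h (U ω) (fun j => obs j ω) z ∂(μ.map (obs 0)) ∂μ := by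
  rw [lintegral_heldOut hobs hind hid hU hUD (Finset.range N \ {i}) (by simp)
    (F := fun u d z => if i ∈ S u then h u d z else 0)
    (Measurable.ite ((hSm i).preimage measurable_fst) hh measurable_const)]
  · refine lintegral_mono fun ω => lintegral_mono fun z => ?_
    dsimp only
    split_ifs <;> simp
  · intro u d d' hdd
    by_cases hi : i ∈ S u
    · simp only [hi, if_true]
      refine hcongr u d d' fun j hj => hdd j ?_
      simp only [Finset.mem_sdiff, Finset.mem_singleton] at hj ⊢
      exact ⟨hj.1, fun hji => hj.2 (hji ▸ hi)⟩
    · simp [hi]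

lemma lintegral_heldOut_sum_le [Inhabited 𝒪] (hobs : ∀ i, Measurable (obs i))
    (hind : iIndepFun obs μ) (hid : ∀ i, μ.map (obs i) = μ.map (obs 0)) (hU : Measurable U)
    (hUD : IndepFun U (fun ω i => obs i ω) μ) {N : ℕ} {S : 𝒰 → Finset ℕ}
    (hSm : ∀ i, MeasurableSet {u | i ∈ S u}) (hSN : ∀ u, S u ⊆ Finset.range N)
    {h : 𝒰 → (ℕ → 𝒪) → 𝒪 → ℝ≥0∞}
    (hh : Measurable fun z : 𝒰 × (ℕ → 𝒪) × 𝒪 => h z.1 z.2.1 z.2.2)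
    (hcongr : ∀ u d d', (∀ j ∈ Finset.range N \ S u, d j = d' j) → h u d = h u d') :
    ∫⁻ ω, ∑ i ∈ S (U ω), h (U ω) (fun j => obs j ω) (obs i ω) ∂μ
      ≤ N * ∫⁻ ω, ∫⁻ z, h (U ω) (fun j => obs j ω) z ∂(μ.map (obs 0)) ∂μ := by
  simp_rw [sum_eq_sum_range_ite (hSN _)]
  rw [lintegral_finsetSum _ fun i _ => ?_]
  · calc _ ≤ ∑ _i ∈ Finset.range N, ∫⁻ ω, ∫⁻ z, h (U ω) (fun j => obs j ω) z ∂(μ.map (obs 0)) ∂μ :=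
          Finset.sum_le_sum fun i _ =>
            lintegral_heldOut_indicator hobs hind hid hU hUD hSm hh hcongr i
      _ = _ := by simp
  · refine Measurable.ite ((hSm i).preimage hU) ?_ measurable_const
    exact hh.comp (hU.prodMk ((measurable_pi_lambda _ hobs).prodMk (hobs i)))

/-- Conditional Markov inequality for the average over a held-out fold. -/
lemma measure_heldOut_average_le [Inhabited 𝒪] (hobs : ∀ i, Measurable (obs i))
    (hind : iIndepFun obs μ) (hid : ∀ i, μ.map (obs i) = μ.map (obs 0)) (hU : Measurable U)
    (hUD : IndepFun U (fun ω i => obs i ω) μ) {N : ℕ} {S : 𝒰 → Finset ℕ}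
    (hSm : ∀ i, MeasurableSet {u | i ∈ S u}) (hSN : ∀ u, S u ⊆ Finset.range N) (hN : N ≠ 0)
    {h : 𝒰 → (ℕ → 𝒪) → 𝒪 → ℝ≥0∞}
    (hh : Measurable fun z : 𝒰 × (ℕ → 𝒪) × 𝒪 => h z.1 z.2.1 z.2.2)
    (hcongr : ∀ u d d', (∀ j ∈ Finset.range N \ S u, d j = d' j) → h u d = h u d')
    {η κ : ℝ≥0∞} (hη : η ≠ 0) (hη' : η ≠ ∞) :
    μ {ω | η ≤ (N : ℝ≥0∞)⁻¹ * ∑ i ∈ S (U ω), h (U ω) (fun j => obs j ω) (obs i ω)}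
      ≤ μ {ω | κ ≤ ∫⁻ z, h (U ω) (fun j => obs j ω) z ∂(μ.map (obs 0))} + κ / η := by
  have : IsProbabilityMeasure (μ.map (obs 0)) :=
    Measure.isProbabilityMeasure_map (hobs 0).aemeasurable
  set W : 𝒰 → (ℕ → 𝒪) → ℝ≥0∞ := fun u d => ∫⁻ z, h u d z ∂(μ.map (obs 0)) with hW
  have hWm : Measurable fun y : 𝒰 × (ℕ → 𝒪) => W y.1 y.2 := by
    have hF' : Measurable fun z : (𝒰 × (ℕ → 𝒪)) × 𝒪 => h z.1.1 z.1.2 z.2 :=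
      hh.comp (by fun_prop : Measurable fun z : (𝒰 × (ℕ → 𝒪)) × 𝒪 => (z.1.1, z.1.2, z.2))
    exact hF'.lintegral_prod_right'
  set h' : 𝒰 → (ℕ → 𝒪) → 𝒪 → ℝ≥0∞ := fun u d z => if W u d < κ then h u d z else 0 with hh'
  have hh'm : Measurable fun z : 𝒰 × (ℕ → 𝒪) × 𝒪 => h' z.1 z.2.1 z.2.2 := by
    refine Measurable.ite ?_ hh measurable_const
    exact measurableSet_lt (hWm.comp (by fun_prop : Measurable fun z : 𝒰 × (ℕ → 𝒪) × 𝒪 =>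
      (z.1, z.2.1))) measurable_const
  have hWc : ∀ u d d', (∀ j ∈ Finset.range N \ S u, d j = d' j) → W u d = W u d' := by
    intro u d d' hd
    simp only [hW, hcongr u d d' hd]
  have hh'c : ∀ u d d', (∀ j ∈ Finset.range N \ S u, d j = d' j) → h' u d = h' u d' := by
    intro u d d' hd
    simp only [hh', hcongr u d d' hd, hWc u d d' hd]
  have hbound := lintegral_heldOut_sum_le hobs hind hid hU hUD hSm hSN hh'm hh'c
  have hb2 : ∫⁻ ω, ∫⁻ z, h' (U ω) (fun j => obs j ω) z ∂(μ.map (obs 0)) ∂μ ≤ κ := by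
    calc _ ≤ ∫⁻ _, κ ∂μ := by
          refine lintegral_mono fun ω => ?_
          by_cases hlt : W (U ω) (fun j => obs j ω) < κ
          · simpa only [hh', hlt, if_true] using hlt.le
          · simp [hh', hlt]
      _ = κ := by simp
  have hN0 : (N : ℝ≥0∞) ≠ 0 := by exact_mod_cast hN
  have hNt : (N : ℝ≥0∞) ≠ ∞ := ENNReal.natCast_ne_top N
  have hmeas : Measurable fun ω =>
      (N : ℝ≥0∞)⁻¹ * ∑ i ∈ S (U ω), h' (U ω) (fun j => obs j ω) (obs i ω) := by
    simp_rw [sum_eq_sum_range_ite (hSN _)]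
    refine (Finset.measurable_sum _ fun i _ => ?_).const_mul _
    refine Measurable.ite ((hSm i).preimage hU) ?_ measurable_const
    exact hh'm.comp (hU.prodMk ((measurable_pi_lambda _ hobs).prodMk (hobs i)))
  calc _ ≤ μ ({ω | κ ≤ W (U ω) (fun j => obs j ω)} ∪
        {ω | η ≤ (N : ℝ≥0∞)⁻¹ * ∑ i ∈ S (U ω), h' (U ω) (fun j => obs j ω) (obs i ω)}) := by
        refine measure_mono fun ω hω => ?_
        by_cases hlt : W (U ω) (fun j => obs j ω) < κ
        · right
          simpa only [hh', hlt, if_true, Set.mem_ofPred_eq] using hω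
        · left
          exact not_lt.1 hlt
    _ ≤ _ := measure_union_le _ _
    _ ≤ μ {ω | κ ≤ W (U ω) (fun j => obs j ω)} + κ / η := by
        gcongr
        refine (meas_ge_le_lintegral_div hmeas.aemeasurable hη hη').trans ?_
        gcongr
        rw [lintegral_const_mul' _ _ (ENNReal.inv_ne_top.2 hN0)]
        calc (N : ℝ≥0∞)⁻¹ * _ ≤ (N : ℝ≥0∞)⁻¹ * (N * κ) := by
              gcongr
              exact hbound.trans (by gcongr)
          _ = κ := by rw [← mul_assoc, ENNReal.inv_mul_cancel hN0 hNt, one_mul]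

/-- Averages over held-out folds of nonnegative functions whose conditional mean vanishes in
probability vanish in probability. -/
lemma tendstoZeroInProb_heldOut_average [Inhabited 𝒪] (hobs : ∀ i, Measurable (obs i))
    (hind : iIndepFun obs μ) (hid : ∀ i, μ.map (obs i) = μ.map (obs 0)) (hU : Measurable U)
    (hUD : IndepFun U (fun ω i => obs i ω) μ) {S : ℕ → 𝒰 → Finset ℕ}
    (hSm : ∀ n i, MeasurableSet {u | i ∈ S n u}) (hSN : ∀ n u, S n u ⊆ Finset.range (2 * n))
    {h : ℕ → 𝒰 → (ℕ → 𝒪) → 𝒪 → ℝ≥0∞}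
    (hh : ∀ n, Measurable fun z : 𝒰 × (ℕ → 𝒪) × 𝒪 => h n z.1 z.2.1 z.2.2)
    (hcongr : ∀ n u d d', (∀ j ∈ Finset.range (2 * n) \ S n u, d j = d' j) → h n u d = h n u d')
    (hW : TendstoZeroInProb μ
      (fun n ω => ∫⁻ z, h n (U ω) (fun j => obs j ω) z ∂(μ.map (obs 0)))) :
    TendstoZeroInProb μ (fun n ω => ((2 * n : ℕ) : ℝ≥0∞)⁻¹ *
      ∑ i ∈ S n (U ω), h n (U ω) (fun j => obs j ω) (obs i ω)) := by
  have key : ∀ η : ℝ≥0∞, 0 < η → η ≠ ∞ → Tendsto (fun n => μ {ω | η ≤ ((2 * n : ℕ) : ℝ≥0∞)⁻¹ *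
      ∑ i ∈ S n (U ω), h n (U ω) (fun j => obs j ω) (obs i ω)}) atTop (𝓝 0) := by
    intro η hη hηt
    rw [ENNReal.tendsto_nhds_zero]
    intro ε hε
    have hε2 : 0 < ε / 2 := ENNReal.half_pos hε.ne'
    have hκ : 0 < min 1 (ε / 2) * η := ENNReal.mul_pos (lt_min one_pos hε2).ne' hη.ne'
    filter_upwards [(ENNReal.tendsto_nhds_zero.1 (hW _ hκ)) _ hε2, eventually_ne_atTop 0]
      with n hn hn0
    refine (measure_heldOut_average_le hobs hind hid hU hUD (hSm n) (hSN n) (by omega) (hh n)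
      (hcongr n) (κ := min 1 (ε / 2) * η) hη.ne' hηt).trans ?_
    rw [ENNReal.mul_div_cancel_right hη.ne' hηt]
    calc _ ≤ ε / 2 + ε / 2 := add_le_add hn (min_le_right _ _)
      _ = ε := ENNReal.add_halves ε
  intro η hη
  by_cases hηt : η = ∞
  · refine tendsto_of_tendsto_of_tendsto_of_le_of_le tendsto_const_nhds
      (key 1 one_pos ENNReal.one_ne_top) (fun _ => zero_le) fun n => measure_mono fun ω hω => ?_
    subst hηt
    exact le_trans (le_top (a := (1 : ℝ≥0∞))) hω
  · exact key η hη hηt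

/-- Second moment of a centred sum over a held-out fold. -/
lemma lintegral_sq_heldOut_sum_le [Inhabited 𝒪] (hobs : ∀ i, Measurable (obs i))
    (hind : iIndepFun obs μ) (hid : ∀ i, μ.map (obs i) = μ.map (obs 0)) (hU : Measurable U)
    (hUD : IndepFun U (fun ω i => obs i ω) μ) {N : ℕ} {S : 𝒰 → Finset ℕ}
    (hSm : ∀ i, MeasurableSet {u | i ∈ S u}) (hSN : ∀ u, S u ⊆ Finset.range N)
    {h : 𝒰 → (ℕ → 𝒪) → 𝒪 → ℝ}
    (hh : Measurable fun z : 𝒰 × (ℕ → 𝒪) × 𝒪 => h z.1 z.2.1 z.2.2)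
    (hcongr : ∀ u d d', (∀ j ∈ Finset.range N \ S u, d j = d' j) → h u d = h u d')
    {κ : ℝ≥0∞} (hκ : κ ≠ ∞) (hV : ∀ u d, ∫⁻ z, ‖h u d z‖ₑ ^ 2 ∂(μ.map (obs 0)) ≤ κ)
    (h0 : ∀ u d, ∫ z, h u d z ∂(μ.map (obs 0)) = 0) :
    ∫⁻ ω, ‖∑ i ∈ S (U ω), h (U ω) (fun j => obs j ω) (obs i ω)‖ₑ ^ 2 ∂μ ≤ N * κ := by
  set H : ℕ → Ω → ℝ := fun i ω =>
    if i ∈ S (U ω) then h (U ω) (fun j => obs j ω) (obs i ω) else 0 with hH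
  have hsum : ∀ ω, ∑ i ∈ S (U ω), h (U ω) (fun j => obs j ω) (obs i ω)
      = ∑ i ∈ Finset.range N, H i ω := fun ω => sum_eq_sum_range_ite (hSN _) _
  have hHm : ∀ i, Measurable (H i) := fun i =>
    Measurable.ite ((hSm i).preimage hU)
      (hh.comp (hU.prodMk ((measurable_pi_lambda _ hobs).prodMk (hobs i)))) measurable_const
  have hH2 : ∀ i, ∫⁻ ω, ‖H i ω‖ₑ ^ 2 ∂μ ≤ κ := by
    intro i
    have := lintegral_heldOut_indicator hobs hind hid hU hUD (N := N) hSm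
      (h := fun u d z => ‖h u d z‖ₑ ^ 2) (hh.enorm.pow_const 2)
      (fun u d d' hd => by rw [hcongr u d d' hd]) i
    calc ∫⁻ ω, ‖H i ω‖ₑ ^ 2 ∂μ = _ := by
          refine lintegral_congr fun ω => ?_
          by_cases hi : i ∈ S (U ω)
          · simp only [hH, hi, if_true]
          · simp only [hH, hi, if_false]; simp
      _ ≤ _ := this
      _ ≤ ∫⁻ _, κ ∂μ := lintegral_mono fun ω => hV _ _
      _ = κ := by simp
  have hHL : ∀ i, MemLp (H i) 2 μ := by
    intro i
    refine ⟨(hHm i).aestronglyMeasurable, ?_⟩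
    rw [eLpNorm_lt_top_iff_lintegral_rpow_enorm_lt_top two_ne_zero ENNReal.ofNat_ne_top]
    simpa using (hH2 i).trans_lt hκ.lt_top
  have hcross : ∀ i ∈ Finset.range N, ∀ j ∈ Finset.range N, i ≠ j →
      ∫ ω, H i ω * H j ω ∂μ = 0 := by
    intro i _ j hj hij
    have hint : Integrable (fun ω => H i ω * H j ω) μ := (hHL i).integrable_mul (hHL j)
    have := integral_heldOut hobs hind hid hU hUD (Finset.range N \ {i}) (i := i) (by simp)
      (F := fun u d z => if i ∈ S u ∧ j ∈ S u then h u d z * h u d (d j) else 0)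
      (Measurable.ite ((((hSm i).inter (hSm j))).preimage measurable_fst)
        (hh.mul (hh.comp (by fun_prop : Measurable fun z : 𝒰 × (ℕ → 𝒪) × 𝒪 =>
          (z.1, z.2.1, z.2.1 j)))) measurable_const) ?_ ?_
    · calc ∫ ω, H i ω * H j ω ∂μ = _ := by
            refine integral_congr_ae (ae_of_all _ fun ω => ?_)
            simp only [hH]
            by_cases hi : i ∈ S (U ω) <;> by_cases hj' : j ∈ S (U ω) <;> simp [hi, hj']
        _ = _ := this
        _ = 0 := by
            refine integral_eq_zero_of_ae (ae_of_all _ fun ω => ?_)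
            by_cases hc : i ∈ S (U ω) ∧ j ∈ S (U ω)
            · simp only [hc, and_self, if_true, integral_mul_const, h0, zero_mul, Pi.zero_apply]
            · simp [hc]
    · intro u d d' hdd
      by_cases hi : i ∈ S u
      · have e1 := hcongr u d d' fun k hk => hdd k (by
          simp only [Finset.mem_sdiff, Finset.mem_singleton] at hk ⊢
          exact ⟨hk.1, fun hki => hk.2 (hki ▸ hi)⟩)
        have e2 := hdd j (by simpa [hij.symm] using hj)
        simp only [e1, e2]
      · simp [hi]
    · refine hint.congr (ae_of_all _ fun ω => ?_)
      simp only [hH]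
      by_cases hi : i ∈ S (U ω) <;> by_cases hj' : j ∈ S (U ω) <;> simp [hi, hj']
  have hsq : ∫ ω, (∑ i ∈ Finset.range N, H i ω) ^ 2 ∂μ
      = ∑ i ∈ Finset.range N, ∫ ω, H i ω ^ 2 ∂μ := by
    have hint : ∀ i j, Integrable (fun ω => H i ω * H j ω) μ := fun i j =>
      (hHL i).integrable_mul (hHL j)
    simp_rw [sq, Finset.sum_mul_sum]
    rw [integral_finsetSum _ fun i _ => integrable_finsetSum _ fun j _ => hint i j]
    refine Finset.sum_congr rfl fun i hi => ?_
    rw [integral_finsetSum _ fun j _ => hint i j]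
    rw [Finset.sum_eq_single_of_mem i hi]
    exact fun j hj hji => hcross i hi j hj hji.symm
  have henorm : ∀ x : ℝ, ‖x‖ₑ ^ 2 = ENNReal.ofReal (x ^ 2) := fun x => by
    rw [Real.enorm_eq_ofReal_abs, ← ENNReal.ofReal_pow (abs_nonneg _), sq_abs]
  have hL2 : MemLp (fun ω => ∑ i ∈ Finset.range N, H i ω) 2 μ :=
    memLp_finsetSum _ fun i _ => hHL i
  simp_rw [hsum, henorm]
  rw [← ofReal_integral_eq_lintegral_ofReal hL2.integrable_sq (ae_of_all _ fun _ => sq_nonneg _),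
    hsq, ENNReal.ofReal_sum_of_nonneg fun i _ => integral_nonneg fun _ => sq_nonneg _]
  calc _ ≤ ∑ _i ∈ Finset.range N, κ := by
        refine Finset.sum_le_sum fun i _ => ?_
        rw [ofReal_integral_eq_lintegral_ofReal (hHL i).integrable_sq
          (ae_of_all _ fun _ => sq_nonneg _)]
        simpa only [henorm] using hH2 i
    _ = N * κ := by simp

end HeldOutAverages

section HeldOutSums

variable {Ω 𝒰 𝒪 : Type*} [MeasurableSpace Ω] [MeasurableSpace 𝒰] [MeasurableSpace 𝒪]
  {μ : Measure Ω} [IsProbabilityMeasure μ] {obs : ℕ → Ω → 𝒪} {U : Ω → 𝒰}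

/-- Conditional Chebyshev inequality for a centred sum over a held-out fold. -/
lemma measure_heldOut_sum_le [Inhabited 𝒪] (hobs : ∀ i, Measurable (obs i))
    (hind : iIndepFun obs μ) (hid : ∀ i, μ.map (obs i) = μ.map (obs 0)) (hU : Measurable U)
    (hUD : IndepFun U (fun ω i => obs i ω) μ) {N : ℕ} {S : 𝒰 → Finset ℕ}
    (hSm : ∀ i, MeasurableSet {u | i ∈ S u}) (hSN : ∀ u, S u ⊆ Finset.range N) (hN : N ≠ 0)
    {h : 𝒰 → (ℕ → 𝒪) → 𝒪 → ℝ}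
    (hh : Measurable fun z : 𝒰 × (ℕ → 𝒪) × 𝒪 => h z.1 z.2.1 z.2.2)
    (hcongr : ∀ u d d', (∀ j ∈ Finset.range N \ S u, d j = d' j) → h u d = h u d')
    (h0 : ∀ u d, ∫⁻ z, ‖h u d z‖ₑ ^ 2 ∂(μ.map (obs 0)) ≠ ∞ → ∫ z, h u d z ∂(μ.map (obs 0)) = 0)
    {η κ : ℝ≥0∞} (hη : η ≠ 0) (hη' : η ≠ ∞) (hκ : κ ≠ ∞) :
    μ {ω | η ≤ ‖(√(N : ℝ))⁻¹ * ∑ i ∈ S (U ω), h (U ω) (fun j => obs j ω) (obs i ω)‖ₑ}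
      ≤ μ {ω | κ ≤ ∫⁻ z, ‖h (U ω) (fun j => obs j ω) z‖ₑ ^ 2 ∂(μ.map (obs 0))} + κ / η ^ 2 := by
  have : IsProbabilityMeasure (μ.map (obs 0)) :=
    Measure.isProbabilityMeasure_map (hobs 0).aemeasurable
  set W : 𝒰 → (ℕ → 𝒪) → ℝ≥0∞ := fun u d => ∫⁻ z, ‖h u d z‖ₑ ^ 2 ∂(μ.map (obs 0)) with hW
  have hWm : Measurable fun y : 𝒰 × (ℕ → 𝒪) => W y.1 y.2 := by
    have hF' : Measurable fun z : (𝒰 × (ℕ → 𝒪)) × 𝒪 => ‖h z.1.1 z.1.2 z.2‖ₑ ^ 2 :=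
      (hh.comp (by fun_prop : Measurable fun z : (𝒰 × (ℕ → 𝒪)) × 𝒪 =>
        (z.1.1, z.1.2, z.2))).enorm.pow_const 2
    exact hF'.lintegral_prod_right'
  set h' : 𝒰 → (ℕ → 𝒪) → 𝒪 → ℝ := fun u d z => if W u d < κ then h u d z else 0 with hh'
  have hh'm : Measurable fun z : 𝒰 × (ℕ → 𝒪) × 𝒪 => h' z.1 z.2.1 z.2.2 := by
    refine Measurable.ite ?_ hh measurable_const
    exact measurableSet_lt (hWm.comp (by fun_prop : Measurable fun z : 𝒰 × (ℕ → 𝒪) × 𝒪 =>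
      (z.1, z.2.1))) measurable_const
  have hWc : ∀ u d d', (∀ j ∈ Finset.range N \ S u, d j = d' j) → W u d = W u d' := by
    intro u d d' hd
    simp only [hW, hcongr u d d' hd]
  have hh'c : ∀ u d d', (∀ j ∈ Finset.range N \ S u, d j = d' j) → h' u d = h' u d' := by
    intro u d d' hd
    simp only [hh', hcongr u d d' hd, hWc u d d' hd]
  have hV : ∀ u d, ∫⁻ z, ‖h' u d z‖ₑ ^ 2 ∂(μ.map (obs 0)) ≤ κ := by
    intro u d
    by_cases hlt : W u d < κ
    · simpa only [hh', hlt, if_true] using hlt.le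
    · simp [hh', hlt]
  have h0' : ∀ u d, ∫ z, h' u d z ∂(μ.map (obs 0)) = 0 := by
    intro u d
    by_cases hlt : W u d < κ
    · simpa only [hh', hlt, if_true] using h0 u d hlt.ne_top
    · simp [hh', hlt]
  have hbound := lintegral_sq_heldOut_sum_le hobs hind hid hU hUD hSm hSN hh'm hh'c hκ hV h0'
  have hN0 : (N : ℝ≥0∞) ≠ 0 := by exact_mod_cast hN
  have hNt : (N : ℝ≥0∞) ≠ ∞ := ENNReal.natCast_ne_top N
  have hmeas : Measurable fun ω =>
      (√(N : ℝ))⁻¹ * ∑ i ∈ S (U ω), h' (U ω) (fun j => obs j ω) (obs i ω) := by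
    simp_rw [sum_eq_sum_range_ite (hSN _)]
    refine (Finset.measurable_sum _ fun i _ => ?_).const_mul _
    refine Measurable.ite ((hSm i).preimage hU) ?_ measurable_const
    exact hh'm.comp (hU.prodMk ((measurable_pi_lambda _ hobs).prodMk (hobs i)))
  have hscale : ∀ s : ℝ, ‖(√(N : ℝ))⁻¹ * s‖ₑ ^ 2 = (N : ℝ≥0∞)⁻¹ * ‖s‖ₑ ^ 2 := by
    intro s
    rw [enorm_mul, mul_pow]
    congr 1
    rw [Real.enorm_eq_ofReal (by positivity), ← ENNReal.ofReal_pow (by positivity), inv_pow,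
      Real.sq_sqrt (Nat.cast_nonneg N), ENNReal.ofReal_inv_of_pos (by positivity),
      ENNReal.ofReal_natCast]
  calc _ ≤ μ ({ω | κ ≤ W (U ω) (fun j => obs j ω)} ∪ {ω | η ^ 2 ≤ ‖(√(N : ℝ))⁻¹ *
          ∑ i ∈ S (U ω), h' (U ω) (fun j => obs j ω) (obs i ω)‖ₑ ^ 2}) := by
        refine measure_mono fun ω hω => ?_
        by_cases hlt : W (U ω) (fun j => obs j ω) < κ
        · right
          simp only [hh', hlt, if_true, Set.mem_ofPred_eq]
          exact pow_le_pow_left₀ zero_le hω 2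
        · left
          exact not_lt.1 hlt
    _ ≤ _ := measure_union_le _ _
    _ ≤ μ {ω | κ ≤ W (U ω) (fun j => obs j ω)} + κ / η ^ 2 := by
        gcongr
        refine (meas_ge_le_lintegral_div (hmeas.enorm.pow_const 2).aemeasurable
          (pow_ne_zero 2 hη) (ENNReal.pow_ne_top hη')).trans ?_
        gcongr
        simp_rw [hscale]
        rw [lintegral_const_mul' _ _ (ENNReal.inv_ne_top.2 hN0)]
        calc (N : ℝ≥0∞)⁻¹ * _ ≤ (N : ℝ≥0∞)⁻¹ * (N * κ) := by gcongr
          _ = κ := by rw [← mul_assoc, ENNReal.inv_mul_cancel hN0 hNt, one_mul]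

/-- Normalized sums over held-out folds of centred functions whose conditional second moment
vanishes in probability vanish in probability. -/
lemma tendstoZeroInProb_heldOut_sum [Inhabited 𝒪] (hobs : ∀ i, Measurable (obs i))
    (hind : iIndepFun obs μ) (hid : ∀ i, μ.map (obs i) = μ.map (obs 0)) (hU : Measurable U)
    (hUD : IndepFun U (fun ω i => obs i ω) μ) {S : ℕ → 𝒰 → Finset ℕ}
    (hSm : ∀ n i, MeasurableSet {u | i ∈ S n u}) (hSN : ∀ n u, S n u ⊆ Finset.range (2 * n))
    {h : ℕ → 𝒰 → (ℕ → 𝒪) → 𝒪 → ℝ}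
    (hh : ∀ n, Measurable fun z : 𝒰 × (ℕ → 𝒪) × 𝒪 => h n z.1 z.2.1 z.2.2)
    (hcongr : ∀ n u d d', (∀ j ∈ Finset.range (2 * n) \ S n u, d j = d' j) → h n u d = h n u d')
    (h0 : ∀ n u d, ∫⁻ z, ‖h n u d z‖ₑ ^ 2 ∂(μ.map (obs 0)) ≠ ∞ →
      ∫ z, h n u d z ∂(μ.map (obs 0)) = 0)
    (hW : TendstoZeroInProb μ
      (fun n ω => ∫⁻ z, ‖h n (U ω) (fun j => obs j ω) z‖ₑ ^ 2 ∂(μ.map (obs 0)))) :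
    TendstoZeroInProb μ (fun n ω => ‖(√((2 * n : ℕ) : ℝ))⁻¹ *
      ∑ i ∈ S n (U ω), h n (U ω) (fun j => obs j ω) (obs i ω)‖ₑ) := by
  intro η hη
  by_cases hηt : η = ∞
  · simp only [hηt, top_le_iff, enorm_ne_top, Set.ofPred_false, measure_empty]
    exact tendsto_const_nhds
  rw [ENNReal.tendsto_nhds_zero]
  intro ε hε
  have hη_sq : η ^ 2 ≠ 0 := pow_ne_zero 2 hη.ne'
  have hη_sq_top : η ^ 2 ≠ ∞ := ENNReal.pow_ne_top hηt
  have hε2 : 0 < ε / 2 := ENNReal.half_pos hε.ne'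
  have hκ : 0 < min 1 (ε / 2) * η ^ 2 := ENNReal.mul_pos (lt_min one_pos hε2).ne' hη_sq
  filter_upwards [(ENNReal.tendsto_nhds_zero.1 (hW _ hκ)) _ hε2, eventually_ne_atTop 0]
    with n hn hn0
  refine (measure_heldOut_sum_le hobs hind hid hU hUD (hSm n) (hSN n) (by omega) (hh n)
    (hcongr n) (h0 n) (κ := min 1 (ε / 2) * η ^ 2) hη.ne' hηt
    (ENNReal.mul_ne_top (ne_top_of_le_ne_top ENNReal.one_ne_top (min_le_left _ _)) hη_sq_top)).trans ?_
  rw [ENNReal.mul_div_cancel_right hη_sq hη_sq_top]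
  calc _ ≤ ε / 2 + ε / 2 := add_le_add hn (min_le_right _ _)
    _ = ε := ENNReal.add_halves ε

end HeldOutSums

section LimitTheorems

variable {Ω : Type*} [MeasurableSpace Ω] {μ : Measure Ω} [IsProbabilityMeasure μ]

open scoped RealInnerProductSpace in
/-- **Multivariate central limit theorem** for centred square integrable i.i.d. vectors. -/
theorem tendstoInDistribution_inv_sqrt_smul_sum_multivariate {ι : Type*} [Fintype ι]
    [DecidableEq ι] {ξ : ℕ → Ω → EuclideanSpace ℝ ι} (hind : iIndepFun ξ μ)
    (hid : ∀ i, IdentDistrib (ξ i) (ξ 0) μ μ) (hL2 : ∀ g, MemLp (fun ω => ξ 0 ω g) 2 μ)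
    (h0 : ∀ g, ∫ ω, ξ 0 ω g ∂μ = 0) {S : Matrix ι ι ℝ} (hS : S.PosSemidef)
    (hcov : ∀ g h, ∫ ω, ξ 0 ω g * ξ 0 ω h ∂μ = S g h) :
    TendstoInDistribution (fun (n : ℕ) ω => (√(n : ℝ))⁻¹ • ∑ i ∈ Finset.range n, ξ i ω) atTop id
      (fun _ => μ) (multivariateGaussian 0 S) where
  forall_aemeasurable n :=
    (Finset.aemeasurable_fun_sum (Finset.range n) fun i _ =>
      (hid i).aemeasurable_fst).fun_const_smul _
  aemeasurable_limit := aemeasurable_id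
  tendsto := by
    have hm : ∀ n : ℕ, AEMeasurable (fun ω => (√(n : ℝ))⁻¹ • ∑ i ∈ Finset.range n, ξ i ω) μ :=
      fun n => (Finset.aemeasurable_fun_sum (Finset.range n) fun i _ =>
      (hid i).aemeasurable_fst).fun_const_smul _
    refine ProbabilityMeasure.tendsto_iff_tendsto_charFun.2 fun t => ?_
    set X : ℕ → Ω → ℝ := fun i ω => ⟪ξ i ω, t⟫ with hX
    have hXsum : X 0 = fun ω => ∑ g, t g * ξ 0 ω g := by
      ext ω
      simp [hX, PiLp.inner_apply]
    have hX0 : ∫ ω, X 0 ω ∂μ = 0 := by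
      rw [hXsum, integral_finsetSum _ fun g _ => ((hL2 g).integrable one_le_two).const_mul _]
      simp [integral_const_mul, h0]
    have hXL : MemLp (X 0) 2 μ := by
      rw [hXsum]
      exact memLp_finsetSum _ fun g _ => (hL2 g).const_mul _
    have hvar : Var[X 0; μ] = t ⬝ᵥ S.mulVec t := by
      rw [variance_of_integral_eq_zero hXL.aestronglyMeasurable.aemeasurable hX0, hXsum]
      have hi : ∀ g h, Integrable (fun ω => (t g * ξ 0 ω g) * (t h * ξ 0 ω h)) μ := fun g h =>
        ((hL2 g).const_mul _).integrable_mul ((hL2 h).const_mul _)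
      simp only [sq, Finset.sum_mul_sum]
      rw [integral_finsetSum _ fun g _ => integrable_finsetSum _ fun h _ => hi g h]
      simp only [dotProduct, Matrix.mulVec, Finset.mul_sum]
      refine Finset.sum_congr rfl fun g _ => ?_
      rw [integral_finsetSum _ fun h _ => hi g h]
      refine Finset.sum_congr rfl fun h _ => ?_
      rw [← hcov g h, mul_comm (∫ ω, ξ 0 ω g * ξ 0 ω h ∂μ) (t h), ← mul_assoc,
        ← integral_const_mul]
      refine integral_congr_ae (ae_of_all _ fun ω => ?_)
      ring
    have hclt := tendstoInDistribution_inv_sqrt_mul_sum_sub (X := X) (P := μ)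
      (P' := gaussianReal 0 Var[X 0; μ].toNNReal) (Y := id) ⟨aemeasurable_id, by simp⟩ hXL
      (hind.comp (fun _ x => ⟪x, t⟫) fun _ => by fun_prop)
      (fun i => (hid i).comp (u := fun x => ⟪x, t⟫) (by fun_prop))
    have h1 := ProbabilityMeasure.tendsto_iff_tendsto_charFun.1 hclt.tendsto 1
    simp only [ProbabilityMeasure.coe_mk, Measure.map_id] at h1 ⊢
    convert h1 using 2 with n
    · have hm' : AEMeasurable (fun ω => (√(n : ℝ))⁻¹ * (∑ i ∈ Finset.range n, X i ω
          - n * ∫ ω, X 0 ω ∂μ)) μ := hclt.forall_aemeasurable n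
      rw [charFun_apply, charFun_apply, integral_map (hm n) (by fun_prop),
        integral_map hm' (by fun_prop)]
      refine integral_congr_ae (ae_of_all _ fun ω => ?_)
      simp only [hX0]
      simp [hX, sum_inner, inner_smul_left]
    · rw [charFun_multivariateGaussian hS, charFun_gaussianReal, hvar,
        Real.coe_toNNReal _ (hvar ▸ variance_nonneg _ _)]
      simp

/-- Weak law of large numbers along even sample sizes. -/
lemma tendstoInMeasure_average_two_mul {𝒪 : Type*} [MeasurableSpace 𝒪] {obs : ℕ → Ω → 𝒪}
    (hobs : ∀ i, Measurable (obs i)) (hind : iIndepFun obs μ)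
    (hid : ∀ i, IdentDistrib (obs i) (obs 0) μ μ) {f : 𝒪 → ℝ} (hf : Measurable f)
    (hint : Integrable (fun ω => f (obs 0 ω)) μ) :
    TendstoInMeasure μ (fun (n : ℕ) ω => ((2 * n : ℕ) : ℝ)⁻¹ *
      ∑ i ∈ Finset.range (2 * n), f (obs i ω)) atTop (fun _ => ∫ ω, f (obs 0 ω) ∂μ) := by
  have hlaw := strong_law_ae (μ := μ) (fun i ω => f (obs i ω)) hint
    (fun i j hij => (hind.indepFun hij).comp hf hf) fun i => (hid i).comp hf
  have h1 : TendstoInMeasure μ (fun (n : ℕ) ω => (n : ℝ)⁻¹ • ∑ i ∈ Finset.range n, f (obs i ω))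
      atTop (fun _ => ∫ ω, f (obs 0 ω) ∂μ) := by
    refine tendstoInMeasure_of_tendsto_ae (fun n => ?_) hlaw
    exact ((Finset.measurable_sum _ fun i _ =>
      hf.comp (hobs i)).const_smul ((n : ℝ)⁻¹)).aestronglyMeasurable
  exact h1.comp (tendsto_id.const_mul_atTop' (r := 2) two_pos)

end LimitTheorems

/-! ### Regression functions -/

section CondMean

variable {Ω : Type*} [MeasurableSpace Ω] {p : ℕ} {μ : Measure Ω} [IsProbabilityMeasure μ]
  {X : Ω → Cov p} {Z : Ω → ℝ}

lemma measurable_condMean (Z : Ω → ℝ) (X : Ω → Cov p) : Measurable (condMean μ Z X) :=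
  (StronglyMeasurable.integral_condDistrib (f := fun z : Cov p × ℝ => z.2)
    measurable_snd.stronglyMeasurable).measurable

lemma condMean_comp_ae_eq_condExp (hX : Measurable X) (hZ : Integrable Z μ) :
    (fun ω => condMean μ Z X (X ω)) =ᵐ[μ] μ[Z | MeasurableSpace.comap X inferInstance] :=
  (condExp_ae_eq_integral_condDistrib' hX hZ).symm

lemma memLp_condMean_comp (hX : Measurable X) {q : ℝ≥0∞} (hq : 1 ≤ q) (hZ : MemLp Z q μ) :
    MemLp (fun ω => condMean μ Z X (X ω)) q μ :=
  (hZ.condExp hq).ae_eq (condMean_comp_ae_eq_condExp hX (hZ.integrable hq)).symm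

lemma integral_mul_comp_eq_condMean (hX : Measurable X) {f : Cov p → ℝ} (hf : Measurable f)
    (hZ : Integrable Z μ) (hZf : Integrable (fun ω => Z ω * f (X ω)) μ) :
    ∫ ω, Z ω * f (X ω) ∂μ = ∫ ω, condMean μ Z X (X ω) * f (X ω) ∂μ := by
  have hfm : StronglyMeasurable[MeasurableSpace.comap X inferInstance] (fun ω => f (X ω)) :=
    (hf.comp (comap_measurable X)).stronglyMeasurable
  have h1 := condExp_mul_of_stronglyMeasurable_right (f := Z) hfm hZf hZ
  rw [← integral_condExp hX.comap_le (f := fun ω => Z ω * f (X ω))]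
  refine integral_congr_ae ?_
  filter_upwards [h1, condMean_comp_ae_eq_condExp hX hZ] with ω h1 h2
  rw [h2]
  exact h1

lemma integral_sub_condMean_mul (hX : Measurable X) {f : Cov p → ℝ} (hf : Measurable f)
    (hZ : MemLp Z 2 μ) (hfX : MemLp (fun ω => f (X ω)) 2 μ) :
    ∫ ω, (Z ω - condMean μ Z X (X ω)) * f (X ω) ∂μ = 0 := by
  have i1 : Integrable (fun ω => Z ω * f (X ω)) μ := hZ.integrable_mul hfX
  have i2 : Integrable (fun ω => condMean μ Z X (X ω) * f (X ω)) μ :=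
    (memLp_condMean_comp hX one_le_two hZ).integrable_mul hfX
  simp_rw [sub_mul]
  rw [integral_sub i1 i2, integral_mul_comp_eq_condMean hX hf (hZ.integrable one_le_two) i1,
    sub_self]

end CondMean

namespace Study

variable {Ω : Type*} [MeasurableSpace Ω] {p G : ℕ} {μ : Measure Ω} [IsProbabilityMeasure μ]
  {D : Study Ω p}

lemma measurable_propensity (D : Study Ω p) : Measurable (D.propensity μ) :=
  (Kernel.measurable_coe _ (measurableSet_singleton (1 : ℝ))).ennreal_toReal

lemma propensity_nonneg (x : Cov p) : 0 ≤ D.propensity μ x := measureReal_nonneg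

lemma propensity_le_one (x : Cov p) : D.propensity μ x ≤ 1 := measureReal_le_one

lemma measurable_outcomeReg (D : Study Ω p) : Measurable (D.outcomeReg μ) :=
  measurable_condMean _ _

lemma measurable_cate (D : Study Ω p) : Measurable (D.cate μ) :=
  measurable_condMean _ _

namespace IsCausal

lemma measurable_obs (hD : D.IsCausal μ) (i : ℕ) : Measurable (D.obs i) :=
  (hD.meas_Y i).prodMk ((hD.meas_A i).prodMk (hD.meas_X i))

lemma abs_A_le (hD : D.IsCausal μ) (i : ℕ) (ω : Ω) : |D.A i ω| ≤ 1 := by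
  rcases hD.binary i ω with h | h <;> simp [h]

lemma memLp_A (hD : D.IsCausal μ) {q : ℝ≥0∞} : MemLp (D.A 0) q μ :=
  MemLp.of_bound (hD.meas_A 0).aestronglyMeasurable 1 (ae_of_all _ fun ω => hD.abs_A_le 0 ω)

lemma memLp_propensity (hD : D.IsCausal μ) {q : ℝ≥0∞} :
    MemLp (fun ω => D.propensity μ (D.X 0 ω)) q μ :=
  MemLp.of_bound (D.measurable_propensity.comp (hD.meas_X 0)).aestronglyMeasurable 1
    (ae_of_all _ fun ω => by
      rw [Real.norm_eq_abs, abs_of_nonneg (propensity_nonneg _)]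
      exact propensity_le_one _)

lemma propensity_ae_eq_condExp (hD : D.IsCausal μ) :
    (fun ω => D.propensity μ (D.X 0 ω)) =ᵐ[μ]
      μ[D.A 0 | MeasurableSpace.comap (D.X 0) inferInstance] := by
  have h := condDistrib_ae_eq_condExp (μ := μ) (hD.meas_X 0) (hD.meas_A 0)
    (measurableSet_singleton (1 : ℝ))
  have hA : (D.A 0 ⁻¹' {1}).indicator (fun _ => (1 : ℝ)) = D.A 0 := by
    ext ω
    rcases hD.binary 0 ω with h | h <;> simp [Set.indicator, h]
  rw [hA] at h
  exact h

lemma propensity_ae_eq_condMean (hD : D.IsCausal μ) :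
    (fun ω => D.propensity μ (D.X 0 ω)) =ᵐ[μ]
      fun ω => condMean μ (D.A 0) (D.X 0) (D.X 0 ω) :=
  hD.propensity_ae_eq_condExp.trans (condMean_comp_ae_eq_condExp (hD.meas_X 0)
    (hD.memLp_A.integrable le_rfl)).symm

lemma Y_eq (hD : D.IsCausal μ) (ω : Ω) : D.Y 0 ω = D.Y0 0 ω + D.A 0 ω * (D.Y1 0 ω - D.Y0 0 ω) := by
  rcases hD.binary 0 ω with h | h
  · simp [h, (hD.consistency 0 ω).2 h]
  · simp [h, (hD.consistency 0 ω).1 h]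

/-- Overlap transfers moments of the observed outcome to a potential outcome. -/
lemma lintegral_enorm_pow_le (hD : D.IsCausal μ) {B : Set ℝ} (hB : MeasurableSet B) {c : ℝ≥0∞}
    (hc : ∀ᵐ x ∂(μ.map (D.X 0)), c ≤ condDistrib (D.A 0) (D.X 0) μ x B)
    {φ : ℝ × ℝ → ℝ≥0∞} (hφ : Measurable φ) :
    c * ∫⁻ ω, φ (D.Y1 0 ω, D.Y0 0 ω) ∂μ
      ≤ ∫⁻ ω, φ (D.Y1 0 ω, D.Y0 0 ω) * B.indicator 1 (D.A 0 ω) ∂μ := by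
  have hX := hD.meas_X 0
  have hW : Measurable fun ω => (D.Y1 0 ω, D.Y0 0 ω) := (hD.meas_Y1 0).prodMk (hD.meas_Y0 0)
  have hWA : Measurable fun ω => ((D.Y1 0 ω, D.Y0 0 ω), D.A 0 ω) := hW.prodMk (hD.meas_A 0)
  have hind : Measurable (B.indicator (1 : ℝ → ℝ≥0∞)) := measurable_one.indicator hB
  have hg : Measurable fun z : (ℝ × ℝ) × ℝ => φ z.1 * B.indicator 1 z.2 := by fun_prop
  have e1 : ∫⁻ ω, φ (D.Y1 0 ω, D.Y0 0 ω) ∂μ = ∫⁻ x, ∫⁻ w, φ w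
      ∂(condDistrib (fun ω => (D.Y1 0 ω, D.Y0 0 ω)) (D.X 0) μ x) ∂(μ.map (D.X 0)) := by
    rw [← Measure.lintegral_compProd (f := fun z : Cov p × (ℝ × ℝ) => φ z.2) (by fun_prop),
      compProd_map_condDistrib hW.aemeasurable, lintegral_map (by fun_prop) (hX.prodMk hW)]
  have e2 : ∫⁻ ω, φ (D.Y1 0 ω, D.Y0 0 ω) * B.indicator 1 (D.A 0 ω) ∂μ
      = ∫⁻ x, ∫⁻ z, φ z.1 * B.indicator 1 z.2
        ∂(condDistrib (fun ω => ((D.Y1 0 ω, D.Y0 0 ω), D.A 0 ω)) (D.X 0) μ x)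
        ∂(μ.map (D.X 0)) := by
    rw [← Measure.lintegral_compProd
      (f := fun z : Cov p × ((ℝ × ℝ) × ℝ) => φ z.2.1 * B.indicator 1 z.2.2) (by fun_prop),
      compProd_map_condDistrib hWA.aemeasurable, lintegral_map (by fun_prop) (hX.prodMk hWA)]
  rw [e1, e2, ← lintegral_const_mul c (Measurable.lintegral_kernel hφ)]
  refine lintegral_mono_ae ?_
  filter_upwards [hc, hD.unconfounded 0] with x hx hu
  rw [hu, lintegral_prod_mul hφ.aemeasurable hind.aemeasurable, lintegral_indicator_one hB,
    mul_comm]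
  gcongr

lemma memLp_potential (hD : D.IsCausal μ) (hY : MemLp (D.Y 0) 4 μ) :
    MemLp (D.Y1 0) 4 μ ∧ MemLp (D.Y0 0) 4 μ := by
  obtain ⟨c, hc0, hc⟩ := hD.overlap
  have hfin : ∫⁻ ω, ‖D.Y 0 ω‖ₑ ^ 4 ∂μ < ∞ := by
    have := (eLpNorm_lt_top_iff_lintegral_rpow_enorm_lt_top (by norm_num) (by norm_num)).1 hY.2
    simpa using this
  have hc1 : ENNReal.ofReal c ≠ 0 := by simpa using hc0
  have key : ∀ (Z : Ω → ℝ) (φ : ℝ × ℝ → ℝ≥0∞) (B : Set ℝ), Measurable Z → Measurable φ →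
      MeasurableSet B → (∀ ω, ‖Z ω‖ₑ ^ 4 = φ (D.Y1 0 ω, D.Y0 0 ω)) →
      (∀ ω, D.A 0 ω ∈ B → D.Y 0 ω = Z ω) →
      (∀ᵐ x ∂(μ.map (D.X 0)), ENNReal.ofReal c ≤ condDistrib (D.A 0) (D.X 0) μ x B) →
      MemLp Z 4 μ := by
    intro Z φ B hZ hφ hB hZφ hZY hcB
    refine ⟨hZ.aestronglyMeasurable, ?_⟩
    rw [eLpNorm_lt_top_iff_lintegral_rpow_enorm_lt_top (by norm_num) (by norm_num)]
    have h1 := hD.lintegral_enorm_pow_le hB hcB hφ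
    have h2 : ∫⁻ ω, φ (D.Y1 0 ω, D.Y0 0 ω) * B.indicator 1 (D.A 0 ω) ∂μ
        ≤ ∫⁻ ω, ‖D.Y 0 ω‖ₑ ^ 4 ∂μ := by
      refine lintegral_mono fun ω => ?_
      by_cases hω : D.A 0 ω ∈ B
      · simp [hω, hZY ω hω, hZφ ω]
      · simp [hω]
    simp only [ENNReal.toReal_ofNat, ENNReal.rpow_ofNat, hZφ]
    by_contra hcon
    rw [not_lt, top_le_iff] at hcon
    rw [hcon, ENNReal.mul_top hc1] at h1
    exact absurd (h1.trans h2) (not_le.2 hfin)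
  constructor
  · refine key (D.Y1 0) (fun w => ‖w.1‖ₑ ^ 4) {1} (hD.meas_Y1 0) (by fun_prop)
      (measurableSet_singleton _) (fun _ => rfl) (fun ω hω => (hD.consistency 0 ω).1 hω) ?_
    filter_upwards [hc] with x hx
    rw [← ENNReal.ofReal_toReal (measure_ne_top (condDistrib (D.A 0) (D.X 0) μ x) {1})]
    exact ENNReal.ofReal_le_ofReal hx.1
  · refine key (D.Y0 0) (fun w => ‖w.2‖ₑ ^ 4) {1}ᶜ (hD.meas_Y0 0) (by fun_prop)
      (measurableSet_singleton _).compl (fun _ => rfl)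
      (fun ω hω => (hD.consistency 0 ω).2 ((hD.binary 0 ω).resolve_right hω)) ?_
    filter_upwards [hc] with x hx
    rw [← ENNReal.ofReal_toReal (measure_ne_top (condDistrib (D.A 0) (D.X 0) μ x) {1}ᶜ)]
    refine ENNReal.ofReal_le_ofReal ?_
    change c ≤ (condDistrib (D.A 0) (D.X 0) μ x).real {1}ᶜ
    rw [probReal_compl_eq_one_sub (measurableSet_singleton _)]
    have := hx.2
    unfold propensity at this
    linarith

/-- Unconfoundedness: treatment and potential outcomes are conditionally uncorrelated. -/
lemma condExp_A_mul (hD : D.IsCausal μ) {φ : ℝ × ℝ → ℝ} (hφ : Measurable φ)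
    (hint : Integrable (fun ω => φ (D.Y1 0 ω, D.Y0 0 ω)) μ) :
    μ[fun ω => φ (D.Y1 0 ω, D.Y0 0 ω) * D.A 0 ω | MeasurableSpace.comap (D.X 0) inferInstance]
      =ᵐ[μ] fun ω => condMean μ (fun ω => φ (D.Y1 0 ω, D.Y0 0 ω)) (D.X 0) (D.X 0 ω)
        * D.propensity μ (D.X 0 ω) := by
  have hX := hD.meas_X 0
  have hW : Measurable fun ω => (D.Y1 0 ω, D.Y0 0 ω) := (hD.meas_Y1 0).prodMk (hD.meas_Y0 0)
  have hWA : Measurable fun ω => ((D.Y1 0 ω, D.Y0 0 ω), D.A 0 ω) := hW.prodMk (hD.meas_A 0)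
  have hint' : Integrable (fun ω => φ (D.Y1 0 ω, D.Y0 0 ω) * D.A 0 ω) μ :=
    hint.mul_bdd (hD.meas_A 0).aestronglyMeasurable (ae_of_all _ fun ω => hD.abs_A_le 0 ω)
  have h1 := condExp_ae_eq_integral_condDistrib hX hWA.aemeasurable
    (f := fun z : (ℝ × ℝ) × ℝ => φ z.1 * z.2) (by fun_prop : Measurable _).stronglyMeasurable hint'
  have h2 := condExp_ae_eq_integral_condDistrib hX hW.aemeasurable
    (f := φ) hφ.stronglyMeasurable hint
  have h3 := condExp_ae_eq_integral_condDistrib hX (hD.meas_A 0).aemeasurable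
    (f := fun a : ℝ => a) stronglyMeasurable_id (hD.memLp_A.integrable le_rfl)
  filter_upwards [h1, h2, h3, ae_of_ae_map hX.aemeasurable (hD.unconfounded 0),
    condMean_comp_ae_eq_condExp hX hint, hD.propensity_ae_eq_condExp] with ω h1 h2 h3 h4 h5 h6
  rw [h1, h4, integral_prod_mul φ (fun a : ℝ => a), h5, h6, h2, ← h3]

lemma integral_A_mul_sub_condMean_mul (hD : D.IsCausal μ) {φ : ℝ × ℝ → ℝ} (hφ : Measurable φ)
    (hφ2 : MemLp (fun ω => φ (D.Y1 0 ω, D.Y0 0 ω)) 2 μ) {f : Cov p → ℝ} (hf : Measurable f)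
    (hfX : MemLp (fun ω => f (D.X 0 ω)) 2 μ) :
    ∫ ω, D.A 0 ω * (φ (D.Y1 0 ω, D.Y0 0 ω)
      - condMean μ (fun ω => φ (D.Y1 0 ω, D.Y0 0 ω)) (D.X 0) (D.X 0 ω)) * f (D.X 0 ω) ∂μ = 0 := by
  have hX := hD.meas_X 0
  set Z : Ω → ℝ := fun ω => φ (D.Y1 0 ω, D.Y0 0 ω) with hZ
  set m : Cov p → ℝ := condMean μ Z (D.X 0) with hm
  have hmm : Measurable m := measurable_condMean _ _
  have hm2 : MemLp (fun ω => m (D.X 0 ω)) 2 μ := memLp_condMean_comp hX one_le_two hφ2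
  have hAb : ∀ᵐ ω ∂μ, ‖D.A 0 ω‖ ≤ 1 := ae_of_all _ fun ω => hD.abs_A_le 0 ω
  have hAm := (hD.meas_A 0).aestronglyMeasurable (μ := μ)
  have iZA : Integrable (fun ω => Z ω * D.A 0 ω) μ :=
    (hφ2.integrable one_le_two).mul_bdd hAm hAb
  have iZf : Integrable (fun ω => Z ω * f (D.X 0 ω)) μ := hφ2.integrable_mul hfX
  have imf : Integrable (fun ω => m (D.X 0 ω) * f (D.X 0 ω)) μ := hm2.integrable_mul hfX
  have iZAf : Integrable (fun ω => (Z ω * D.A 0 ω) * f (D.X 0 ω)) μ :=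
    (iZf.mul_bdd hAm hAb).congr (ae_of_all _ fun ω => by ring)
  have iAmf : Integrable (fun ω => D.A 0 ω * (m (D.X 0 ω) * f (D.X 0 ω))) μ :=
    (imf.mul_bdd hAm hAb).congr (ae_of_all _ fun ω => by ring)
  have e1 := integral_mul_comp_eq_condMean hX hf iZA iZAf
  have e2 := integral_mul_comp_eq_condMean hX (hmm.mul hf) (hD.memLp_A.integrable le_rfl) iAmf
  have e3 : ∫ ω, D.A 0 ω * (Z ω - m (D.X 0 ω)) * f (D.X 0 ω) ∂μ
      = ∫ ω, (Z ω * D.A 0 ω) * f (D.X 0 ω) ∂μ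
        - ∫ ω, D.A 0 ω * (m (D.X 0 ω) * f (D.X 0 ω)) ∂μ := by
    rw [← integral_sub iZAf iAmf]
    exact integral_congr_ae (ae_of_all _ fun ω => by ring)
  simp only [Pi.mul_apply] at e2
  rw [e3, e1, e2, sub_eq_zero]
  refine integral_congr_ae ?_
  filter_upwards [hD.condExp_A_mul hφ (hφ2.integrable one_le_two),
    condMean_comp_ae_eq_condExp hX iZA, hD.propensity_ae_eq_condMean] with ω h1 h2 h3
  rw [h2, h1, ← h3]
  ring

lemma outcomeReg_ae_eq (hD : D.IsCausal μ) (hY : MemLp (D.Y 0) 4 μ) :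
    ∀ᵐ ω ∂μ, D.outcomeReg μ (D.X 0 ω) = condMean μ (D.Y0 0) (D.X 0) (D.X 0 ω)
      + D.propensity μ (D.X 0 ω) * D.cate μ (D.X 0 ω) := by
  have hX := hD.meas_X 0
  obtain ⟨h1, h0⟩ := hD.memLp_potential hY
  have i1 : Integrable (D.Y0 0) μ := h0.integrable (by norm_num)
  have i2 : Integrable (fun ω => D.Y1 0 ω - D.Y0 0 ω) μ := (h1.sub h0).integrable (by norm_num)
  have i3 : Integrable (fun ω => (D.Y1 0 ω - D.Y0 0 ω) * D.A 0 ω) μ :=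
    i2.mul_bdd (hD.meas_A 0).aestronglyMeasurable (ae_of_all _ fun ω => hD.abs_A_le 0 ω)
  have hYe : D.Y 0 = D.Y0 0 + fun ω => (D.Y1 0 ω - D.Y0 0 ω) * D.A 0 ω := by
    ext ω
    rw [hD.Y_eq ω, Pi.add_apply, mul_comm]
  have hadd := condExp_add i1 i3 (MeasurableSpace.comap (D.X 0) inferInstance)
  rw [← hYe] at hadd
  filter_upwards [hadd, hD.condExp_A_mul (φ := fun w => w.1 - w.2) (by fun_prop) i2,
    condMean_comp_ae_eq_condExp hX i1,
    condMean_comp_ae_eq_condExp hX (hY.integrable (by norm_num))] with ω a1 a2 a3 a4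
  unfold outcomeReg cate
  rw [a4, a1, Pi.add_apply, a2, a3]
  ring

end IsCausal

end Study

lemma measurable_groupInd {p G : ℕ} {M : Cov p → Fin G} (hM : Measurable M) (g : Fin G) :
    Measurable fun x => groupInd M x g :=
  Measurable.ite (hM (measurableSet_singleton g)) measurable_const measurable_const

lemma abs_groupInd_le {p G : ℕ} (M : Cov p → Fin G) (x : Cov p) (g : Fin G) :
    |groupInd M x g| ≤ 1 := by
  unfold groupInd
  split_ifs <;> simp

lemma groupInd_mul_self {p G : ℕ} (M : Cov p → Fin G) (x : Cov p) (g : Fin G) :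
    groupInd M x g * groupInd M x g = groupInd M x g := by
  unfold groupInd
  split_ifs <;> simp

lemma sum_mul_groupInd {p G : ℕ} (M : Cov p → Fin G) (x : Cov p) (t : Fin G → ℝ) :
    ∑ g, t g * groupInd M x g = t (M x) := by
  simp [groupInd]

namespace Study

variable {Ω : Type*} [MeasurableSpace Ω] {p G : ℕ} {μ : Measure Ω} [IsProbabilityMeasure μ]
  {D : Study Ω p} {M : Cov p → Fin G}

/-- The error `ε'` as a function of the observation. -/
noncomputable def residual (D : Study Ω p) (μ : Measure Ω) [IsFiniteMeasure μ]
    (M : Cov p → Fin G) (z : Obs p) : ℝ :=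
  z.1 - D.outcomeReg μ z.2.2 - (z.2.1 - D.propensity μ z.2.2) * D.tau μ M (M z.2.2)

/-- The residualized treatment `A - e(X)` as a function of the observation. -/
noncomputable def treatRes (D : Study Ω p) (μ : Measure Ω) [IsFiniteMeasure μ] (z : Obs p) : ℝ :=
  z.2.1 - D.propensity μ z.2.2

lemma measurable_treatRes (D : Study Ω p) : Measurable (D.treatRes μ) :=
  (measurable_fst.comp measurable_snd).sub
    (D.measurable_propensity.comp (measurable_snd.comp measurable_snd))

lemma measurable_residual (D : Study Ω p) (hM : Measurable M) : Measurable (D.residual μ M) := by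
  have h2 : Measurable fun z : Obs p => z.2.2 := by fun_prop
  exact (measurable_fst.sub (D.measurable_outcomeReg.comp h2)).sub
    (D.measurable_treatRes.mul ((measurable_of_finite (D.tau μ M)).comp (hM.comp h2)))

lemma measurable_delta (D : Study Ω p) (hM : Measurable M) : Measurable (D.delta μ M) := by
  have : D.delta μ M = fun x => D.cate μ x - D.tau μ M (M x) := by
    ext x
    rw [delta, sum_mul_groupInd]
  rw [this]
  exact D.measurable_cate.sub ((measurable_of_finite (D.tau μ M)).comp hM)

namespace IsCausal

lemma abs_treatRes_le (hD : D.IsCausal μ) (i : ℕ) (ω : Ω) : |D.treatRes μ (D.obs i ω)| ≤ 1 := by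
  have h0 := propensity_nonneg (D := D) (μ := μ) (D.X i ω)
  have h1 := propensity_le_one (D := D) (μ := μ) (D.X i ω)
  change |D.A i ω - D.propensity μ (D.X i ω)| ≤ 1
  rcases hD.binary i ω with h | h <;> rw [h, abs_le] <;> constructor <;> linarith

lemma memLp_treatRes (hD : D.IsCausal μ) {q : ℝ≥0∞} :
    MemLp (fun ω => D.treatRes μ (D.obs 0 ω)) q μ :=
  MemLp.of_bound (D.measurable_treatRes.comp (hD.measurable_obs 0)).aestronglyMeasurable 1
    (ae_of_all _ fun ω => hD.abs_treatRes_le 0 ω)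

lemma memLp_groupInd (hD : D.IsCausal μ) (hM : Measurable M) (g : Fin G) {q : ℝ≥0∞} :
    MemLp (fun ω => groupInd M (D.X 0 ω) g) q μ :=
  MemLp.of_bound ((measurable_groupInd hM g).comp (hD.meas_X 0)).aestronglyMeasurable 1
    (ae_of_all _ fun _ => abs_groupInd_le M _ g)

lemma memLp_tau_comp (hD : D.IsCausal μ) (hM : Measurable M) {q : ℝ≥0∞} :
    MemLp (fun ω => D.tau μ M (M (D.X 0 ω))) q μ :=
  MemLp.of_bound (((measurable_of_finite (D.tau μ M)).comp hM).comp
    (hD.meas_X 0)).aestronglyMeasurable (∑ g, |D.tau μ M g|) (ae_of_all _ fun _ =>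
      Finset.single_le_sum (f := fun g => |D.tau μ M g|) (fun _ _ => abs_nonneg _)
        (Finset.mem_univ _))

lemma memLp_delta (hD : D.IsCausal μ) (hM : Measurable M) (hY : MemLp (D.Y 0) 4 μ) :
    MemLp (fun ω => D.delta μ M (D.X 0 ω)) 4 μ := by
  obtain ⟨h1, h0⟩ := hD.memLp_potential hY
  have := (memLp_condMean_comp (hD.meas_X 0) (by norm_num) (h1.sub h0)).sub
    (hD.memLp_tau_comp hM)
  refine this.ae_eq (ae_of_all _ fun ω => ?_)
  simp only [Pi.sub_apply, delta, sum_mul_groupInd]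
  rfl

lemma memLp_residual (hD : D.IsCausal μ) (hM : Measurable M) (hY : MemLp (D.Y 0) 4 μ) :
    MemLp (fun ω => D.residual μ M (D.obs 0 ω)) 4 μ := by
  have h1 := memLp_condMean_comp (hD.meas_X 0) (by norm_num) hY
  have h2 : MemLp (fun ω => D.treatRes μ (D.obs 0 ω) * D.tau μ M (M (D.X 0 ω))) 4 μ :=
    (hD.memLp_tau_comp hM (q := 4)).mul' (hD.memLp_treatRes (q := ∞))
  exact (hY.sub h1).sub h2

lemma integral_treatRes_mul (hD : D.IsCausal μ) {f : Cov p → ℝ} (hf : Measurable f)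
    (hfX : MemLp (fun ω => f (D.X 0 ω)) 2 μ) :
    ∫ ω, D.treatRes μ (D.obs 0 ω) * f (D.X 0 ω) ∂μ = 0 := by
  rw [← integral_sub_condMean_mul (hD.meas_X 0) hf hD.memLp_A hfX]
  refine integral_congr_ae ?_
  filter_upwards [hD.propensity_ae_eq_condMean] with ω h
  rw [← h]
  rfl

lemma integral_residual_mul (hD : D.IsCausal μ) (hM : Measurable M) (hY : MemLp (D.Y 0) 4 μ)
    {f : Cov p → ℝ} (hf : Measurable f) (hfX : MemLp (fun ω => f (D.X 0 ω)) 2 μ) :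
    ∫ ω, D.residual μ M (D.obs 0 ω) * f (D.X 0 ω) ∂μ = 0 := by
  have hY2 : MemLp (D.Y 0) 2 μ := hY.mono_exponent (by norm_num)
  have hτf : MemLp (fun ω => D.tau μ M (M (D.X 0 ω)) * f (D.X 0 ω)) 2 μ :=
    hfX.mul' (hD.memLp_tau_comp hM (q := ∞))
  have hτfm : Measurable fun x => D.tau μ M (M x) * f x :=
    ((measurable_of_finite (D.tau μ M)).comp hM).mul hf
  have i1 : Integrable (fun ω => (D.Y 0 ω - condMean μ (D.Y 0) (D.X 0) (D.X 0 ω))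
      * f (D.X 0 ω)) μ :=
    (hY2.sub (memLp_condMean_comp (hD.meas_X 0) one_le_two hY2)).integrable_mul hfX
  have i2 : Integrable (fun ω => D.treatRes μ (D.obs 0 ω)
      * (D.tau μ M (M (D.X 0 ω)) * f (D.X 0 ω))) μ :=
    (hD.memLp_treatRes (q := 2)).integrable_mul hτf
  have e1 := integral_sub_condMean_mul (hD.meas_X 0) hf hY2 hfX
  have e2 := hD.integral_treatRes_mul hτfm hτf
  calc _ = ∫ ω, (D.Y 0 ω - condMean μ (D.Y 0) (D.X 0) (D.X 0 ω)) * f (D.X 0 ω)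
        - D.treatRes μ (D.obs 0 ω) * (D.tau μ M (M (D.X 0 ω)) * f (D.X 0 ω)) ∂μ :=
        integral_congr_ae (ae_of_all _ fun ω => by
          simp only [residual, treatRes, obs, outcomeReg]; ring)
    _ = 0 := by rw [integral_sub i1 i2, e1, e2, sub_zero]

lemma eps_eq (hD : D.IsCausal μ) (ω : Ω) : D.eps μ M ω
    = (D.Y0 0 ω - condMean μ (D.Y0 0) (D.X 0) (D.X 0 ω))
      + D.A 0 ω * ((D.Y1 0 ω - D.Y0 0 ω) - D.cate μ (D.X 0 ω)) := by
  rw [eps, delta, sum_mul_groupInd, hD.Y_eq ω]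
  ring

lemma memLp_eps (hD : D.IsCausal μ) (hY : MemLp (D.Y 0) 4 μ) : MemLp (D.eps μ M) 4 μ := by
  obtain ⟨h1, h0⟩ := hD.memLp_potential hY
  have a1 := h0.sub (memLp_condMean_comp (hD.meas_X 0) (by norm_num) h0)
  have a2 := (h1.sub h0).sub (memLp_condMean_comp (hD.meas_X 0) (by norm_num) (h1.sub h0))
  have a3 := a2.mul' (hD.memLp_A (q := ∞)) (r := 4)
  refine (a1.add a3).ae_eq (ae_of_all _ fun ω => ?_)
  rw [hD.eps_eq ω]
  rfl

/-- The error is centred given covariates and treatment. -/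
lemma integral_eps_mul (hD : D.IsCausal μ) (hY : MemLp (D.Y 0) 4 μ)
    {f₁ f₂ : Cov p → ℝ} (hf₁ : Measurable f₁) (hf₂ : Measurable f₂)
    (hfX₁ : MemLp (fun ω => f₁ (D.X 0 ω)) 2 μ) (hfX₂ : MemLp (fun ω => f₂ (D.X 0 ω)) 2 μ) :
    ∫ ω, D.eps μ M ω * (f₁ (D.X 0 ω) + D.A 0 ω * f₂ (D.X 0 ω)) ∂μ = 0 := by
  obtain ⟨h1, h0⟩ := hD.memLp_potential hY
  have h0' : MemLp (D.Y0 0) 2 μ := h0.mono_exponent (by norm_num)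
  have hd' : MemLp (fun ω => D.Y1 0 ω - D.Y0 0 ω) 2 μ := (h1.sub h0).mono_exponent (by norm_num)
  have hX := hD.meas_X 0
  set R0 : Ω → ℝ := fun ω => D.Y0 0 ω - condMean μ (D.Y0 0) (D.X 0) (D.X 0 ω) with hR0
  set R1 : Ω → ℝ := fun ω => (D.Y1 0 ω - D.Y0 0 ω) - D.cate μ (D.X 0 ω) with hR1
  have hR0L : MemLp R0 2 μ := h0'.sub (memLp_condMean_comp hX one_le_two h0')
  have hR1L : MemLp R1 2 μ := hd'.sub (memLp_condMean_comp hX one_le_two hd')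
  have e1 : ∫ ω, R0 ω * f₁ (D.X 0 ω) ∂μ = 0 := integral_sub_condMean_mul hX hf₁ h0' hfX₁
  have e2 : ∫ ω, D.A 0 ω * R0 ω * f₂ (D.X 0 ω) ∂μ = 0 :=
    hD.integral_A_mul_sub_condMean_mul (φ := fun w => w.2) measurable_snd h0' hf₂ hfX₂
  have hfX : MemLp (fun ω => f₁ (D.X 0 ω) + f₂ (D.X 0 ω)) 2 μ := hfX₁.add hfX₂
  have e3 : ∫ ω, D.A 0 ω * R1 ω * (f₁ (D.X 0 ω) + f₂ (D.X 0 ω)) ∂μ = 0 :=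
    hD.integral_A_mul_sub_condMean_mul (φ := fun w => w.1 - w.2) (by fun_prop) hd'
      (hf₁.add hf₂) hfX
  have i1 : Integrable (fun ω => R0 ω * f₁ (D.X 0 ω)) μ := hR0L.integrable_mul hfX₁
  have i2 : Integrable (fun ω => D.A 0 ω * R0 ω * f₂ (D.X 0 ω)) μ :=
    (hR0L.mul' (hD.memLp_A (q := ∞)) (r := 2)).integrable_mul hfX₂
  have i3 : Integrable (fun ω => D.A 0 ω * R1 ω * (f₁ (D.X 0 ω) + f₂ (D.X 0 ω))) μ :=
    (hR1L.mul' (hD.memLp_A (q := ∞)) (r := 2)).integrable_mul hfX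
  calc _ = ∫ ω, (R0 ω * f₁ (D.X 0 ω) + D.A 0 ω * R0 ω * f₂ (D.X 0 ω))
        + D.A 0 ω * R1 ω * (f₁ (D.X 0 ω) + f₂ (D.X 0 ω)) ∂μ := by
        refine integral_congr_ae (ae_of_all _ fun ω => ?_)
        simp only [hD.eps_eq ω, hR0, hR1]
        rcases hD.binary 0 ω with h | h <;> rw [h] <;> ring
    _ = 0 := by
        rw [integral_add (f := fun ω => R0 ω * f₁ (D.X 0 ω) + D.A 0 ω * R0 ω * f₂ (D.X 0 ω))
          (i1.add i2) i3, integral_add i1 i2, e1, e2, e3]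
        norm_num

lemma residual_ae_eq_eps' (hD : D.IsCausal μ) (hY : MemLp (D.Y 0) 4 μ) :
    ∀ᵐ ω ∂μ, D.residual μ M (D.obs 0 ω) = D.eps' μ M ω := by
  filter_upwards [hD.outcomeReg_ae_eq hY] with ω h
  simp only [residual, obs, h, eps', eps, delta, sum_mul_groupInd]
  ring

lemma integral_treatRes_sq_mul (hD : D.IsCausal μ) {f : Cov p → ℝ} (hf : Measurable f)
    (hfX : MemLp (fun ω => f (D.X 0 ω)) 2 μ) :
    ∫ ω, D.treatRes μ (D.obs 0 ω) ^ 2 * f (D.X 0 ω) ∂μ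
      = ∫ ω, D.propensity μ (D.X 0 ω) * (1 - D.propensity μ (D.X 0 ω)) * f (D.X 0 ω) ∂μ := by
  have hem := D.measurable_propensity (μ := μ)
  have heX : MemLp (fun ω => 1 - 2 * D.propensity μ (D.X 0 ω)) ∞ μ :=
    (memLp_const 1).sub (hD.memLp_propensity.const_mul 2)
  have hefX : MemLp (fun ω => (1 - 2 * D.propensity μ (D.X 0 ω)) * f (D.X 0 ω)) 2 μ :=
    hfX.mul' heX
  have e1 := hD.integral_treatRes_mul (f := fun x => (1 - 2 * D.propensity μ x) * f x)
    ((measurable_const.sub (hem.const_mul 2)).mul hf) hefX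
  have i1 : Integrable (fun ω => D.treatRes μ (D.obs 0 ω)
      * ((1 - 2 * D.propensity μ (D.X 0 ω)) * f (D.X 0 ω))) μ :=
    (hD.memLp_treatRes (q := 2)).integrable_mul hefX
  have heX' : MemLp (fun ω => D.propensity μ (D.X 0 ω) * (1 - D.propensity μ (D.X 0 ω))) 2 μ :=
    ((memLp_const (p := 2) 1).sub hD.memLp_propensity).mul' (hD.memLp_propensity (q := ∞))
  have i2 : Integrable (fun ω => D.propensity μ (D.X 0 ω) * (1 - D.propensity μ (D.X 0 ω))
      * f (D.X 0 ω)) μ := heX'.integrable_mul hfX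
  calc _ = ∫ ω, D.treatRes μ (D.obs 0 ω) * ((1 - 2 * D.propensity μ (D.X 0 ω)) * f (D.X 0 ω))
        + D.propensity μ (D.X 0 ω) * (1 - D.propensity μ (D.X 0 ω)) * f (D.X 0 ω) ∂μ := by
        refine integral_congr_ae (ae_of_all _ fun ω => ?_)
        simp only [treatRes, obs]
        rcases hD.binary 0 ω with h | h <;> rw [h] <;> ring
    _ = _ := by rw [integral_add i1 i2, e1, zero_add]

lemma integral_delta_mul_groupInd (hD : D.IsCausal μ) (hM : Measurable M)
    (hY : MemLp (D.Y 0) 4 μ) (g : Fin G) (hg : μ.real {ω | M (D.X 0 ω) = g} ≠ 0) :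
    ∫ ω, D.delta μ M (D.X 0 ω) * groupInd M (D.X 0 ω) g ∂μ = 0 := by
  obtain ⟨h1, h0⟩ := hD.memLp_potential hY
  have hd : MemLp (fun ω => D.Y1 0 ω - D.Y0 0 ω) 2 μ := (h1.sub h0).mono_exponent (by norm_num)
  have hX := hD.meas_X 0
  have hI : MemLp (fun ω => groupInd M (D.X 0 ω) g) 2 μ := hD.memLp_groupInd hM g
  have hset : MeasurableSet {ω | M (D.X 0 ω) = g} := (hM.comp hX) (measurableSet_singleton g)
  have hIs : ∀ (Z : Ω → ℝ), (fun ω => Z ω * groupInd M (D.X 0 ω) g)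
      = {ω | M (D.X 0 ω) = g}.indicator Z := by
    intro Z
    ext ω
    by_cases h : M (D.X 0 ω) = g <;> simp [groupInd, h]
  have i1 : Integrable (fun ω => (D.Y1 0 ω - D.Y0 0 ω) * groupInd M (D.X 0 ω) g) μ :=
    hd.integrable_mul hI
  have i2 : Integrable (fun ω => D.cate μ (D.X 0 ω) * groupInd M (D.X 0 ω) g) μ :=
    (memLp_condMean_comp hX one_le_two hd).integrable_mul hI
  have i3 : Integrable (fun ω => D.tau μ M g * groupInd M (D.X 0 ω) g) μ :=
    (hI.integrable one_le_two).const_mul _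
  have e1 := integral_mul_comp_eq_condMean hX (measurable_groupInd hM g)
    (hd.integrable one_le_two) i1
  have e2 : ∫ ω, (D.Y1 0 ω - D.Y0 0 ω) * groupInd M (D.X 0 ω) g ∂μ
      = μ.real {ω | M (D.X 0 ω) = g} * D.tau μ M g := by
    rw [hIs, integral_indicator hset, tau, ProbabilityTheory.cond, integral_smul_measure,
      smul_eq_mul,
      ENNReal.toReal_inv, ← measureReal_def, mul_inv_cancel_left₀ hg]
  have e3 : ∫ ω, D.tau μ M g * groupInd M (D.X 0 ω) g ∂μ
      = D.tau μ M g * μ.real {ω | M (D.X 0 ω) = g} := by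
    rw [hIs, integral_indicator hset, setIntegral_const, smul_eq_mul, mul_comm]
  calc _ = ∫ ω, D.cate μ (D.X 0 ω) * groupInd M (D.X 0 ω) g
        - D.tau μ M g * groupInd M (D.X 0 ω) g ∂μ := by
        refine integral_congr_ae (ae_of_all _ fun ω => ?_)
        simp only [delta, sum_mul_groupInd]
        by_cases h : M (D.X 0 ω) = g <;> simp [groupInd, h]
    _ = 0 := by
        rw [integral_sub i2 i3, e3]
        have : ∫ ω, D.cate μ (D.X 0 ω) * groupInd M (D.X 0 ω) g ∂μ = _ := e1.symm
        rw [this, e2]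
        ring

end IsCausal

end Study

namespace Study

variable {Ω : Type*} [MeasurableSpace Ω] {p G : ℕ} {μ : Measure Ω} [IsProbabilityMeasure μ]
  {D : Study Ω p} {M : Cov p → Fin G}

namespace IsCausal

lemma integral_residual_mul_treatRes (hD : D.IsCausal μ) (hM : Measurable M)
    (hY : MemLp (D.Y 0) 4 μ) (g : Fin G) (hg : μ.real {ω | M (D.X 0 ω) = g} ≠ 0)
    (he : ∃ eg : ℝ, ∀ᵐ x ∂(D.lawX μ), M x = g → D.propensity μ x = eg) :
    ∫ ω, D.residual μ M (D.obs 0 ω) * D.treatRes μ (D.obs 0 ω) * groupInd M (D.X 0 ω) g ∂μ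
      = 0 := by
  obtain ⟨eg, heg⟩ := he
  have hIm := measurable_groupInd hM g
  have hδI : MemLp (fun ω => D.delta μ M (D.X 0 ω) * groupInd M (D.X 0 ω) g) 2 μ :=
    ((hD.memLp_groupInd hM g (q := ∞)).mul' (hD.memLp_delta hM hY) (r := 4)).mono_exponent
      (by norm_num)
  have hIe : MemLp (fun ω => -(D.propensity μ (D.X 0 ω) * groupInd M (D.X 0 ω) g)) 2 μ :=
    ((hD.memLp_groupInd hM g (q := ∞)).mul' (hD.memLp_propensity (q := 2))).neg
  have e1 := hD.integral_eps_mul (M := M) hY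
    (f₁ := fun x => -(D.propensity μ x * groupInd M x g)) (f₂ := fun x => groupInd M x g)
    (D.measurable_propensity.mul hIm).neg hIm hIe (hD.memLp_groupInd hM g)
  have e2 := hD.integral_treatRes_sq_mul (f := fun x => D.delta μ M x * groupInd M x g)
    ((D.measurable_delta hM).mul hIm) hδI
  have e3 : ∫ ω, D.propensity μ (D.X 0 ω) * (1 - D.propensity μ (D.X 0 ω))
      * (D.delta μ M (D.X 0 ω) * groupInd M (D.X 0 ω) g) ∂μ = 0 := by
    calc _ = ∫ ω, eg * (1 - eg) * (D.delta μ M (D.X 0 ω) * groupInd M (D.X 0 ω) g) ∂μ := by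
          refine integral_congr_ae ?_
          filter_upwards [ae_of_ae_map (hD.meas_X 0).aemeasurable heg] with ω hω
          by_cases h : M (D.X 0 ω) = g
          · rw [hω h]
          · simp [groupInd, h]
      _ = 0 := by rw [integral_const_mul, hD.integral_delta_mul_groupInd hM hY g hg, mul_zero]
  have i1 : Integrable (fun ω => D.treatRes μ (D.obs 0 ω) ^ 2
      * (D.delta μ M (D.X 0 ω) * groupInd M (D.X 0 ω) g)) μ := by
    simp_rw [sq]
    exact ((hD.memLp_treatRes (q := 2)).mul' (hD.memLp_treatRes (q := ∞))
      (r := 2)).integrable_mul hδI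
  have i2 : Integrable (fun ω => D.eps μ M ω * (-(D.propensity μ (D.X 0 ω)
      * groupInd M (D.X 0 ω) g) + D.A 0 ω * groupInd M (D.X 0 ω) g)) μ :=
    ((hD.memLp_eps hY).mono_exponent (by norm_num)).integrable_mul (p := 2) (q := 2)
      (hIe.add ((hD.memLp_groupInd hM g (q := ∞)).mul' (hD.memLp_A (q := 2))))
  calc _ = ∫ ω, D.treatRes μ (D.obs 0 ω) ^ 2
        * (D.delta μ M (D.X 0 ω) * groupInd M (D.X 0 ω) g)
        + D.eps μ M ω * (-(D.propensity μ (D.X 0 ω) * groupInd M (D.X 0 ω) g)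
          + D.A 0 ω * groupInd M (D.X 0 ω) g) ∂μ := by
        refine integral_congr_ae ?_
        filter_upwards [hD.residual_ae_eq_eps' (M := M) hY] with ω hω
        rw [hω]
        simp only [eps', treatRes, obs]
        ring
    _ = 0 := by rw [integral_add i1 i2, e1, e2, e3, add_zero]

lemma denom_pos (hD : D.IsCausal μ) (hM : Measurable M) (g : Fin G)
    (hg : 0 < μ.real {ω | M (D.X 0 ω) = g}) : 0 < D.denom μ M g := by
  obtain ⟨c, hc0, hc⟩ := hD.overlap
  have hX := hD.meas_X 0
  have e1 := hD.integral_treatRes_sq_mul (measurable_groupInd hM g) (hD.memLp_groupInd hM g)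
  have hset : MeasurableSet {ω | M (D.X 0 ω) = g} := (hM.comp hX) (measurableSet_singleton g)
  have e2 : ∫ ω, c ^ 2 * groupInd M (D.X 0 ω) g ∂μ = c ^ 2 * μ.real {ω | M (D.X 0 ω) = g} := by
    have : (fun ω => c ^ 2 * groupInd M (D.X 0 ω) g)
        = {ω | M (D.X 0 ω) = g}.indicator fun _ => c ^ 2 := by
      ext ω
      by_cases h : M (D.X 0 ω) = g <;> simp [groupInd, h]
    rw [this, integral_indicator hset, setIntegral_const, smul_eq_mul, mul_comm]
  have hI2 := hD.memLp_groupInd hM g (q := ∞)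
  have heX' : MemLp (fun ω => D.propensity μ (D.X 0 ω) * (1 - D.propensity μ (D.X 0 ω))) 1 μ :=
    ((memLp_const (p := 1) 1).sub hD.memLp_propensity).mul' (hD.memLp_propensity (q := ∞))
  have e3 : c ^ 2 * μ.real {ω | M (D.X 0 ω) = g} ≤ D.denom μ M g := by
    calc _ = ∫ ω, c ^ 2 * groupInd M (D.X 0 ω) g ∂μ := e2.symm
      _ ≤ ∫ ω, D.propensity μ (D.X 0 ω) * (1 - D.propensity μ (D.X 0 ω))
          * groupInd M (D.X 0 ω) g ∂μ := by
          refine integral_mono_ae (((hD.memLp_groupInd hM g).integrable le_rfl).const_mul _)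
            (memLp_one_iff_integrable.1 (hI2.mul' heX')) ?_
          filter_upwards [ae_of_ae_map hX.aemeasurable hc] with ω hω
          have : 0 ≤ groupInd M (D.X 0 ω) g := by unfold groupInd; split_ifs <;> simp
          refine mul_le_mul_of_nonneg_right ?_ this
          nlinarith [hω.1, hω.2]
      _ = _ := e1.symm
  exact lt_of_lt_of_le (by positivity) e3

/-- The variance of the influence function splits into the bias and the noise contribution. -/
lemma integral_residual_sq_mul (hD : D.IsCausal μ) (hM : Measurable M)
    (hY : MemLp (D.Y 0) 4 μ) (g : Fin G) (hg : 0 < μ.real {ω | M (D.X 0 ω) = g}) :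
    ∫ ω, D.residual μ M (D.obs 0 ω) ^ 2 * (D.treatRes μ (D.obs 0 ω) ^ 2
      * groupInd M (D.X 0 ω) g) ∂μ = D.SigmaDiag' μ M g * D.denom μ M g ^ 2 := by
  have hIm := measurable_groupInd hM g
  have hem := D.measurable_propensity (μ := μ)
  have hδ := hD.memLp_delta hM hY
  have hε := hD.memLp_eps (M := M) hY
  have hδI : MemLp (fun ω => D.delta μ M (D.X 0 ω) * groupInd M (D.X 0 ω) g) 4 μ :=
    (hD.memLp_groupInd hM g (q := ∞)).mul' hδ
  have hbdd : ∀ {F : Cov p → ℝ}, Measurable F → (∃ C, ∀ x, |F x| ≤ C) →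
      MemLp (fun ω => F (D.X 0 ω)) ∞ μ := fun hF ⟨C, hC⟩ =>
    MemLp.of_bound (hF.comp (hD.meas_X 0)).aestronglyMeasurable C (ae_of_all _ fun ω => hC _)
  set q : Cov p → ℝ := D.propensity μ with hq
  have hq0 : ∀ x, 0 ≤ q x := fun x => propensity_nonneg x
  have hq1 : ∀ x, q x ≤ 1 := fun x => propensity_le_one x
  have hq3 : ∀ x, |(-(q x ^ 3))| ≤ 1 := fun x => by
    rw [abs_neg, abs_of_nonneg (pow_nonneg (hq0 x) 3)]
    exact pow_le_one₀ (hq0 x) (hq1 x)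
  have hq4 : ∀ x, |(1 - q x) ^ 3 + q x ^ 3| ≤ 2 := fun x => by
    have a := pow_le_one₀ (n := 3) (hq0 x) (hq1 x)
    have b := pow_le_one₀ (n := 3) (sub_nonneg.2 (hq1 x)) (by linarith [hq0 x])
    have a' := pow_nonneg (hq0 x) 3
    have b' := pow_nonneg (sub_nonneg.2 (hq1 x)) 3
    rw [abs_of_nonneg (by linarith)]
    linarith
  have hm1 : Measurable fun x => -(q x ^ 3) := (hem.pow_const 3).neg
  have hm2 : Measurable fun x => (1 - q x) ^ 3 + q x ^ 3 :=
    ((measurable_const.sub hem).pow_const 3).add (hem.pow_const 3)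
  have hf1 : MemLp (fun ω => -(q (D.X 0 ω) ^ 3)
      * (D.delta μ M (D.X 0 ω) * groupInd M (D.X 0 ω) g)) 4 μ :=
    hδI.mul' (hbdd (F := fun x => -(q x ^ 3)) hm1 ⟨1, hq3⟩)
  have hf2 : MemLp (fun ω => ((1 - q (D.X 0 ω)) ^ 3 + q (D.X 0 ω) ^ 3)
      * (D.delta μ M (D.X 0 ω) * groupInd M (D.X 0 ω) g)) 4 μ :=
    hδI.mul' (hbdd (F := fun x => (1 - q x) ^ 3 + q x ^ 3) hm2 ⟨2, hq4⟩)
  have hδm := (D.measurable_delta (μ := μ) hM).mul hIm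
  have e1 := hD.integral_eps_mul (M := M) hY
    (f₁ := fun x => -(q x ^ 3) * (D.delta μ M x * groupInd M x g))
    (f₂ := fun x => ((1 - q x) ^ 3 + q x ^ 3) * (D.delta μ M x * groupInd M x g))
    (hm1.mul hδm) (hm2.mul hδm)
    (hf1.mono_exponent (by norm_num)) (hf2.mono_exponent (by norm_num))
  have hf : MemLp (fun ω => -(q (D.X 0 ω) ^ 3)
      * (D.delta μ M (D.X 0 ω) * groupInd M (D.X 0 ω) g)
      + D.A 0 ω * (((1 - q (D.X 0 ω)) ^ 3 + q (D.X 0 ω) ^ 3)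
      * (D.delta μ M (D.X 0 ω) * groupInd M (D.X 0 ω) g))) 4 μ :=
    hf1.add (hf2.mul' (hD.memLp_A (q := ∞)))
  have i1 : Integrable (fun ω => D.eps μ M ω * (-(q (D.X 0 ω) ^ 3)
      * (D.delta μ M (D.X 0 ω) * groupInd M (D.X 0 ω) g)
      + D.A 0 ω * (((1 - q (D.X 0 ω)) ^ 3 + q (D.X 0 ω) ^ 3)
      * (D.delta μ M (D.X 0 ω) * groupInd M (D.X 0 ω) g)))) μ :=
    (hε.mono_exponent (by norm_num)).integrable_mul (p := 2) (q := 2)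
      (hf.mono_exponent (by norm_num))
  have hres : MemLp (fun ω => D.treatRes μ (D.obs 0 ω)) ∞ μ := hD.memLp_treatRes
  have hI := hD.memLp_groupInd hM g (q := ∞)
  have hresI : MemLp (fun ω => D.treatRes μ (D.obs 0 ω) * groupInd M (D.X 0 ω) g) ∞ μ :=
    hI.mul' hres
  have i2 : Integrable (fun ω => (D.A 0 ω - q (D.X 0 ω)) ^ 4 * D.delta μ M (D.X 0 ω) ^ 2
      * groupInd M (D.X 0 ω) g) μ := by
    have h4 : MemLp (fun ω => D.treatRes μ (D.obs 0 ω) * (D.treatRes μ (D.obs 0 ω)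
        * D.delta μ M (D.X 0 ω))) 4 μ := (hδ.mul' hres (r := 4)).mul' hres
    have h4I : MemLp (fun ω => (D.treatRes μ (D.obs 0 ω) * (D.treatRes μ (D.obs 0 ω)
        * D.delta μ M (D.X 0 ω))) * groupInd M (D.X 0 ω) g) 4 μ := hI.mul' h4
    refine ((h4.mono_exponent (by norm_num)).integrable_mul (p := 2) (q := 2)
      (h4I.mono_exponent (by norm_num))).congr (ae_of_all _ fun ω => ?_)
    simp only [Pi.mul_apply, treatRes, obs, hq]
    ring
  have i3 : Integrable (fun ω => D.eps μ M ω ^ 2 * (D.A 0 ω - q (D.X 0 ω)) ^ 2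
      * groupInd M (D.X 0 ω) g) μ := by
    have h4 : MemLp (fun ω => D.treatRes μ (D.obs 0 ω) * D.eps μ M ω) 4 μ := hε.mul' hres
    have h4I : MemLp (fun ω => (D.treatRes μ (D.obs 0 ω) * D.eps μ M ω)
        * groupInd M (D.X 0 ω) g) 4 μ := hI.mul' h4
    refine ((h4.mono_exponent (by norm_num)).integrable_mul (p := 2) (q := 2)
      (h4I.mono_exponent (by norm_num))).congr (ae_of_all _ fun ω => ?_)
    simp only [Pi.mul_apply, treatRes, obs, hq]
    ring
  have i23 : Integrable (fun ω => (D.A 0 ω - q (D.X 0 ω)) ^ 4 * D.delta μ M (D.X 0 ω) ^ 2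
      * groupInd M (D.X 0 ω) g + D.eps μ M ω ^ 2 * (D.A 0 ω - q (D.X 0 ω)) ^ 2
      * groupInd M (D.X 0 ω) g) μ := i2.add i3
  have hd := (hD.denom_pos hM g hg).ne'
  calc _ = ∫ ω, ((D.A 0 ω - q (D.X 0 ω)) ^ 4 * D.delta μ M (D.X 0 ω) ^ 2
        * groupInd M (D.X 0 ω) g + D.eps μ M ω ^ 2 * (D.A 0 ω - q (D.X 0 ω)) ^ 2
        * groupInd M (D.X 0 ω) g)
        + 2 * (D.eps μ M ω * (-(q (D.X 0 ω) ^ 3)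
          * (D.delta μ M (D.X 0 ω) * groupInd M (D.X 0 ω) g)
          + D.A 0 ω * (((1 - q (D.X 0 ω)) ^ 3 + q (D.X 0 ω) ^ 3)
          * (D.delta μ M (D.X 0 ω) * groupInd M (D.X 0 ω) g)))) ∂μ := by
        refine integral_congr_ae ?_
        filter_upwards [hD.residual_ae_eq_eps' (M := M) hY] with ω hω
        rw [hω]
        simp only [eps', treatRes, obs, hq]
        rcases hD.binary 0 ω with h | h <;> rw [h] <;> ring
    _ = (∫ ω, (D.A 0 ω - q (D.X 0 ω)) ^ 4 * D.delta μ M (D.X 0 ω) ^ 2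
        * groupInd M (D.X 0 ω) g ∂μ) + ∫ ω, D.eps μ M ω ^ 2 * (D.A 0 ω - q (D.X 0 ω)) ^ 2
        * groupInd M (D.X 0 ω) g ∂μ := by
        rw [integral_add i23 (i1.const_mul 2), integral_add i2 i3, integral_const_mul, e1,
          mul_zero, add_zero]
    _ = _ := by
        rw [SigmaDiag', SigmaDiag]
        field_simp
        rfl

lemma Sigma'_eq_diagonal (hD : D.IsCausal μ) (hM : Measurable M) (hY : MemLp (D.Y 0) 4 μ)
    (hg : ∀ g, 0 < μ.real {ω | M (D.X 0 ω) = g}) :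
    D.Sigma' μ M = Matrix.diagonal (D.SigmaDiag' μ M) := by
  have hV : ∀ g h ω, D.Vstar μ M g ω * D.Vstar μ M h ω = if g = h then
      D.treatRes μ (D.obs 0 ω) ^ 2 * groupInd M (D.X 0 ω) g else 0 := by
    intro g h ω
    by_cases hgh : g = h
    · subst hgh
      simp only [Vstar, treatRes, obs, if_true]
      rw [mul_mul_mul_comm, groupInd_mul_self, sq]
    · rw [if_neg hgh]
      by_cases h1 : M (D.X 0 ω) = g
      · have h2 : M (D.X 0 ω) ≠ h := fun h' => hgh (h1.symm.trans h')
        simp [Vstar, groupInd, h2]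
      · simp [Vstar, groupInd, h1]
  have h1 : (Matrix.of fun g h => ∫ ω, D.Vstar μ M g ω * D.Vstar μ M h ω ∂μ)
      = Matrix.diagonal (D.denom μ M) := by
    ext g h
    simp only [Matrix.of_apply, hV, Matrix.diagonal_apply]
    split_ifs with hgh
    · rfl
    · simp
  have h2 : (Matrix.of fun g h => ∫ ω, D.eps' μ M ω ^ 2 * (D.Vstar μ M g ω * D.Vstar μ M h ω) ∂μ)
      = Matrix.diagonal fun g => D.SigmaDiag' μ M g * D.denom μ M g ^ 2 := by
    ext g h
    simp only [Matrix.of_apply, hV, Matrix.diagonal_apply]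
    split_ifs with hgh
    · rw [← hD.integral_residual_sq_mul hM hY g (hg g)]
      refine integral_congr_ae ?_
      filter_upwards [hD.residual_ae_eq_eps' (M := M) hY] with ω hω
      rw [hω]
    · simp
  have hpos := fun g => (hD.denom_pos hM g (hg g)).ne'
  have hinv : (Matrix.diagonal (D.denom μ M))⁻¹ = Matrix.diagonal fun g => (D.denom μ M g)⁻¹ := by
    refine Matrix.inv_eq_right_inv ?_
    rw [Matrix.diagonal_mul_diagonal, ← Matrix.diagonal_one]
    congr 1
    ext g
    exact mul_inv_cancel₀ (hpos g)
  rw [Sigma', h1, h2, hinv, Matrix.diagonal_mul_diagonal, Matrix.diagonal_mul_diagonal]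
  congr 1
  ext g
  have := hpos g
  field_simp

end IsCausal

end Study

namespace CrossFit

variable {𝒰 : Type*} {p G : ℕ} {L : CrossFit 𝒰 p}

/-- The index of the fold containing individual `i`. -/
def foldIndex (L : CrossFit 𝒰 p) (n : ℕ) (u : 𝒰) (i : ℕ) : Fin 2 :=
  if i ∈ L.split n u then 0 else 1

lemma IsValid.split_subset [MeasurableSpace 𝒰] (hL : L.IsValid) (n : ℕ) (u : 𝒰) :
    L.split n u ⊆ Finset.range (2 * n) :=
  (Finset.mem_powersetCard.1 (hL.split_mem n u)).1

lemma IsValid.fold_subset [MeasurableSpace 𝒰] (hL : L.IsValid) (n : ℕ) (u : 𝒰) (k : Fin 2) :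
    L.fold n u k ⊆ Finset.range (2 * n) := by
  unfold fold
  split_ifs
  · exact hL.split_subset n u
  · exact Finset.sdiff_subset

lemma IsValid.measurableSet_mem_fold [MeasurableSpace 𝒰] (hL : L.IsValid) (n : ℕ) (k : Fin 2)
    (i : ℕ) : MeasurableSet {u | i ∈ L.fold n u k} := by
  have h : MeasurableSet {u | i ∈ L.split n u} :=
    (measurableSet_mem_finset i).preimage (hL.meas_split n)
  unfold fold
  by_cases hk : k = 0
  · simpa only [hk, if_true] using h
  · simp only [hk, if_false, Finset.mem_sdiff]
    exact (MeasurableSet.const _).inter h.compl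

/-- A sum over both folds is a sum over the whole sample. -/
lemma IsValid.sum_fold [MeasurableSpace 𝒰] {R : Type*} [AddCommMonoid R] (hL : L.IsValid) (n : ℕ)
    (u : 𝒰) (f : Fin 2 → ℕ → R) :
    ∑ k, ∑ i ∈ L.fold n u k, f k i = ∑ i ∈ Finset.range (2 * n), f (L.foldIndex n u i) i := by
  rw [Fin.sum_univ_two, ← Finset.sum_sdiff (hL.split_subset n u), add_comm]
  congr 1
  · refine Finset.sum_congr (by simp [fold]) fun i hi => ?_
    rw [foldIndex, if_neg (Finset.mem_sdiff.1 hi).2]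
  · refine Finset.sum_congr (by simp [fold]) fun i hi => ?_
    rw [foldIndex, if_pos]
    simpa [fold] using hi

end CrossFit

section LIntegral

variable {α : Type*} [MeasurableSpace α] {ν : Measure α}

lemma sq_lintegral_mul_le {f g : α → ℝ≥0∞} (hf : AEMeasurable f ν) (hg : AEMeasurable g ν) :
    (∫⁻ a, f a * g a ∂ν) ^ 2 ≤ (∫⁻ a, f a ^ 2 ∂ν) * ∫⁻ a, g a ^ 2 ∂ν := by
  have h := ENNReal.lintegral_mul_le_Lp_mul_Lq ν Real.HolderConjugate.two_two hf hg
  simp only [Pi.mul_apply, ENNReal.rpow_ofNat] at h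
  calc _ ≤ ((∫⁻ a, f a ^ 2 ∂ν) ^ (1 / (2 : ℝ)) * (∫⁻ a, g a ^ 2 ∂ν) ^ (1 / (2 : ℝ))) ^ 2 :=
        pow_le_pow_left₀ zero_le h 2
    _ = _ := by
        rw [mul_pow, ← ENNReal.rpow_natCast, ← ENNReal.rpow_natCast, ← ENNReal.rpow_mul,
          ← ENNReal.rpow_mul]
        norm_num

lemma lintegral_mul_le_eLpNorm {f g : α → ℝ} (hf : AEMeasurable f ν) (hg : AEMeasurable g ν) :
    ∫⁻ a, ‖f a‖ₑ * ‖g a‖ₑ ∂ν ≤ eLpNorm f 2 ν * eLpNorm g 2 ν := by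
  have h := ENNReal.lintegral_mul_le_Lp_mul_Lq ν Real.HolderConjugate.two_two hf.enorm hg.enorm
  rw [eLpNorm_eq_lintegral_rpow_enorm_toReal two_ne_zero ENNReal.ofNat_ne_top,
    eLpNorm_eq_lintegral_rpow_enorm_toReal two_ne_zero ENNReal.ofNat_ne_top]
  simpa using h

lemma eLpNorm_two_sq (f : α → ℝ) : eLpNorm f 2 ν ^ 2 = ∫⁻ a, ‖f a‖ₑ ^ 2 ∂ν := by
  rw [eLpNorm_eq_lintegral_rpow_enorm_toReal two_ne_zero ENNReal.ofNat_ne_top,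
    ← ENNReal.rpow_natCast, ← ENNReal.rpow_mul]
  norm_num

lemma enorm_add_sq_le (a b : ℝ) : ‖a + b‖ₑ ^ 2 ≤ 2 * (‖a‖ₑ ^ 2 + ‖b‖ₑ ^ 2) := by
  have h : ∀ x : ℝ, ‖x‖ₑ ^ 2 = ENNReal.ofReal (x ^ 2) := fun x => by
    rw [Real.enorm_eq_ofReal_abs, ← ENNReal.ofReal_pow (abs_nonneg _), sq_abs]
  rw [h, h, h, ← ENNReal.ofReal_add (sq_nonneg _) (sq_nonneg _),
    ← ENNReal.ofReal_ofNat 2, ← ENNReal.ofReal_mul (by norm_num)]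
  exact ENNReal.ofReal_le_ofReal (by nlinarith [sq_nonneg (a - b)])

end LIntegral

section CrossFitting

variable {Ω 𝒰 : Type*} [MeasurableSpace Ω] [MeasurableSpace 𝒰] {p G : ℕ} {μ : Measure Ω}
  [IsProbabilityMeasure μ] {D : Study Ω p} {L : CrossFit 𝒰 p} {U : Ω → 𝒰}

/-- The `k`-th nuisance estimates at the covariates of `z`, together with `z` itself. -/
def CrossFit.nuisance (L : CrossFit 𝒰 p) (n : ℕ) (k : Fin 2) (u : 𝒰) (d : ℕ → Obs p)
    (z : Obs p) : ℝ × ℝ × Obs p :=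
  (L.Ehat n k u d z.2.2, L.ehat n k u d z.2.2, z)

lemma CrossFit.IsValid.measurable_nuisance (hL : L.IsValid) (n : ℕ) (k : Fin 2) :
    Measurable fun y : 𝒰 × (ℕ → Obs p) × Obs p => L.nuisance n k y.1 y.2.1 y.2.2 := by
  have h : Measurable fun y : 𝒰 × (ℕ → Obs p) × Obs p => (y.1, y.2.1, y.2.2.2.2) := by fun_prop
  exact ((hL.meas_Ehat n k).comp h).prodMk (((hL.meas_ehat n k).comp h).prodMk (by fun_prop))

lemma CrossFit.IsValid.nuisance_congr (hL : L.IsValid) (n : ℕ) (k : Fin 2) (u : 𝒰)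
    (d d' : ℕ → Obs p) (h : ∀ j ∈ Finset.range (2 * n) \ L.fold n u k, d j = d' j) :
    L.nuisance n k u d = L.nuisance n k u d' := by
  ext1 z
  simp only [nuisance, hL.Ehat_congr n k u d d' h, hL.ehat_congr n k u d d' h]

lemma Study.IsCausal.map_obs (hD : D.IsCausal μ) (i : ℕ) :
    μ.map (D.obs i) = μ.map (D.obs 0) := (hD.identDistrib i).map_eq

lemma tendstoZeroInProb_average (hD : D.IsCausal μ) (hL : L.IsValid) (hU : Measurable U)
    (hUD : IndepFun U D.data μ) (k : Fin 2) {H : ℕ → ℝ × ℝ × Obs p → ℝ≥0∞}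
    (hH : ∀ n, Measurable (H n))
    (hW : TendstoZeroInProb μ fun n ω =>
      ∫⁻ ω', H n (L.nuisance n k (U ω) (D.data ω) (D.obs 0 ω')) ∂μ) :
    TendstoZeroInProb μ fun n ω => ((2 * n : ℕ) : ℝ≥0∞)⁻¹ *
      ∑ i ∈ L.fold n (U ω) k, H n (L.nuisance n k (U ω) (D.data ω) (D.obs i ω)) := by
  have hm : ∀ n, Measurable fun y : 𝒰 × (ℕ → Obs p) × Obs p =>
      H n (L.nuisance n k y.1 y.2.1 y.2.2) := fun n => (hH n).comp (hL.measurable_nuisance n k)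
  refine tendstoZeroInProb_heldOut_average (obs := D.obs) hD.measurable_obs hD.indep hD.map_obs
    hU hUD (S := fun n u => L.fold n u k) (fun n i => hL.measurableSet_mem_fold n k i)
    (fun n u => hL.fold_subset n u k) (h := fun n u d z => H n (L.nuisance n k u d z)) hm
    (fun n u d d' h => by simp only [hL.nuisance_congr n k u d d' h]) ?_
  have hm' : ∀ n u d, Measurable fun z => H n (L.nuisance n k u d z) := fun n u d =>
    (hm n).comp (by fun_prop : Measurable fun z : Obs p => (u, d, z))
  refine hW.mono fun n ω => ?_
  rw [lintegral_map (hm' n _ _) (hD.measurable_obs 0)]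
  rfl

lemma tendstoZeroInProb_centred_sum (hD : D.IsCausal μ) (hL : L.IsValid) (hU : Measurable U)
    (hUD : IndepFun U D.data μ) (k : Fin 2) {H : ℝ × ℝ × Obs p → ℝ} (hH : Measurable H)
    (h0 : ∀ n u d, ∫⁻ ω', ‖H (L.nuisance n k u d (D.obs 0 ω'))‖ₑ ^ 2 ∂μ ≠ ∞ →
      ∫ ω', H (L.nuisance n k u d (D.obs 0 ω')) ∂μ = 0)
    (hW : TendstoZeroInProb μ fun n ω =>
      ∫⁻ ω', ‖H (L.nuisance n k (U ω) (D.data ω) (D.obs 0 ω'))‖ₑ ^ 2 ∂μ) :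
    TendstoZeroInProb μ fun n ω => ‖(√((2 * n : ℕ) : ℝ))⁻¹ *
      ∑ i ∈ L.fold n (U ω) k, H (L.nuisance n k (U ω) (D.data ω) (D.obs i ω))‖ₑ := by
  have hm : ∀ n, Measurable fun y : 𝒰 × (ℕ → Obs p) × Obs p =>
      H (L.nuisance n k y.1 y.2.1 y.2.2) := fun n => hH.comp (hL.measurable_nuisance n k)
  have hm' : ∀ n u d, Measurable fun z => H (L.nuisance n k u d z) := fun n u d =>
    (hm n).comp (by fun_prop : Measurable fun z : Obs p => (u, d, z))
  have hsq : ∀ n u d, ∫⁻ z, ‖H (L.nuisance n k u d z)‖ₑ ^ 2 ∂(μ.map (D.obs 0))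
      = ∫⁻ ω', ‖H (L.nuisance n k u d (D.obs 0 ω'))‖ₑ ^ 2 ∂μ := fun n u d => by
    rw [lintegral_map ((hm' n u d).enorm.pow_const 2) (hD.measurable_obs 0)]
  refine tendstoZeroInProb_heldOut_sum (obs := D.obs) hD.measurable_obs hD.indep hD.map_obs
    hU hUD (S := fun n u => L.fold n u k) (fun n i => hL.measurableSet_mem_fold n k i)
    (fun n u => hL.fold_subset n u k) (h := fun n u d z => H (L.nuisance n k u d z)) hm
    (fun n u d d' h => by simp only [hL.nuisance_congr n k u d d' h]) (fun n u d h => ?_)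
    (hW.mono fun n ω => (hsq n _ _).le)
  rw [integral_map (hD.measurable_obs 0).aemeasurable (hm' n u d).aestronglyMeasurable]
  exact h0 n u d (hsq n u d ▸ h)

end CrossFitting

section NuisanceErrors

variable {Ω 𝒰 : Type*} [MeasurableSpace Ω] {p G : ℕ} {μ : Measure Ω}
  [IsProbabilityMeasure μ] {D : Study Ω p} {L : CrossFit 𝒰 p} {U : Ω → 𝒰} {M : Cov p → Fin G}

namespace Study

/-- The error of the estimated outcome regression. -/
noncomputable def devE (D : Study Ω p) (μ : Measure Ω) [IsFiniteMeasure μ]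
    (y : ℝ × ℝ × Obs p) : ℝ := y.1 - D.outcomeReg μ y.2.2.2.2

/-- The error of the estimated propensity score. -/
noncomputable def devProp (D : Study Ω p) (μ : Measure Ω) [IsFiniteMeasure μ]
    (y : ℝ × ℝ × Obs p) : ℝ := y.2.1 - D.propensity μ y.2.2.2.2

lemma measurable_devE (D : Study Ω p) : Measurable (D.devE μ) :=
  measurable_fst.sub (D.measurable_outcomeReg.comp (by fun_prop))

lemma measurable_devProp (D : Study Ω p) : Measurable (D.devProp μ) :=
  (measurable_fst.comp measurable_snd).sub (D.measurable_propensity.comp (by fun_prop))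

end Study

lemma abs_devProp_le {B : ℝ} (hB : ∀ n k u d x, |L.ehat n k u d x| ≤ B) (n : ℕ) (k : Fin 2)
    (u : 𝒰) (d : ℕ → Obs p) (z : Obs p) : |D.devProp μ (L.nuisance n k u d z)| ≤ B + 1 := by
  have h0 := Study.propensity_nonneg (D := D) (μ := μ) z.2.2
  have h1 := Study.propensity_le_one (D := D) (μ := μ) z.2.2
  have h2 := abs_le.1 (hB n k u d z.2.2)
  change |L.ehat n k u d z.2.2 - D.propensity μ z.2.2| ≤ B + 1
  rw [abs_le]
  constructor <;> linarith

lemma enorm_devProp_le {B : ℝ} (hB : ∀ n k u d x, |L.ehat n k u d x| ≤ B) (n : ℕ) (k : Fin 2)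
    (u : 𝒰) (d : ℕ → Obs p) (z : Obs p) :
    ‖D.devProp μ (L.nuisance n k u d z)‖ₑ ≤ ENNReal.ofReal (B + 1) := by
  rw [Real.enorm_eq_ofReal_abs]
  exact ENNReal.ofReal_le_ofReal (abs_devProp_le hB n k u d z)

lemma enorm_treatRes_le (hD : D.IsCausal μ) (i : ℕ) (ω : Ω) :
    ‖D.treatRes μ (D.obs i ω)‖ₑ ≤ 1 := by
  rw [Real.enorm_eq_ofReal_abs, ← ENNReal.ofReal_one]
  exact ENNReal.ofReal_le_ofReal (hD.abs_treatRes_le i ω)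

lemma enorm_groupInd_le (M : Cov p → Fin G) (x : Cov p) (g : Fin G) : ‖groupInd M x g‖ₑ ≤ 1 := by
  rw [Real.enorm_eq_ofReal_abs, ← ENNReal.ofReal_one]
  exact ENNReal.ofReal_le_ofReal (abs_groupInd_le M x g)

lemma Regular.tendstoZeroInProb_errProp_sq (hreg : Regular D μ M L U) (k : Fin 2) :
    TendstoZeroInProb μ fun n ω => errProp D μ L U k n ω ^ 2 := by
  refine (hreg.rate_ehat k).mono_of_pos fun n hn ω => ?_
  refine le_mul_of_one_le_left zero_le ?_
  rw [← ENNReal.ofReal_one]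
  refine ENNReal.ofReal_le_ofReal (Real.one_le_sqrt.2 ?_)
  have : (1 : ℝ) ≤ n := by exact_mod_cast hn
  linarith

variable [MeasurableSpace 𝒰]

lemma measurable_nuisance_obs (hD : D.IsCausal μ) (hL : L.IsValid) (n : ℕ) (k : Fin 2) (u : 𝒰)
    (d : ℕ → Obs p) : Measurable fun ω' => L.nuisance n k u d (D.obs 0 ω') :=
  (hL.measurable_nuisance n k).comp
    (measurable_const.prodMk (measurable_const.prodMk (hD.measurable_obs 0)))

lemma measurable_devE_nuisance (hD : D.IsCausal μ) (hL : L.IsValid) (n : ℕ) (k : Fin 2) (u : 𝒰)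
    (d : ℕ → Obs p) : Measurable fun ω' => D.devE μ (L.nuisance n k u d (D.obs 0 ω')) :=
  D.measurable_devE.comp (measurable_nuisance_obs hD hL n k u d)

lemma measurable_devProp_nuisance (hD : D.IsCausal μ) (hL : L.IsValid) (n : ℕ) (k : Fin 2)
    (u : 𝒰) (d : ℕ → Obs p) :
    Measurable fun ω' => D.devProp μ (L.nuisance n k u d (D.obs 0 ω')) :=
  D.measurable_devProp.comp (measurable_nuisance_obs hD hL n k u d)

lemma lintegral_devE_sq (hD : D.IsCausal μ) (hL : L.IsValid) (k : Fin 2) (n : ℕ) (ω : Ω) :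
    ∫⁻ ω', ‖D.devE μ (L.nuisance n k (U ω) (D.data ω) (D.obs 0 ω'))‖ₑ ^ 2 ∂μ
      = errE D μ L U k n ω ^ 2 := by
  have hm : Measurable fun x => L.Ehat n k (U ω) (D.data ω) x - D.outcomeReg μ x :=
    ((hL.meas_Ehat n k).comp (by fun_prop : Measurable fun x : Cov p =>
      (U ω, D.data ω, x))).sub D.measurable_outcomeReg
  rw [errE, eLpNorm_two_sq, Study.lawX, lintegral_map (hm.enorm.pow_const 2) (hD.meas_X 0)]
  rfl

lemma lintegral_devProp_sq (hD : D.IsCausal μ) (hL : L.IsValid) (k : Fin 2) (n : ℕ) (ω : Ω) :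
    ∫⁻ ω', ‖D.devProp μ (L.nuisance n k (U ω) (D.data ω) (D.obs 0 ω'))‖ₑ ^ 2 ∂μ
      = errProp D μ L U k n ω ^ 2 := by
  have hm : Measurable fun x => L.ehat n k (U ω) (D.data ω) x - D.propensity μ x :=
    ((hL.meas_ehat n k).comp (by fun_prop : Measurable fun x : Cov p =>
      (U ω, D.data ω, x))).sub D.measurable_propensity
  rw [errProp, eLpNorm_two_sq, Study.lawX, lintegral_map (hm.enorm.pow_const 2) (hD.meas_X 0)]
  rfl

lemma lintegral_devE_mul_devProp_le (hD : D.IsCausal μ) (hL : L.IsValid) (k : Fin 2) (n : ℕ)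
    (ω : Ω) :
    ∫⁻ ω', ‖D.devE μ (L.nuisance n k (U ω) (D.data ω) (D.obs 0 ω'))‖ₑ
      * ‖D.devProp μ (L.nuisance n k (U ω) (D.data ω) (D.obs 0 ω'))‖ₑ ∂μ
      ≤ errProp D μ L U k n ω * errE D μ L U k n ω := by
  have hm1 : Measurable fun x => L.Ehat n k (U ω) (D.data ω) x - D.outcomeReg μ x :=
    ((hL.meas_Ehat n k).comp (by fun_prop : Measurable fun x : Cov p =>
      (U ω, D.data ω, x))).sub D.measurable_outcomeReg
  have hm2 : Measurable fun x => L.ehat n k (U ω) (D.data ω) x - D.propensity μ x :=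
    ((hL.meas_ehat n k).comp (by fun_prop : Measurable fun x : Cov p =>
      (U ω, D.data ω, x))).sub D.measurable_propensity
  have hm12 : Measurable fun x => ‖L.Ehat n k (U ω) (D.data ω) x - D.outcomeReg μ x‖ₑ
      * ‖L.ehat n k (U ω) (D.data ω) x - D.propensity μ x‖ₑ := hm1.enorm.mul hm2.enorm
  have h := lintegral_mul_le_eLpNorm (ν := D.lawX μ) hm1.aemeasurable hm2.aemeasurable
  rw [Study.lawX, lintegral_map hm12 (hD.meas_X 0)] at h
  rw [mul_comm (errProp D μ L U k n ω)]
  exact h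

lemma tendstoZeroInProb_residual_mul_devProp (hD : D.IsCausal μ) (hM : Measurable M)
    (hL : L.IsValid) (hreg : Regular D μ M L U) (k : Fin 2) :
    TendstoZeroInProb μ fun n ω => ∫⁻ ω', ‖D.residual μ M (D.obs 0 ω')
      * D.devProp μ (L.nuisance n k (U ω) (D.data ω) (D.obs 0 ω'))‖ₑ ^ 2 ∂μ := by
  obtain ⟨B, hB⟩ := hL.ehat_bounded
  have hρ := hD.memLp_residual hM hreg.moment_Y
  have hρ4 : ∫⁻ ω', (‖D.residual μ M (D.obs 0 ω')‖ₑ ^ 2) ^ 2 ∂μ ≠ ∞ := by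
    have := (eLpNorm_lt_top_iff_lintegral_rpow_enorm_lt_top (by norm_num) (by norm_num)).1 hρ.2
    refine ne_of_lt ?_
    simpa [← pow_mul] using this
  have hK : ENNReal.ofReal (B + 1) ^ 2 ≠ ∞ := ENNReal.pow_ne_top ENNReal.ofReal_ne_top
  refine TendstoZeroInProb.of_pow (k := 2) (((hreg.tendstoZeroInProb_errProp_sq k).const_mul
    (ENNReal.mul_ne_top hρ4 hK)).mono fun n ω => ?_)
  have hmρ : Measurable fun ω' => D.residual μ M (D.obs 0 ω') :=
    (D.measurable_residual hM).comp (hD.measurable_obs 0)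
  have hmd := measurable_devProp_nuisance hD hL n k (U ω) (D.data ω)
  simp_rw [enorm_mul, mul_pow]
  refine (sq_lintegral_mul_le (hmρ.enorm.pow_const 2).aemeasurable
    (hmd.enorm.pow_const 2).aemeasurable).trans ?_
  rw [mul_assoc]
  gcongr
  rw [← lintegral_devProp_sq hD hL, ← lintegral_const_mul' _ _ hK]
  refine lintegral_mono fun ω' => ?_
  dsimp only
  rw [sq (_ ^ 2)]
  gcongr
  exact enorm_devProp_le hB _ _ _ _ _

lemma tendstoZeroInProb_devE_add (hD : D.IsCausal μ)
    (hL : L.IsValid) (hreg : Regular D μ M L U) (k : Fin 2) (t : ℝ) :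
    TendstoZeroInProb μ fun n ω => ∫⁻ ω',
      ‖-D.devE μ (L.nuisance n k (U ω) (D.data ω) (D.obs 0 ω'))
        + t * D.devProp μ (L.nuisance n k (U ω) (D.data ω) (D.obs 0 ω'))‖ₑ ^ 2 ∂μ := by
  have h1 := ((hreg.consistent_Ehat k).pow two_ne_zero).add
    ((hreg.tendstoZeroInProb_errProp_sq k).const_mul (c := ‖t‖ₑ ^ 2)
      (ENNReal.pow_ne_top enorm_ne_top))
  refine (h1.const_mul (c := 2) ENNReal.ofNat_ne_top).mono fun n ω => ?_
  have hmE := measurable_devE_nuisance hD hL n k (U ω) (D.data ω)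
  have hmd := measurable_devProp_nuisance hD hL n k (U ω) (D.data ω)
  calc _ ≤ ∫⁻ ω', 2 * (‖D.devE μ (L.nuisance n k (U ω) (D.data ω) (D.obs 0 ω'))‖ₑ ^ 2
        + ‖t‖ₑ ^ 2 * ‖D.devProp μ (L.nuisance n k (U ω) (D.data ω) (D.obs 0 ω'))‖ₑ ^ 2) ∂μ := by
        refine lintegral_mono fun ω' => (enorm_add_sq_le _ _).trans ?_
        rw [enorm_neg, enorm_mul, mul_pow]
    _ = _ := by
        rw [lintegral_const_mul' _ _ ENNReal.ofNat_ne_top,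
          lintegral_add_left (hmE.enorm.pow_const 2),
          lintegral_const_mul' _ _ (ENNReal.pow_ne_top enorm_ne_top),
          lintegral_devProp_sq hD hL, lintegral_devE_sq hD hL]

lemma tendstoZeroInProb_devE_mul_devProp (hD : D.IsCausal μ)
    (hL : L.IsValid) (hreg : Regular D μ M L U) (k : Fin 2) (t : ℝ) :
    TendstoZeroInProb μ fun n ω => ∫⁻ ω', ‖√((2 * n : ℕ) : ℝ) *
      (D.devE μ (L.nuisance n k (U ω) (D.data ω) (D.obs 0 ω'))
          * D.devProp μ (L.nuisance n k (U ω) (D.data ω) (D.obs 0 ω'))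
        - t * D.devProp μ (L.nuisance n k (U ω) (D.data ω) (D.obs 0 ω')) ^ 2)‖ₑ ∂μ := by
  refine ((hreg.rate_product k).add ((hreg.rate_ehat k).const_mul (c := ‖t‖ₑ)
    enorm_ne_top)).mono fun n ω => ?_
  have hmE := measurable_devE_nuisance hD hL n k (U ω) (D.data ω)
  have hmd := measurable_devProp_nuisance hD hL n k (U ω) (D.data ω)
  have hmm : Measurable fun ω' =>
      ‖D.devE μ (L.nuisance n k (U ω) (D.data ω) (D.obs 0 ω'))‖ₑ
        * ‖D.devProp μ (L.nuisance n k (U ω) (D.data ω) (D.obs 0 ω'))‖ₑ :=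
    hmE.enorm.mul hmd.enorm
  have hs : ‖√((2 * n : ℕ) : ℝ)‖ₑ = ENNReal.ofReal √(2 * n : ℝ) := by
    rw [Real.enorm_eq_ofReal (Real.sqrt_nonneg _)]
    push_cast
    rfl
  calc _ ≤ ∫⁻ ω', ENNReal.ofReal √(2 * n : ℝ) *
        (‖D.devE μ (L.nuisance n k (U ω) (D.data ω) (D.obs 0 ω'))‖ₑ
          * ‖D.devProp μ (L.nuisance n k (U ω) (D.data ω) (D.obs 0 ω'))‖ₑ
        + ‖t‖ₑ * ‖D.devProp μ (L.nuisance n k (U ω) (D.data ω) (D.obs 0 ω'))‖ₑ ^ 2) ∂μ := by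
        refine lintegral_mono fun ω' => ?_
        rw [enorm_mul, hs]
        gcongr
        refine enorm_sub_le.trans ?_
        rw [enorm_mul, enorm_mul, enorm_pow]
    _ ≤ _ := by
        rw [lintegral_const_mul' _ _ ENNReal.ofReal_ne_top,
          lintegral_add_left hmm,
          lintegral_const_mul' _ _ enorm_ne_top, lintegral_devProp_sq hD hL, mul_add]
        refine add_le_add ?_ (le_of_eq (by ring))
        gcongr
        exact lintegral_devE_mul_devProp_le hD hL k n ω

lemma tendstoZeroInProb_treatRes_mul_devProp (hD : D.IsCausal μ)
    (hL : L.IsValid) (hreg : Regular D μ M L U) (k : Fin 2) :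
    TendstoZeroInProb μ fun n ω => ∫⁻ ω', ‖-(2 * D.treatRes μ (D.obs 0 ω')
      * D.devProp μ (L.nuisance n k (U ω) (D.data ω) (D.obs 0 ω')))
        + D.devProp μ (L.nuisance n k (U ω) (D.data ω) (D.obs 0 ω')) ^ 2‖ₑ ∂μ := by
  obtain ⟨B, hB⟩ := hL.ehat_bounded
  have h1 : TendstoZeroInProb μ (errProp D μ L U k) :=
    TendstoZeroInProb.of_pow (hreg.tendstoZeroInProb_errProp_sq k)
  refine (h1.const_mul (c := 2 + ENNReal.ofReal (B + 1))
    (ENNReal.add_ne_top.2 ⟨ENNReal.ofNat_ne_top, ENNReal.ofReal_ne_top⟩)).mono fun n ω => ?_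
  have hmd := measurable_devProp_nuisance hD hL n k (U ω) (D.data ω)
  have hL1 : ∫⁻ ω', ‖D.devProp μ (L.nuisance n k (U ω) (D.data ω) (D.obs 0 ω'))‖ₑ ∂μ
      ≤ errProp D μ L U k n ω := by
    refine (ENNReal.pow_right_strictMono two_ne_zero).le_iff_le.1 ?_
    rw [← lintegral_devProp_sq hD hL]
    have := sq_lintegral_mul_le hmd.enorm.aemeasurable (aemeasurable_const (b := (1 : ℝ≥0∞)))
      (ν := μ)
    simpa using this
  calc _ ≤ ∫⁻ ω', (2 + ENNReal.ofReal (B + 1)) *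
        ‖D.devProp μ (L.nuisance n k (U ω) (D.data ω) (D.obs 0 ω'))‖ₑ ∂μ := by
        refine lintegral_mono fun ω' => (enorm_add_le _ _).trans ?_
        rw [enorm_neg, enorm_mul, enorm_mul, enorm_pow, sq, add_mul]
        gcongr
        · calc _ ≤ ‖(2 : ℝ)‖ₑ * 1 := by gcongr; exact enorm_treatRes_le hD 0 ω'
            _ = 2 := by rw [mul_one, Real.enorm_eq_ofReal (by norm_num)]; simp
        · exact enorm_devProp_le hB _ _ _ _ _
    _ ≤ _ := by
        rw [lintegral_const_mul _ hmd.enorm]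
        gcongr

end NuisanceErrors

section Expansion

variable {Ω 𝒰 : Type*} [MeasurableSpace Ω] {p G : ℕ} {μ : Measure Ω}
  [IsProbabilityMeasure μ] {D : Study Ω p} {L : CrossFit 𝒰 p} {U : Ω → 𝒰} {M : Cov p → Fin G}

lemma score_eq (n : ℕ) (k : Fin 2) (u : 𝒰) (ω : Ω) (i : ℕ) (g : Fin G) :
    (L.resY n u (D.data ω) k i - L.resA n u (D.data ω) k i * D.tau μ M g)
        * L.resA n u (D.data ω) k i * groupInd M (D.X i ω) g
      = D.residual μ M (D.obs i ω) * D.treatRes μ (D.obs i ω) * groupInd M (D.X i ω) g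
        - D.residual μ M (D.obs i ω) * (D.devProp μ (L.nuisance n k u (D.data ω) (D.obs i ω))
          * groupInd M (D.X i ω) g)
        + D.treatRes μ (D.obs i ω) * ((-D.devE μ (L.nuisance n k u (D.data ω) (D.obs i ω))
          + D.tau μ M g * D.devProp μ (L.nuisance n k u (D.data ω) (D.obs i ω)))
          * groupInd M (D.X i ω) g)
        + (D.devE μ (L.nuisance n k u (D.data ω) (D.obs i ω))
            * D.devProp μ (L.nuisance n k u (D.data ω) (D.obs i ω))
          - D.tau μ M g * D.devProp μ (L.nuisance n k u (D.data ω) (D.obs i ω)) ^ 2)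
          * groupInd M (D.X i ω) g := by
  by_cases h : M (D.X i ω) = g
  · simp only [CrossFit.resY, CrossFit.resA, Study.residual, Study.treatRes, Study.devE,
      Study.devProp, CrossFit.nuisance, Study.data, Study.obs, h]
    ring
  · simp [groupInd, h]

lemma enorm_mul_sum_sub_le (a : ℝ) (s : Finset ℕ) (x b c d : ℕ → ℝ) :
    ‖a * (∑ i ∈ s, (x i - b i + c i + d i) - ∑ i ∈ s, x i)‖ₑ
      ≤ ‖a * ∑ i ∈ s, b i‖ₑ + ‖a * ∑ i ∈ s, c i‖ₑ + ‖a * ∑ i ∈ s, d i‖ₑ := by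
  have h : a * (∑ i ∈ s, (x i - b i + c i + d i) - ∑ i ∈ s, x i)
      = -(a * ∑ i ∈ s, b i) + a * ∑ i ∈ s, c i + a * ∑ i ∈ s, d i := by
    simp only [Finset.sum_add_distrib, Finset.sum_sub_distrib]
    ring
  rw [h]
  refine (enorm_add_le _ _).trans (add_le_add_left ((enorm_add_le _ _).trans ?_) _)
  rw [enorm_neg]

variable [MeasurableSpace 𝒰]

lemma Study.IsCausal.integral_treatRes_mul_of_integrable (hD : D.IsCausal μ) {f : Cov p → ℝ}
    (hf : Measurable f)
    (hint : Integrable (fun ω => D.treatRes μ (D.obs 0 ω) * f (D.X 0 ω)) μ) :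
    ∫ ω, D.treatRes μ (D.obs 0 ω) * f (D.X 0 ω) ∂μ = 0 := by
  have hX := hD.meas_X 0
  have hA : Integrable (D.A 0) μ := hD.memLp_A.integrable le_rfl
  have he : Integrable (fun ω => D.propensity μ (D.X 0 ω)) μ :=
    hD.memLp_propensity.integrable le_rfl
  have hem : StronglyMeasurable[MeasurableSpace.comap (D.X 0) inferInstance]
      (fun ω => D.propensity μ (D.X 0 ω)) :=
    (D.measurable_propensity.comp (comap_measurable (D.X 0))).stronglyMeasurable
  have hZ : Integrable (fun ω => D.treatRes μ (D.obs 0 ω)) μ :=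
    hD.memLp_treatRes.integrable le_rfl
  rw [integral_mul_comp_eq_condMean hX hf hZ hint]
  refine integral_eq_zero_of_ae ?_
  filter_upwards [condMean_comp_ae_eq_condExp hX hZ,
    condExp_sub hA he (MeasurableSpace.comap (D.X 0) inferInstance),
    hD.propensity_ae_eq_condExp] with ω h1 h2 h3
  rw [condExp_of_stronglyMeasurable hX.comap_le hem he, Pi.sub_apply, ← h3, sub_self] at h2
  rw [h1]
  change (μ[D.A 0 - fun ω => D.propensity μ (D.X 0 ω) | _]) ω * _ = 0
  rw [h2, zero_mul]

lemma tendstoZeroInProb_sum_residual_mul_devProp (hD : D.IsCausal μ) (hM : Measurable M)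
    (hL : L.IsValid) (hU : Measurable U) (hUD : IndepFun U D.data μ)
    (hreg : Regular D μ M L U) (k : Fin 2) (g : Fin G) :
    TendstoZeroInProb μ fun n ω => ‖(√((2 * n : ℕ) : ℝ))⁻¹ * ∑ i ∈ L.fold n (U ω) k,
      D.residual μ M (D.obs i ω) * (D.devProp μ (L.nuisance n k (U ω) (D.data ω) (D.obs i ω))
        * groupInd M (D.X i ω) g)‖ₑ := by
  have hIm := measurable_groupInd hM g
  have h2 : Measurable fun y : ℝ × ℝ × Obs p => y.2.2 := by fun_prop
  have h4 : Measurable fun y : ℝ × ℝ × Obs p => y.2.2.2.2 := by fun_prop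
  refine tendstoZeroInProb_centred_sum hD hL hU hUD k
    (H := fun y => D.residual μ M y.2.2 * (D.devProp μ y * groupInd M y.2.2.2.2 g))
    (((D.measurable_residual hM).comp h2).mul (D.measurable_devProp.mul (hIm.comp h4)))
    (fun n u d _ => ?_) ?_
  · obtain ⟨B, hB⟩ := hL.ehat_bounded
    have hfm : Measurable fun x =>
        (L.ehat n k u d x - D.propensity μ x) * groupInd M x g :=
      (((hL.meas_ehat n k).comp (by fun_prop : Measurable fun x : Cov p => (u, d, x))).sub
        D.measurable_propensity).mul hIm
    refine hD.integral_residual_mul hM hreg.moment_Y hfm ?_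
    refine MemLp.of_bound (hfm.comp (hD.meas_X 0)).aestronglyMeasurable (B + 1)
      (ae_of_all _ fun ω => ?_)
    have a1 := abs_devProp_le (D := D) (μ := μ) hB n k u d (D.obs 0 ω)
    have a2 := abs_groupInd_le M (D.X 0 ω) g
    rw [Real.norm_eq_abs, abs_mul]
    calc _ ≤ (B + 1) * 1 := mul_le_mul a1 a2 (abs_nonneg _) ((abs_nonneg _).trans a1)
      _ = _ := mul_one _
  · refine (tendstoZeroInProb_residual_mul_devProp hD hM hL hreg k).mono fun n ω => ?_
    refine lintegral_mono fun ω' => ?_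
    gcongr ?_ ^ 2
    rw [← mul_assoc, enorm_mul]
    exact mul_le_of_le_one_right zero_le (enorm_groupInd_le M _ g)

lemma tendstoZeroInProb_sum_treatRes_mul_devE (hD : D.IsCausal μ) (hM : Measurable M)
    (hL : L.IsValid) (hU : Measurable U) (hUD : IndepFun U D.data μ)
    (hreg : Regular D μ M L U) (k : Fin 2) (g : Fin G) (t : ℝ) :
    TendstoZeroInProb μ fun n ω => ‖(√((2 * n : ℕ) : ℝ))⁻¹ * ∑ i ∈ L.fold n (U ω) k,
      D.treatRes μ (D.obs i ω) * ((-D.devE μ (L.nuisance n k (U ω) (D.data ω) (D.obs i ω))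
        + t * D.devProp μ (L.nuisance n k (U ω) (D.data ω) (D.obs i ω)))
        * groupInd M (D.X i ω) g)‖ₑ := by
  have hIm := measurable_groupInd hM g
  have h2 : Measurable fun y : ℝ × ℝ × Obs p => y.2.2 := by fun_prop
  have h4 : Measurable fun y : ℝ × ℝ × Obs p => y.2.2.2.2 := by fun_prop
  have hH : Measurable fun y : ℝ × ℝ × Obs p => D.treatRes μ y.2.2 *
      ((-D.devE μ y + t * D.devProp μ y) * groupInd M y.2.2.2.2 g) :=
    (D.measurable_treatRes.comp h2).mul
      ((D.measurable_devE.neg.add (D.measurable_devProp.const_mul t)).mul (hIm.comp h4))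
  refine tendstoZeroInProb_centred_sum hD hL hU hUD k (H := fun y => D.treatRes μ y.2.2 *
      ((-D.devE μ y + t * D.devProp μ y) * groupInd M y.2.2.2.2 g)) hH (fun n u d hfin => ?_) ?_
  · have hx : Measurable fun x : Cov p => (u, d, x) := by fun_prop
    have hfm : Measurable fun x =>
        (-(L.Ehat n k u d x - D.outcomeReg μ x) + t * (L.ehat n k u d x - D.propensity μ x))
          * groupInd M x g :=
      ((((hL.meas_Ehat n k).comp hx).sub D.measurable_outcomeReg).neg.add
        ((((hL.meas_ehat n k).comp hx).sub D.measurable_propensity).const_mul t)).mul hIm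
    refine hD.integral_treatRes_mul_of_integrable hfm (MemLp.integrable one_le_two ⟨?_, ?_⟩)
    · exact (hH.comp (measurable_nuisance_obs hD hL n k u d)).aestronglyMeasurable
    · rw [eLpNorm_lt_top_iff_lintegral_rpow_enorm_lt_top two_ne_zero ENNReal.ofNat_ne_top]
      simp only [ENNReal.toReal_ofNat, ENNReal.rpow_ofNat]
      exact hfin.lt_top
  · refine (tendstoZeroInProb_devE_add hD hL hreg k t).mono fun n ω => ?_
    refine lintegral_mono fun ω' => ?_
    gcongr ?_ ^ 2
    rw [enorm_mul, enorm_mul]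
    exact (mul_le_of_le_one_left zero_le (enorm_treatRes_le hD 0 ω')).trans
      (mul_le_of_le_one_right zero_le (enorm_groupInd_le M _ g))

lemma enorm_inv_natCast_mul_sum_le (N : ℕ) (s : Finset ℕ) (f : ℕ → ℝ) :
    ‖(N : ℝ)⁻¹ * ∑ i ∈ s, f i‖ₑ ≤ (N : ℝ≥0∞)⁻¹ * ∑ i ∈ s, ‖f i‖ₑ := by
  rcases Nat.eq_zero_or_pos N with rfl | hN
  · simp
  rw [enorm_mul]
  gcongr
  · rw [Real.enorm_eq_ofReal (by positivity), ENNReal.ofReal_inv_of_pos (by exact_mod_cast hN),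
      ENNReal.ofReal_natCast]
  · exact enorm_sum_le _ _

lemma tendstoZeroInProb_sum_devE_mul_devProp (hD : D.IsCausal μ)
    (hL : L.IsValid) (hU : Measurable U) (hUD : IndepFun U D.data μ)
    (hreg : Regular D μ M L U) (k : Fin 2) (g : Fin G) (t : ℝ) :
    TendstoZeroInProb μ fun n ω => ‖(√((2 * n : ℕ) : ℝ))⁻¹ * ∑ i ∈ L.fold n (U ω) k,
      (D.devE μ (L.nuisance n k (U ω) (D.data ω) (D.obs i ω))
          * D.devProp μ (L.nuisance n k (U ω) (D.data ω) (D.obs i ω))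
        - t * D.devProp μ (L.nuisance n k (U ω) (D.data ω) (D.obs i ω)) ^ 2)
        * groupInd M (D.X i ω) g‖ₑ := by
  have h := tendstoZeroInProb_average hD hL hU hUD k
    (H := fun n y => ‖√((2 * n : ℕ) : ℝ) * (D.devE μ y * D.devProp μ y
      - t * D.devProp μ y ^ 2)‖ₑ)
    (fun n => (((D.measurable_devE.mul D.measurable_devProp).sub
      ((D.measurable_devProp.pow_const 2).const_mul t)).const_mul _).enorm)
    (tendstoZeroInProb_devE_mul_devProp hD hL hreg k t)
  refine h.mono fun n ω => ?_
  have hs : (√((2 * n : ℕ) : ℝ))⁻¹ = ((2 * n : ℕ) : ℝ)⁻¹ * √((2 * n : ℕ) : ℝ) := by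
    rcases Nat.eq_zero_or_pos n with rfl | hn
    · simp
    · have h0 : (0 : ℝ) < ((2 * n : ℕ) : ℝ) := by exact_mod_cast (by omega : 0 < 2 * n)
      have h1 := Real.sqrt_pos.2 h0
      field_simp
      rw [Real.sq_sqrt h0.le]
  rw [hs, mul_assoc, Finset.mul_sum]
  refine (enorm_inv_natCast_mul_sum_le _ _ _).trans ?_
  gcongr with i _
  rw [← mul_assoc, enorm_mul]
  exact mul_le_of_le_one_right zero_le (enorm_groupInd_le M _ g)

/-- The score with estimated nuisances is asymptotically equivalent to the oracle score. -/
lemma tendstoZeroInProb_score_sub_oracle (hD : D.IsCausal μ) (hM : Measurable M)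
    (hL : L.IsValid) (hU : Measurable U) (hUD : IndepFun U D.data μ)
    (hreg : Regular D μ M L U) (g : Fin G) :
    TendstoZeroInProb μ fun n ω => ‖(√((2 * n : ℕ) : ℝ))⁻¹ * (∑ k, ∑ i ∈ L.fold n (U ω) k,
      (L.resY n (U ω) (D.data ω) k i - L.resA n (U ω) (D.data ω) k i * D.tau μ M g)
        * L.resA n (U ω) (D.data ω) k i * groupInd M (D.X i ω) g)
      - (√((2 * n : ℕ) : ℝ))⁻¹ * ∑ i ∈ Finset.range (2 * n),
        D.residual μ M (D.obs i ω) * D.treatRes μ (D.obs i ω) * groupInd M (D.X i ω) g‖ₑ := by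
  have h : ∀ k : Fin 2, _ := fun k =>
    ((tendstoZeroInProb_sum_residual_mul_devProp hD hM hL hU hUD hreg k g).add
      (tendstoZeroInProb_sum_treatRes_mul_devE hD hM hL hU hUD hreg k g (D.tau μ M g))).add
      (tendstoZeroInProb_sum_devE_mul_devProp hD hL hU hUD hreg k g (D.tau μ M g))
  refine ((h 0).add (h 1)).mono fun n ω => ?_
  rw [← hL.sum_fold n (U ω) fun _ i =>
      D.residual μ M (D.obs i ω) * D.treatRes μ (D.obs i ω) * groupInd M (D.X i ω) g,
    ← mul_sub, ← Finset.sum_sub_distrib, Fin.sum_univ_two, mul_add]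
  refine (enorm_add_le _ _).trans ?_
  gcongr ?_ + ?_ <;>
  · simp_rw [score_eq]
    exact enorm_mul_sum_sub_le _ _ _ _ _ _

end Expansion

lemma tendstoZeroInProb_sub_of_eq_off {Ω E : Type*} [MeasurableSpace Ω] {μ : Measure Ω}
    [NormedAddCommGroup E] {f g : ℕ → Ω → E} {s : ℕ → Set Ω}
    (hs : Tendsto (fun n => μ (s n)) atTop (𝓝 0))
    (h : ∀ n, 0 < n → ∀ ω, ω ∉ s n → f n ω = g n ω) :
    TendstoZeroInProb μ fun n ω => ‖f n ω - g n ω‖ₑ := fun η hη =>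
  tendsto_of_tendsto_of_tendsto_of_le_of_le' tendsto_const_nhds hs
    (Eventually.of_forall fun _ => zero_le) <| (eventually_gt_atTop 0).mono fun n hn =>
      measure_mono fun ω (hω : η ≤ ‖f n ω - g n ω‖ₑ) => by
        by_contra hcon
        simp only [h n hn ω hcon, sub_self, enorm_zero] at hω
        exact hη.not_ge hω

namespace CrossFit

variable {𝒰 : Type*} {p G : ℕ} {L : CrossFit 𝒰 p}

/-- The diagonal entry `∑ₖ ∑_{i ∈ I_k} (A_i - ê_k)² I{M(X_i) = g}` of the Gram matrix. -/
noncomputable def gram (L : CrossFit 𝒰 p) (M : Cov p → Fin G) (n : ℕ) (u : 𝒰) (d : ℕ → Obs p)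
    (g : Fin G) : ℝ :=
  ∑ k, ∑ i ∈ L.fold n u k, L.resA n u d k i ^ 2 * groupInd M (d i).2.2 g

/-- `∑ₖ ∑_{i ∈ I_k} (Y_i - Ê_k)(A_i - ê_k) I{M(X_i) = g}`. -/
noncomputable def crossMoment (L : CrossFit 𝒰 p) (M : Cov p → Fin G) (n : ℕ) (u : 𝒰)
    (d : ℕ → Obs p) (g : Fin G) : ℝ :=
  ∑ k, ∑ i ∈ L.fold n u k, L.resY n u d k i * L.resA n u d k i * groupInd M (d i).2.2 g

/-- The estimating function
`∑ₖ ∑_{i ∈ I_k} {Y_i - Ê_k - (A_i - ê_k) t}(A_i - ê_k) I{M(X_i) = g}`. -/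
noncomputable def score (L : CrossFit 𝒰 p) (M : Cov p → Fin G) (n : ℕ) (u : 𝒰)
    (d : ℕ → Obs p) (t : ℝ) (g : Fin G) : ℝ :=
  ∑ k, ∑ i ∈ L.fold n u k,
    (L.resY n u d k i - L.resA n u d k i * t) * L.resA n u d k i * groupInd M (d i).2.2 g

lemma score_eq_crossMoment_sub (M : Cov p → Fin G) (n : ℕ) (u : 𝒰)
    (d : ℕ → Obs p) (t : ℝ) (g : Fin G) :
    L.score M n u d t g = L.crossMoment M n u d g - L.gram M n u d g * t := by
  simp only [score, crossMoment, gram, Finset.sum_mul, ← Finset.sum_sub_distrib]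
  refine Finset.sum_congr rfl fun k _ => Finset.sum_congr rfl fun i _ => ?_
  ring

lemma gram_matrix_eq_diagonal (M : Cov p → Fin G) (n : ℕ) (u : 𝒰) (d : ℕ → Obs p) :
    ∑ k, ∑ i ∈ L.fold n u k, L.resA n u d k i ^ 2 •
      Matrix.vecMulVec (groupInd M (d i).2.2) (groupInd M (d i).2.2)
      = Matrix.diagonal (L.gram M n u d) := by
  ext g h
  simp only [Matrix.sum_apply, Matrix.smul_apply, Matrix.vecMulVec_apply, smul_eq_mul,
    Matrix.diagonal_apply]
  split_ifs with hgh
  · subst hgh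
    simp only [groupInd_mul_self, gram]
  · refine Finset.sum_eq_zero fun k _ => Finset.sum_eq_zero fun i _ => ?_
    by_cases h1 : M (d i).2.2 = g
    · simp [groupInd, h1, hgh]
    · simp [groupInd, h1]

open Classical in
lemma tauHat_apply (M : Cov p → Fin G) (n : ℕ) (u : 𝒰) (d : ℕ → Obs p) (g : Fin G) :
    L.tauHat M n u d g = if ∀ h, L.gram M n u d h ≠ 0
      then L.crossMoment M n u d g / L.gram M n u d g else 0 := by
  have hcross : (∑ k, ∑ i ∈ L.fold n u k,
      (L.resY n u d k i * L.resA n u d k i) • groupInd M (d i).2.2) = L.crossMoment M n u d := by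
    ext g
    simp [crossMoment, Finset.sum_apply]
  rw [tauHat, gram_matrix_eq_diagonal, hcross, Matrix.inv_diagonal, Matrix.mulVec_diagonal]
  split_ifs with h
  · have hu : IsUnit (L.gram M n u d) := Pi.isUnit_iff.2 fun g => (h g).isUnit
    have hinv : Ring.inverse (L.gram M n u d) g = (L.gram M n u d g)⁻¹ := by
      refine eq_inv_of_mul_eq_one_left ?_
      have := congrFun (Ring.inverse_mul_cancel _ hu) g
      exact this
    rw [hinv, div_eq_inv_mul]
  · rw [Ring.inverse_non_unit _ fun hu => h fun g => (Pi.isUnit_iff.1 hu g).ne_zero]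
    simp

lemma tauHat_sub_eq {M : Cov p → Fin G} {n : ℕ} {u : 𝒰} {d : ℕ → Obs p}
    (h : ∀ h, L.gram M n u d h ≠ 0) (t : ℝ) (g : Fin G) :
    L.tauHat M n u d g - t = L.score M n u d t g / L.gram M n u d g := by
  rw [tauHat_apply, if_pos h, score_eq_crossMoment_sub, sub_div, mul_div_cancel_left₀ _ (h g)]

section Measurability

variable [MeasurableSpace 𝒰] {M : Cov p → Fin G}

lemma IsValid.measurable_sum_fold (hL : L.IsValid) (n : ℕ) {F : Fin 2 → ℕ → 𝒰 × (ℕ → Obs p) → ℝ}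
    (hF : ∀ k i, Measurable (F k i)) :
    Measurable fun y : 𝒰 × (ℕ → Obs p) => ∑ k, ∑ i ∈ L.fold n y.1 k, F k i y := by
  refine Finset.measurable_sum _ fun k _ => ?_
  simp only [sum_eq_sum_range_ite (hL.fold_subset n _ k)]
  exact Finset.measurable_sum _ fun i _ => Measurable.ite
    ((hL.measurableSet_mem_fold n k i).preimage measurable_fst) (hF k i) measurable_const

lemma IsValid.measurable_resA (hL : L.IsValid) (n : ℕ) (k : Fin 2) (i : ℕ) :
    Measurable fun y : 𝒰 × (ℕ → Obs p) => L.resA n y.1 y.2 k i :=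
  (by fun_prop : Measurable fun y : 𝒰 × (ℕ → Obs p) => (y.2 i).2.1).sub
    ((hL.meas_ehat n k).comp
      (by fun_prop : Measurable fun y : 𝒰 × (ℕ → Obs p) => (y.1, y.2, (y.2 i).2.2)))

lemma IsValid.measurable_resY (hL : L.IsValid) (n : ℕ) (k : Fin 2) (i : ℕ) :
    Measurable fun y : 𝒰 × (ℕ → Obs p) => L.resY n y.1 y.2 k i :=
  (by fun_prop : Measurable fun y : 𝒰 × (ℕ → Obs p) => (y.2 i).1).sub
    ((hL.meas_Ehat n k).comp
      (by fun_prop : Measurable fun y : 𝒰 × (ℕ → Obs p) => (y.1, y.2, (y.2 i).2.2)))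

lemma measurable_groupInd_data (hM : Measurable M) (g : Fin G) (i : ℕ) :
    Measurable fun y : 𝒰 × (ℕ → Obs p) => groupInd M (y.2 i).2.2 g :=
  (measurable_groupInd hM g).comp (by fun_prop)

lemma IsValid.measurable_gram (hL : L.IsValid) (hM : Measurable M) (n : ℕ) (g : Fin G) :
    Measurable fun y : 𝒰 × (ℕ → Obs p) => L.gram M n y.1 y.2 g :=
  hL.measurable_sum_fold n fun k i =>
    ((hL.measurable_resA n k i).pow_const 2).mul (measurable_groupInd_data hM g i)

lemma IsValid.measurable_crossMoment (hL : L.IsValid) (hM : Measurable M) (n : ℕ) (g : Fin G) :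
    Measurable fun y : 𝒰 × (ℕ → Obs p) => L.crossMoment M n y.1 y.2 g :=
  hL.measurable_sum_fold n fun k i =>
    ((hL.measurable_resY n k i).mul (hL.measurable_resA n k i)).mul
      (measurable_groupInd_data hM g i)

lemma IsValid.measurable_score (hL : L.IsValid) (hM : Measurable M) (n : ℕ) (t : ℝ) (g : Fin G) :
    Measurable fun y : 𝒰 × (ℕ → Obs p) => L.score M n y.1 y.2 t g := by
  simp only [score_eq_crossMoment_sub]
  exact (hL.measurable_crossMoment hM n g).sub ((hL.measurable_gram hM n g).mul_const t)

open Classical in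
lemma IsValid.measurable_tauHat (hL : L.IsValid) (hM : Measurable M) (n : ℕ) :
    Measurable fun y : 𝒰 × (ℕ → Obs p) => L.tauHat M n y.1 y.2 := by
  refine measurable_pi_lambda _ fun g => ?_
  simp only [tauHat_apply]
  refine Measurable.ite ?_ ((hL.measurable_crossMoment hM n g).div (hL.measurable_gram hM n g))
    measurable_const
  rw [Set.ofPred_forall]
  exact MeasurableSet.iInter fun h =>
    (measurableSet_eq_fun (hL.measurable_gram hM n h) measurable_const).compl

lemma IsValid.measurable_scaledError (hL : L.IsValid) (hM : Measurable M) (t : Fin G → ℝ) (n : ℕ) :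
    Measurable fun y : 𝒰 × (ℕ → Obs p) => L.scaledError M t n y.1 y.2 :=
  (WithLp.measurable_toLp 2 _).comp
    (((hL.measurable_tauHat hM n).sub_const t).const_smul (Real.sqrt (2 * n : ℝ)))

end Measurability

end CrossFit

section Consistency

variable {Ω 𝒰 : Type*} [MeasurableSpace Ω] {p G : ℕ} {μ : Measure Ω}
  [IsProbabilityMeasure μ] {D : Study Ω p} {L : CrossFit 𝒰 p} {U : Ω → 𝒰} {M : Cov p → Fin G}

lemma Study.IsCausal.measurable_data (hD : D.IsCausal μ) : Measurable D.data :=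
  measurable_pi_lambda _ fun i => hD.measurable_obs i

lemma Regular.group_prob_pos (hreg : Regular D μ M L U) (g : Fin G) :
    0 < μ.real {ω | M (D.X 0 ω) = g} := by
  obtain ⟨c, hc, h⟩ := hreg.group_pos
  exact hc.trans_le (h g)

variable [MeasurableSpace 𝒰]

lemma tendstoInMeasure_gram (hD : D.IsCausal μ) (hM : Measurable M)
    (hL : L.IsValid) (hU : Measurable U) (hUD : IndepFun U D.data μ)
    (hreg : Regular D μ M L U) (g : Fin G) :
    TendstoInMeasure μ (fun n ω => ((2 * n : ℕ) : ℝ)⁻¹ * L.gram M n (U ω) (D.data ω) g) atTop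
      (fun _ => D.denom μ M g) := by
  have hf : Measurable fun z : Obs p => D.treatRes μ z ^ 2 * groupInd M z.2.2 g :=
    (D.measurable_treatRes.pow_const 2).mul ((measurable_groupInd hM g).comp (by fun_prop))
  have hint : Integrable (fun ω => D.treatRes μ (D.obs 0 ω) ^ 2
      * groupInd M (D.obs 0 ω).2.2 g) μ := by
    refine Integrable.of_bound (hf.comp (hD.measurable_obs 0)).aestronglyMeasurable 1
      (ae_of_all _ fun ω => ?_)
    rw [norm_mul, norm_pow]
    exact mul_le_one₀ (pow_le_one₀ (norm_nonneg _) (hD.abs_treatRes_le 0 ω)) (norm_nonneg _)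
      (abs_groupInd_le M _ g)
  have hlln := tendstoInMeasure_average_two_mul hD.measurable_obs hD.indep hD.identDistrib hf hint
  have hden : ∫ ω, D.treatRes μ (D.obs 0 ω) ^ 2 * groupInd M (D.obs 0 ω).2.2 g ∂μ
      = D.denom μ M g := rfl
  rw [hden] at hlln
  refine tendstoInMeasure_of_sub hlln ?_
  have h : ∀ k : Fin 2, TendstoZeroInProb μ fun n ω => ((2 * n : ℕ) : ℝ≥0∞)⁻¹ *
      ∑ i ∈ L.fold n (U ω) k, ‖-(2 * D.treatRes μ (D.obs i ω)
        * D.devProp μ (L.nuisance n k (U ω) (D.data ω) (D.obs i ω)))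
        + D.devProp μ (L.nuisance n k (U ω) (D.data ω) (D.obs i ω)) ^ 2‖ₑ :=
    fun k => tendstoZeroInProb_average hD hL hU hUD k
    (H := fun _ y => ‖-(2 * D.treatRes μ y.2.2 * D.devProp μ y) + D.devProp μ y ^ 2‖ₑ)
    (fun _ => ((((D.measurable_treatRes.comp (by fun_prop)).const_mul 2).mul
      D.measurable_devProp).neg.add (D.measurable_devProp.pow_const 2)).enorm)
    (tendstoZeroInProb_treatRes_mul_devProp hD hL hreg k)
  refine ((h 0).add (h 1)).mono fun n ω => ?_
  rw [← hL.sum_fold n (U ω) fun _ i => D.treatRes μ (D.obs i ω) ^ 2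
      * groupInd M (D.obs i ω).2.2 g, CrossFit.gram,
    ← mul_sub, ← Finset.sum_sub_distrib, Fin.sum_univ_two, mul_add]
  refine (enorm_add_le _ _).trans ?_
  gcongr ?_ + ?_ <;>
  · rw [← Finset.sum_sub_distrib]
    refine (enorm_inv_natCast_mul_sum_le _ _ _).trans ?_
    gcongr with i _
    refine le_trans (le_of_eq ?_) (mul_le_of_le_one_right zero_le
      (enorm_groupInd_le M (D.X i ω) g))
    rw [← enorm_mul]
    congr 1
    simp only [CrossFit.resA, Study.treatRes, Study.devProp, CrossFit.nuisance, Study.data,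
      Study.obs]
    ring

/-- The estimated Gram matrix is invertible with probability tending to one. -/
lemma tendsto_measure_gram_eq_zero (hD : D.IsCausal μ) (hM : Measurable M)
    (hL : L.IsValid) (hU : Measurable U) (hUD : IndepFun U D.data μ)
    (hreg : Regular D μ M L U) :
    Tendsto (fun n => μ {ω | ∃ g, L.gram M n (U ω) (D.data ω) g = 0}) atTop (𝓝 0) := by
  have h : Tendsto (fun n => ∑ g, μ {ω | ENNReal.ofReal (D.denom μ M g) ≤
      edist (((2 * n : ℕ) : ℝ)⁻¹ * L.gram M n (U ω) (D.data ω) g) (D.denom μ M g)})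
      atTop (𝓝 0) := by
    simpa using tendsto_finsetSum Finset.univ fun g _ =>
      tendstoInMeasure_gram hD hM hL hU hUD hreg g _
        (ENNReal.ofReal_pos.2 (hD.denom_pos hM g (hreg.group_prob_pos g)))
  refine tendsto_of_tendsto_of_tendsto_of_le_of_le tendsto_const_nhds h (fun _ => zero_le)
    fun n => (measure_mono ?_).trans (measure_iUnion_fintype_le _ _)
  rintro ω ⟨g, hg⟩
  refine Set.mem_iUnion.2 ⟨g, ?_⟩
  rw [Set.mem_ofPred_eq, hg, mul_zero, edist_comm, edist_dist, Real.dist_eq, sub_zero]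
  exact ENNReal.ofReal_le_ofReal (le_abs_self _)

lemma memLp_oracleScore (hD : D.IsCausal μ) (hM : Measurable M) (hY : MemLp (D.Y 0) 4 μ)
    (g : Fin G) : MemLp (fun ω => D.residual μ M (D.obs 0 ω) * D.treatRes μ (D.obs 0 ω)
      * groupInd M (D.X 0 ω) g) 4 μ :=
  (hD.memLp_groupInd hM g (q := ∞)).mul' (r := 4)
    ((hD.memLp_treatRes (q := ∞)).mul' (hD.memLp_residual hM hY) (r := 4))

lemma measurable_oracleScore (D : Study Ω p) (hM : Measurable M) (g : Fin G) :
    Measurable fun z : Obs p => D.residual μ M z * D.treatRes μ z * groupInd M z.2.2 g :=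
  ((D.measurable_residual hM).mul D.measurable_treatRes).mul
    ((measurable_groupInd hM g).comp (by fun_prop))

lemma tendstoInMeasure_score (hD : D.IsCausal μ) (hM : Measurable M)
    (hL : L.IsValid) (hU : Measurable U) (hUD : IndepFun U D.data μ)
    (hreg : Regular D μ M L U) (g : Fin G)
    (he : ∃ eg : ℝ, ∀ᵐ x ∂(D.lawX μ), M x = g → D.propensity μ x = eg) :
    TendstoInMeasure μ (fun n ω => ((2 * n : ℕ) : ℝ)⁻¹ *
      L.score M n (U ω) (D.data ω) (D.tau μ M g) g) atTop (fun _ => 0) := by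
  have hlln := tendstoInMeasure_average_two_mul hD.measurable_obs hD.indep hD.identDistrib
    (measurable_oracleScore (μ := μ) D hM g)
    ((memLp_oracleScore hD hM hreg.moment_Y g).integrable (by norm_num))
  have h0 := hD.integral_residual_mul_treatRes hM hreg.moment_Y g
    (hreg.group_prob_pos g).ne' he
  have h0' : ∫ ω, D.residual μ M (D.obs 0 ω) * D.treatRes μ (D.obs 0 ω)
      * groupInd M (D.obs 0 ω).2.2 g ∂μ = 0 := h0
  rw [h0'] at hlln
  refine tendstoInMeasure_of_sub hlln
    ((tendstoZeroInProb_score_sub_oracle hD hM hL hU hUD hreg g).mono fun n ω => ?_)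
  rw [← mul_sub, ← mul_sub, enorm_mul, enorm_mul]
  refine mul_le_mul ?_ le_rfl zero_le zero_le
  rw [Real.enorm_eq_ofReal (by positivity), Real.enorm_eq_ofReal (by positivity)]
  refine ENNReal.ofReal_le_ofReal ?_
  rcases Nat.eq_zero_or_pos n with rfl | hn
  · simp
  · have h1 : (1 : ℝ) ≤ ((2 * n : ℕ) : ℝ) := by exact_mod_cast (by omega : 1 ≤ 2 * n)
    refine inv_anti₀ (Real.sqrt_pos.2 (by linarith)) (Real.sqrt_le_self_iff.2 (Or.inr h1))

/-- Consistency of the estimator. -/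
lemma tendstoInMeasure_tauHat_sub (hD : D.IsCausal μ) (hM : Measurable M)
    (hL : L.IsValid) (hU : Measurable U) (hUD : IndepFun U D.data μ)
    (hreg : Regular D μ M L U) (g : Fin G)
    (he : ∃ eg : ℝ, ∀ᵐ x ∂(D.lawX μ), M x = g → D.propensity μ x = eg) :
    TendstoInMeasure μ (fun n ω => L.tauHat M n (U ω) (D.data ω) g - D.tau μ M g) atTop
      (fun _ => 0) := by
  have hd := hD.denom_pos hM g (hreg.group_prob_pos g)
  have h := TendstoInMeasure.continuousAt_comp (g := fun y : ℝ × ℝ => y.1 / y.2)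
    (c := (0, D.denom μ M g)) (continuousAt_fst.div continuousAt_snd hd.ne')
    (TendstoInMeasure.prodMk (tendstoInMeasure_score hD hM hL hU hUD hreg g he)
      (tendstoInMeasure_gram hD hM hL hU hUD hreg g))
  rw [zero_div] at h
  refine tendstoInMeasure_of_sub h (tendstoZeroInProb_sub_of_eq_off
    (tendsto_measure_gram_eq_zero hD hM hL hU hUD hreg) fun n hn ω hω => ?_)
  have hω' : ∀ g, L.gram M n (U ω) (D.data ω) g ≠ 0 := fun g hg => hω ⟨g, hg⟩
  have hn' : ((2 * n : ℕ) : ℝ) ≠ 0 := by exact_mod_cast (by omega : 2 * n ≠ 0)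
  rw [CrossFit.tauHat_sub_eq hω', mul_div_mul_left _ _ (inv_ne_zero hn')]

end Consistency

section Variance

lemma abs_mul_sum_sq_sub_le (s : Finset ℕ) (a b : ℕ → ℝ) {c : ℝ} (hc : 0 ≤ c) :
    |c * ∑ i ∈ s, a i ^ 2 - c * ∑ i ∈ s, b i ^ 2| ≤ c * ∑ i ∈ s, (a i - b i) ^ 2
      + 2 * √((c * ∑ i ∈ s, b i ^ 2) * (c * ∑ i ∈ s, (a i - b i) ^ 2)) := by
  have h1 : c * ∑ i ∈ s, a i ^ 2 - c * ∑ i ∈ s, b i ^ 2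
      = c * ∑ i ∈ s, (a i - b i) ^ 2 + 2 * (c * ∑ i ∈ s, b i * (a i - b i)) := by
    have : ∀ i, a i ^ 2 = b i ^ 2 + (a i - b i) ^ 2 + 2 * (b i * (a i - b i)) := fun i => by ring
    simp only [this, Finset.sum_add_distrib, ← Finset.mul_sum]
    ring
  have h2 : |c * ∑ i ∈ s, b i * (a i - b i)|
      ≤ √((c * ∑ i ∈ s, b i ^ 2) * (c * ∑ i ∈ s, (a i - b i) ^ 2)) := by
    refine Real.abs_le_sqrt ?_
    rw [mul_pow, sq c, mul_mul_mul_comm]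
    exact mul_le_mul_of_nonneg_left (Finset.sum_mul_sq_le_sq_mul_sq _ _ _) (mul_nonneg hc hc)
  have h3 : 0 ≤ c * ∑ i ∈ s, (a i - b i) ^ 2 :=
    mul_nonneg hc (Finset.sum_nonneg fun i _ => sq_nonneg _)
  rw [h1]
  refine (abs_add_le _ _).trans ?_
  rw [abs_of_nonneg h3, abs_mul, abs_two]
  linarith

variable {Ω 𝒰 : Type*} [MeasurableSpace Ω] {p G : ℕ} {μ : Measure Ω}
  [IsProbabilityMeasure μ] {D : Study Ω p} {L : CrossFit 𝒰 p} {U : Ω → 𝒰} {M : Cov p → Fin G}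

lemma epsHat_mul_resA_sub (n : ℕ) (k : Fin 2) (u : 𝒰) (ω : Ω) (i : ℕ) (g : Fin G) :
    L.epsHat M n u (D.data ω) k i * L.resA n u (D.data ω) k i * groupInd M (D.X i ω) g
        - D.residual μ M (D.obs i ω) * D.treatRes μ (D.obs i ω) * groupInd M (D.X i ω) g
      = (-(D.residual μ M (D.obs i ω) * D.devProp μ (L.nuisance n k u (D.data ω) (D.obs i ω)))
          + (-D.devE μ (L.nuisance n k u (D.data ω) (D.obs i ω))
            + D.tau μ M g * D.devProp μ (L.nuisance n k u (D.data ω) (D.obs i ω)))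
            * L.resA n u (D.data ω) k i
          + -(L.resA n u (D.data ω) k i ^ 2 * (L.tauHat M n u (D.data ω) g - D.tau μ M g)))
        * groupInd M (D.X i ω) g := by
  by_cases h : M (D.X i ω) = g
  · have hs : ∑ g', groupInd M (D.X i ω) g' * L.tauHat M n u (D.data ω) g'
        = L.tauHat M n u (D.data ω) g := by
      simp only [mul_comm (groupInd M _ _), sum_mul_groupInd, h]
    have hs' : L.epsHat M n u (D.data ω) k i = L.resY n u (D.data ω) k i
        - L.resA n u (D.data ω) k i * L.tauHat M n u (D.data ω) g := by
      rw [← hs]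
      rfl
    simp only [hs', CrossFit.resY, CrossFit.resA, Study.residual, Study.treatRes, Study.devE,
      Study.devProp, CrossFit.nuisance, Study.data, Study.obs, h]
    ring
  · simp [groupInd, h]

lemma enorm_add_add_sq_le (a b c : ℝ) :
    ‖a + b + c‖ₑ ^ 2 ≤ 4 * (‖a‖ₑ ^ 2 + ‖b‖ₑ ^ 2 + ‖c‖ₑ ^ 2) := by
  calc _ ≤ 2 * (‖a + b‖ₑ ^ 2 + ‖c‖ₑ ^ 2) := enorm_add_sq_le _ _
    _ ≤ 2 * (2 * (‖a‖ₑ ^ 2 + ‖b‖ₑ ^ 2) + 2 * ‖c‖ₑ ^ 2) := by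
        gcongr
        · exact enorm_add_sq_le _ _
        · exact le_mul_of_one_le_left zero_le one_le_two
    _ = _ := by ring

lemma enorm_resA_le (hD : D.IsCausal μ) {B : ℝ} (hB : ∀ n k u d x, |L.ehat n k u d x| ≤ B)
    (n : ℕ) (k : Fin 2) (u : 𝒰) (ω : Ω) (i : ℕ) :
    ‖L.resA n u (D.data ω) k i‖ₑ ≤ ENNReal.ofReal (1 + B) := by
  rw [Real.enorm_eq_ofReal_abs]
  refine ENNReal.ofReal_le_ofReal ((abs_sub _ _).trans (add_le_add ?_ (hB _ _ _ _ _)))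
  change |D.A i ω| ≤ 1
  rcases hD.binary i ω with h | h <;> simp [h]

variable [MeasurableSpace 𝒰]

lemma tendstoZeroInProb_average_epsHat_sub (hD : D.IsCausal μ) (hM : Measurable M)
    (hL : L.IsValid) (hU : Measurable U) (hUD : IndepFun U D.data μ)
    (hreg : Regular D μ M L U) (g : Fin G)
    (he : ∃ eg : ℝ, ∀ᵐ x ∂(D.lawX μ), M x = g → D.propensity μ x = eg) (k : Fin 2) :
    TendstoZeroInProb μ fun n ω => ((2 * n : ℕ) : ℝ≥0∞)⁻¹ * ∑ i ∈ L.fold n (U ω) k,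
      ‖L.epsHat M n (U ω) (D.data ω) k i * L.resA n (U ω) (D.data ω) k i
          * groupInd M (D.X i ω) g
        - D.residual μ M (D.obs i ω) * D.treatRes μ (D.obs i ω)
          * groupInd M (D.X i ω) g‖ₑ ^ 2 := by
  obtain ⟨B, hB⟩ := hL.ehat_bounded
  set K : ℝ≥0∞ := ENNReal.ofReal (1 + B) with hK
  have hKt : K ≠ ∞ := ENNReal.ofReal_ne_top
  have h1 : TendstoZeroInProb μ fun n ω => ((2 * n : ℕ) : ℝ≥0∞)⁻¹ * ∑ i ∈ L.fold n (U ω) k,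
      ‖D.residual μ M (D.obs i ω)
        * D.devProp μ (L.nuisance n k (U ω) (D.data ω) (D.obs i ω))‖ₑ ^ 2 :=
    tendstoZeroInProb_average hD hL hU hUD k
      (H := fun _ y => ‖D.residual μ M y.2.2 * D.devProp μ y‖ₑ ^ 2)
      (fun _ => (((D.measurable_residual hM).comp (by fun_prop)).mul
        D.measurable_devProp).enorm.pow_const 2)
      (tendstoZeroInProb_residual_mul_devProp hD hM hL hreg k)
  have h2 : TendstoZeroInProb μ fun n ω => ((2 * n : ℕ) : ℝ≥0∞)⁻¹ * ∑ i ∈ L.fold n (U ω) k,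
      ‖-D.devE μ (L.nuisance n k (U ω) (D.data ω) (D.obs i ω)) + D.tau μ M g
        * D.devProp μ (L.nuisance n k (U ω) (D.data ω) (D.obs i ω))‖ₑ ^ 2 :=
    tendstoZeroInProb_average hD hL hU hUD k
      (H := fun _ y => ‖-D.devE μ y + D.tau μ M g * D.devProp μ y‖ₑ ^ 2)
      (fun _ => (D.measurable_devE.neg.add
        (D.measurable_devProp.const_mul _)).enorm.pow_const 2)
      (tendstoZeroInProb_devE_add hD hL hreg k _)
  have h3 := (tendstoInMeasure_zero_iff.1
    (tendstoInMeasure_tauHat_sub hD hM hL hU hUD hreg g he)).pow two_ne_zero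
  refine (((h1.add (h2.const_mul (ENNReal.pow_ne_top hKt (n := 2)))).add
    (h3.const_mul (ENNReal.pow_ne_top hKt (n := 4)))).const_mul
      (c := 4) ENNReal.ofNat_ne_top).mono fun n ω => ?_
  calc _ ≤ ((2 * n : ℕ) : ℝ≥0∞)⁻¹ * ∑ i ∈ L.fold n (U ω) k, 4 * (‖D.residual μ M (D.obs i ω)
        * D.devProp μ (L.nuisance n k (U ω) (D.data ω) (D.obs i ω))‖ₑ ^ 2
        + K ^ 2 * ‖-D.devE μ (L.nuisance n k (U ω) (D.data ω) (D.obs i ω)) + D.tau μ M g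
          * D.devProp μ (L.nuisance n k (U ω) (D.data ω) (D.obs i ω))‖ₑ ^ 2
        + K ^ 4 * ‖L.tauHat M n (U ω) (D.data ω) g - D.tau μ M g‖ₑ ^ 2) := by
        gcongr with i _
        rw [epsHat_mul_resA_sub, enorm_mul]
        have hI := enorm_groupInd_le M (D.X i ω) g
        have hA := enorm_resA_le hD hB n k (U ω) ω i
        refine (pow_le_pow_left₀ zero_le (mul_le_of_le_one_right zero_le hI) 2).trans
          ((enorm_add_add_sq_le _ _ _).trans ?_)
        rw [enorm_neg, enorm_neg, enorm_mul _ (L.resA n (U ω) (D.data ω) k i),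
          enorm_mul (L.resA n (U ω) (D.data ω) k i ^ 2), mul_pow, mul_pow, enorm_pow, ← pow_mul,
          mul_comm (K ^ 2)]
        gcongr
    _ ≤ _ := by
        rw [← Finset.mul_sum, mul_left_comm]
        gcongr
        rw [Finset.sum_add_distrib, Finset.sum_add_distrib, ← Finset.mul_sum, Finset.sum_const,
          mul_add, mul_add, mul_left_comm _ (K ^ 2)]
        refine add_le_add le_rfl ?_
        rw [nsmul_eq_mul, ← mul_assoc]
        refine mul_le_of_le_one_left zero_le ?_
        have hcard : (L.fold n (U ω) k).card ≤ 2 * n := by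
          simpa using Finset.card_le_card (hL.fold_subset n (U ω) k)
        calc _ ≤ ((2 * n : ℕ) : ℝ≥0∞)⁻¹ * ((2 * n : ℕ) : ℝ≥0∞) := by
              gcongr
          _ ≤ 1 := ENNReal.inv_mul_le_one _

/-- The numerator of the variance estimator. -/
lemma tendstoInMeasure_average_epsHat_sq (hD : D.IsCausal μ) (hM : Measurable M)
    (hL : L.IsValid) (hU : Measurable U) (hUD : IndepFun U D.data μ)
    (hreg : Regular D μ M L U) (g : Fin G)
    (he : ∃ eg : ℝ, ∀ᵐ x ∂(D.lawX μ), M x = g → D.propensity μ x = eg) :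
    TendstoInMeasure μ (fun n ω => ((2 * n : ℕ) : ℝ)⁻¹ * ∑ k, ∑ i ∈ L.fold n (U ω) k,
      (L.epsHat M n (U ω) (D.data ω) k i * L.resA n (U ω) (D.data ω) k i
        * groupInd M (D.X i ω) g) ^ 2) atTop
      (fun _ => D.SigmaDiag' μ M g * D.denom μ M g ^ 2) := by
  have hO := memLp_oracleScore hD hM hreg.moment_Y g
  have hlln := tendstoInMeasure_average_two_mul hD.measurable_obs hD.indep hD.identDistrib
    ((measurable_oracleScore (μ := μ) D hM g).pow_const 2)
    (hO.mono_exponent (by norm_num : (2 : ℝ≥0∞) ≤ 4)).integrable_sq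
  have hint : ∫ ω, (D.residual μ M (D.obs 0 ω) * D.treatRes μ (D.obs 0 ω)
      * groupInd M (D.obs 0 ω).2.2 g) ^ 2 ∂μ = D.SigmaDiag' μ M g * D.denom μ M g ^ 2 := by
    rw [← hD.integral_residual_sq_mul hM hreg.moment_Y g (hreg.group_prob_pos g)]
    refine integral_congr_ae (ae_of_all _ fun ω => ?_)
    change (_ * _ * groupInd M (D.X 0 ω) g) ^ 2 = _
    simp only [mul_pow, sq (groupInd M (D.X 0 ω) g), groupInd_mul_self, mul_assoc]
  rw [hint] at hlln
  have hC : TendstoInMeasure μ (fun n ω => ((2 * n : ℕ) : ℝ)⁻¹ * ∑ k, ∑ i ∈ L.fold n (U ω) k,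
      (L.epsHat M n (U ω) (D.data ω) k i * L.resA n (U ω) (D.data ω) k i
          * groupInd M (D.X i ω) g
        - D.residual μ M (D.obs i ω) * D.treatRes μ (D.obs i ω)
          * groupInd M (D.X i ω) g) ^ 2) atTop (fun _ => 0) := by
    rw [tendstoInMeasure_zero_iff]
    have h := tendstoZeroInProb_average_epsHat_sub hD hM hL hU hUD hreg g he
    refine ((h 0).add (h 1)).mono fun n ω => ?_
    rw [Fin.sum_univ_two, mul_add]
    refine (enorm_add_le _ _).trans ?_
    gcongr ?_ + ?_ <;>
    · refine (enorm_inv_natCast_mul_sum_le _ _ _).trans (le_of_eq ?_)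
      simp only [enorm_pow]
  have hbound := TendstoInMeasure.continuousAt_comp
    (g := fun y : ℝ × ℝ => y.2 + 2 * √(y.1 * y.2)) (Continuous.continuousAt (by fun_prop))
    (TendstoInMeasure.prodMk hlln hC)
  simp only [mul_zero, Real.sqrt_zero, add_zero] at hbound
  refine tendstoInMeasure_of_sub hlln
    ((tendstoInMeasure_zero_iff.1 hbound).mono fun n ω => ?_)
  rw [enorm_le_iff_norm_le, Real.norm_eq_abs, Real.norm_eq_abs]
  refine le_trans ?_ (le_abs_self _)
  simp only [hL.sum_fold n (U ω) fun k i => (L.epsHat M n (U ω) (D.data ω) k i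
      * L.resA n (U ω) (D.data ω) k i * groupInd M (D.X i ω) g) ^ 2,
    hL.sum_fold n (U ω) fun k i => (L.epsHat M n (U ω) (D.data ω) k i
      * L.resA n (U ω) (D.data ω) k i * groupInd M (D.X i ω) g
      - D.residual μ M (D.obs i ω) * D.treatRes μ (D.obs i ω) * groupInd M (D.X i ω) g) ^ 2]
  exact abs_mul_sum_sq_sub_le _ _ _ (by positivity)

/-- Consistency of the variance estimator. -/
theorem tendstoInMeasure_SigmaHat (hD : D.IsCausal μ) (hM : Measurable M)
    (hL : L.IsValid) (hU : Measurable U) (hUD : IndepFun U D.data μ)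
    (hreg : Regular D μ M L U) (g : Fin G)
    (he : ∃ eg : ℝ, ∀ᵐ x ∂(D.lawX μ), M x = g → D.propensity μ x = eg) :
    TendstoInMeasure μ (fun n ω => L.SigmaHat M n (U ω) (D.data ω) g) atTop
      (fun _ => D.SigmaDiag' μ M g) := by
  have hd := (hD.denom_pos hM g (hreg.group_prob_pos g)).ne'
  have h := TendstoInMeasure.continuousAt_comp (g := fun y : ℝ × ℝ => y.1 / y.2 ^ 2)
    (c := (D.SigmaDiag' μ M g * D.denom μ M g ^ 2, D.denom μ M g))
    (continuousAt_fst.div (continuousAt_snd.pow 2) (pow_ne_zero 2 hd))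
    (TendstoInMeasure.prodMk (tendstoInMeasure_average_epsHat_sq hD hM hL hU hUD hreg g he)
      (tendstoInMeasure_gram hD hM hL hU hUD hreg g))
  simp only [mul_div_cancel_right₀ _ (pow_ne_zero 2 hd)] at h
  convert h using 3 with n ω
  rw [CrossFit.SigmaHat, CrossFit.gram]
  push_cast
  rw [one_div]
  congr 2
  refine Finset.sum_congr rfl fun k _ => Finset.sum_congr rfl fun i _ => ?_
  change _ * groupInd M (D.X i ω) g = _
  simp only [mul_pow, sq (groupInd M (D.X i ω) g), groupInd_mul_self]

end Variance

section AsymptoticNormality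

lemma tendstoInMeasure_toLp {Ω : Type*} [MeasurableSpace Ω] {μ : Measure Ω} {G : ℕ}
    {f : ℕ → Ω → Fin G → ℝ} {a : Fin G → ℝ}
    (h : ∀ g, TendstoInMeasure μ (fun n ω => f n ω g) atTop (fun _ => a g)) :
    TendstoInMeasure μ (fun n ω => WithLp.toLp 2 (f n ω)) atTop (fun _ => WithLp.toLp 2 a) :=
  TendstoInMeasure.continuousAt_comp (PiLp.continuous_toLp 2 _).continuousAt
    (TendstoInMeasure.pi h)

variable {Ω 𝒰 : Type*} [MeasurableSpace Ω] [MeasurableSpace 𝒰] {p G : ℕ} {μ : Measure Ω}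
  [IsProbabilityMeasure μ] {D : Study Ω p} {L : CrossFit 𝒰 p} {U : Ω → 𝒰} {M : Cov p → Fin G}

/-- The influence function of the estimator. -/
noncomputable def Study.influence (D : Study Ω p) (μ : Measure Ω) [IsFiniteMeasure μ]
    (M : Cov p → Fin G) (z : Obs p) : EuclideanSpace ℝ (Fin G) :=
  WithLp.toLp 2 fun g =>
    (D.denom μ M g)⁻¹ * (D.residual μ M z * D.treatRes μ z * groupInd M z.2.2 g)

lemma Study.measurable_influence (D : Study Ω p) (hM : Measurable M) :
    Measurable (D.influence μ M) :=
  (WithLp.measurable_toLp 2 _).comp (measurable_pi_lambda _ fun g =>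
    (measurable_oracleScore D hM g).const_mul _)

lemma Study.SigmaDiag'_nonneg (D : Study Ω p) (g : Fin G) : 0 ≤ D.SigmaDiag' μ M g := by
  have hI : ∀ x, 0 ≤ groupInd M x g := fun x => by
    unfold groupInd
    split_ifs <;> simp
  refine add_nonneg (div_nonneg (integral_nonneg fun ω => ?_) (sq_nonneg _))
    (div_nonneg (integral_nonneg fun ω => ?_) (sq_nonneg _))
  · exact mul_nonneg (mul_nonneg (by positivity) (sq_nonneg _)) (hI _)
  · exact mul_nonneg (mul_nonneg (sq_nonneg _) (sq_nonneg _)) (hI _)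

lemma Study.IsCausal.integral_influence_mul (hD : D.IsCausal μ) (hM : Measurable M)
    (hY : MemLp (D.Y 0) 4 μ) (hg : ∀ g, 0 < μ.real {ω | M (D.X 0 ω) = g}) (g h : Fin G) :
    ∫ ω, D.influence μ M (D.obs 0 ω) g * D.influence μ M (D.obs 0 ω) h ∂μ
      = Matrix.diagonal (D.SigmaDiag' μ M) g h := by
  rw [Matrix.diagonal_apply]
  split_ifs with hgh
  · subst hgh
    have hd := (hD.denom_pos hM g (hg g)).ne'
    have : ∀ ω, D.influence μ M (D.obs 0 ω) g * D.influence μ M (D.obs 0 ω) g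
        = (D.denom μ M g ^ 2)⁻¹ * (D.residual μ M (D.obs 0 ω) ^ 2
          * (D.treatRes μ (D.obs 0 ω) ^ 2 * groupInd M (D.X 0 ω) g)) := fun ω => by
      rw [← groupInd_mul_self M (D.X 0 ω) g]
      simp only [Study.influence, Study.obs]
      ring
    simp only [this]
    rw [integral_const_mul, hD.integral_residual_sq_mul hM hY g (hg g)]
    field_simp
  · refine integral_eq_zero_of_ae (ae_of_all _ fun ω => ?_)
    by_cases h1 : M (D.X 0 ω) = g
    · simp [Study.influence, Study.obs, groupInd, h1, hgh]
    · simp [Study.influence, Study.obs, groupInd, h1]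

lemma tendstoInDistribution_influence (hD : D.IsCausal μ) (hM : Measurable M)
    (hY : MemLp (D.Y 0) 4 μ) (hg : ∀ g, 0 < μ.real {ω | M (D.X 0 ω) = g})
    (he : ∀ g, ∃ eg : ℝ, ∀ᵐ x ∂(D.lawX μ), M x = g → D.propensity μ x = eg) :
    TendstoInDistribution (fun (n : ℕ) ω => (√((2 * n : ℕ) : ℝ))⁻¹ •
        ∑ i ∈ Finset.range (2 * n), D.influence μ M (D.obs i ω)) atTop id
      (fun _ => μ) (multivariateGaussian 0 (Matrix.diagonal (D.SigmaDiag' μ M))) := by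
  have hm := D.measurable_influence (μ := μ) hM
  have h := tendstoInDistribution_inv_sqrt_smul_sum_multivariate
    (ξ := fun i ω => D.influence μ M (D.obs i ω)) (S := Matrix.diagonal (D.SigmaDiag' μ M))
    (hD.indep.comp (fun _ => D.influence μ M) fun _ => hm)
    (fun i => (hD.identDistrib i).comp hm)
    (fun g => ((memLp_oracleScore hD hM hY g).mono_exponent (by norm_num)).const_mul _)
    (fun g => by
      have := hD.integral_residual_mul_treatRes hM hY g (hg g).ne' (he g)
      simp only [Study.influence]
      rw [integral_const_mul]
      exact mul_eq_zero_of_right _ this)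
    (Matrix.PosSemidef.diagonal fun g => D.SigmaDiag'_nonneg g)
    (hD.integral_influence_mul hM hY hg)
  exact ⟨fun n => h.forall_aemeasurable (2 * n), h.aemeasurable_limit,
    h.tendsto.comp (tendsto_id.const_mul_atTop' (r := 2) two_pos)⟩

/-- Asymptotic normality of the standardised estimating function. -/
lemma tendstoInDistribution_score (hD : D.IsCausal μ) (hM : Measurable M)
    (hL : L.IsValid) (hU : Measurable U) (hUD : IndepFun U D.data μ)
    (hreg : Regular D μ M L U)
    (he : ∀ g, ∃ eg : ℝ, ∀ᵐ x ∂(D.lawX μ), M x = g → D.propensity μ x = eg) :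
    TendstoInDistribution (fun (n : ℕ) ω => (WithLp.toLp 2 fun g => (D.denom μ M g)⁻¹ *
        ((√((2 * n : ℕ) : ℝ))⁻¹ * L.score M n (U ω) (D.data ω) (D.tau μ M g) g) :
          EuclideanSpace ℝ (Fin G))) atTop id
      (fun _ => μ) (multivariateGaussian 0 (Matrix.diagonal (D.SigmaDiag' μ M))) := by
  refine tendstoInDistribution_of_tendstoInMeasure_sub _ _
    (tendstoInDistribution_influence hD hM hreg.moment_Y hreg.group_prob_pos he) ?_ fun n => ?_
  · have h : ∀ g, TendstoInMeasure μ (fun (n : ℕ) ω => (D.denom μ M g)⁻¹ *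
        ((√((2 * n : ℕ) : ℝ))⁻¹ * L.score M n (U ω) (D.data ω) (D.tau μ M g) g)
        - (√((2 * n : ℕ) : ℝ))⁻¹ * ∑ i ∈ Finset.range (2 * n), D.influence μ M (D.obs i ω) g)
        atTop (fun _ => 0) := fun g => by
      rw [tendstoInMeasure_zero_iff]
      refine ((tendstoZeroInProb_score_sub_oracle hD hM hL hU hUD hreg g).const_mul
        (c := ‖(D.denom μ M g)⁻¹‖ₑ) enorm_ne_top).mono fun n ω => ?_
      rw [← enorm_mul]
      refine le_of_eq (congrArg _ ?_)
      simp only [Study.influence, ← Finset.mul_sum, CrossFit.score, Study.obs, Study.data]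
      ring
    refine tendstoInMeasure_zero_iff.2
      ((tendstoInMeasure_zero_iff.1 (tendstoInMeasure_toLp h)).mono fun n ω => ?_)
    refine le_of_eq (congrArg _ ?_)
    ext g
    simp
  · refine ((WithLp.measurable_toLp 2 _).comp (measurable_pi_lambda _ fun g => ?_)).aemeasurable
    exact (((hL.measurable_score hM n _ g).comp
      (hU.prodMk hD.measurable_data)).const_mul _).const_mul _

/-- Asymptotic normality of the estimator. -/
theorem tendstoInDistribution_scaledError (hD : D.IsCausal μ) (hM : Measurable M)
    (hL : L.IsValid) (hU : Measurable U) (hUD : IndepFun U D.data μ)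
    (hreg : Regular D μ M L U)
    (he : ∀ g, ∃ eg : ℝ, ∀ᵐ x ∂(D.lawX μ), M x = g → D.propensity μ x = eg) :
    TendstoInDistribution
      (fun n ω => L.scaledError M (D.tau μ M) n (U ω) (D.data ω)) atTop id
      (fun _ => μ) (multivariateGaussian 0 (Matrix.diagonal (D.SigmaDiag' μ M))) := by
  have hd : ∀ g, D.denom μ M g ≠ 0 := fun g => (hD.denom_pos hM g (hreg.group_prob_pos g)).ne'
  have hq : TendstoInMeasure μ (fun (n : ℕ) ω (g : Fin G) => D.denom μ M g /
      (((2 * n : ℕ) : ℝ)⁻¹ * L.gram M n (U ω) (D.data ω) g)) atTop (fun _ _ => (1 : ℝ)) := by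
    refine TendstoInMeasure.pi fun g => ?_
    have := TendstoInMeasure.continuousAt_comp (g := fun y : ℝ => D.denom μ M g / y)
      (continuousAt_const.div continuousAt_id (hd g))
      (tendstoInMeasure_gram hD hM hL hU hUD hreg g)
    simpa only [div_self (hd g)] using this
  have hqm : ∀ n : ℕ, AEMeasurable (fun ω (g : Fin G) => D.denom μ M g /
      (((2 * n : ℕ) : ℝ)⁻¹ * L.gram M n (U ω) (D.data ω) g)) μ := fun n =>
    (measurable_pi_lambda _ fun g => measurable_const.div (((hL.measurable_gram hM n g).comp
      (hU.prodMk hD.measurable_data)).const_mul _)).aemeasurable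
  have hslutsky :=
    TendstoInDistribution.continuous_comp_prodMk_of_tendstoInMeasure_const
      (g := fun y : EuclideanSpace ℝ (Fin G) × (Fin G → ℝ) =>
        (WithLp.toLp 2 fun g => y.1 g * y.2 g : EuclideanSpace ℝ (Fin G)))
      (by fun_prop) (tendstoInDistribution_score hD hM hL hU hUD hreg he) hq hqm
  simp only [id, mul_one] at hslutsky
  refine tendstoInDistribution_of_tendstoInMeasure_sub _ _ hslutsky ?_ fun n =>
    ((hL.measurable_scaledError hM _ n).comp (hU.prodMk hD.measurable_data)).aemeasurable
  refine tendstoInMeasure_zero_iff.2 (tendstoZeroInProb_sub_of_eq_off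
    (tendsto_measure_gram_eq_zero hD hM hL hU hUD hreg) fun n hn ω hω => ?_)
  have hω' : ∀ g, L.gram M n (U ω) (D.data ω) g ≠ 0 := fun g hg => hω ⟨g, hg⟩
  have h0 : (0 : ℝ) < ((2 * n : ℕ) : ℝ) := by exact_mod_cast (by omega : 0 < 2 * n)
  have hs := Real.sqrt_pos.2 h0
  have hsq := Real.sq_sqrt h0.le
  ext g
  have h2 : (2 * n : ℝ) = ((2 * n : ℕ) : ℝ) := by push_cast; rfl
  simp only [CrossFit.scaledError, h2, Pi.smul_apply, Pi.sub_apply, smul_eq_mul,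
    CrossFit.tauHat_sub_eq hω']
  have := hω' g
  have := hd g
  generalize ((2 * n : ℕ) : ℝ) = N at *
  field_simp
  rw [hsq, mul_comm]

end AsymptoticNormality

end SSLS

theorem theorem5 {Ω 𝒰 : Type*} [MeasurableSpace Ω] [MeasurableSpace 𝒰]
    (μ : Measure Ω) [IsProbabilityMeasure μ] {p G : ℕ}
    (D : SSLS.Study Ω p) (hD : D.IsCausal μ)
    (M : SSLS.Cov p → Fin G) (hM : Measurable M)
    (L : SSLS.CrossFit 𝒰 p) (hL : L.IsValid)
    (U : Ω → 𝒰) (hU : Measurable U) (hUD : IndepFun U D.data μ)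
    (hreg : SSLS.Regular D μ M L U)
    (he : ∀ g, ∃ eg : ℝ, ∀ᵐ x ∂(D.lawX μ), M x = g → D.propensity μ x = eg) :
    D.Sigma' μ M = Matrix.diagonal (D.SigmaDiag' μ M) ∧
    TendstoInDistribution
      (fun n ω => L.scaledError M (D.tau μ M) n (U ω) (D.data ω)) atTop id
      (fun _ => μ) (multivariateGaussian 0 (D.Sigma' μ M)) ∧
    ∀ g, TendstoInMeasure μ
      (fun n ω => L.SigmaHat M n (U ω) (D.data ω) g) atTop
      (fun _ => D.Sigma' μ M g g) := by
  have hS := hD.Sigma'_eq_diagonal hM hreg.moment_Y hreg.group_prob_pos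
  refine ⟨hS, ?_, fun g => ?_⟩
  · rw [hS]
    exact SSLS.tendstoInDistribution_scaledError hD hM hL hU hUD hreg he
  · rw [hS, Matrix.diagonal_apply_eq]
    exact SSLS.tendstoInMeasure_SigmaHat hD hM hL hU hUD hreg g (he g)
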